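/- Let $R$ be a complete discrete valuation domain with maximal ideal generated by $\pi$ and field of fractions $Q$. Let $\Lambda$ be an $R$-order, i.e. an $R$-algebra that is finitely generated and torsion-free as an $R$-module, such that $A:=Q\Lambda=Q\otimes_R\Lambda$ is a separable $Q$-algebra. Let $\Gamma$ be a hereditary $R$-order with $\Lambda\subseteq\Gamma\subseteq A$, and let $I$ be a two-sided ideal of $\Gamma$ with $I\subseteq\operatorname{rad}(\Lambda)$ and $\pi^n\in I$ for some $n\in\mathbb N$. Put $$D:=\begin{pmatrix}\Lambda/I&\Gamma/I\\0&\Gamma/I\end{pmatrix}.$$ All modules are right modules. A $D$-module is identified with a triple $(U,V,f)$, where $U$ is a $\Lambda/I$-module, $V$ is a $\Gamma/I$-module and $f:U\to V$ is $\Lambda/I$-linear; the corresponding module is $U\times V$ with $(u,v)\begin{pmatrix}a&b\\0&c\end{pmatrix}=(ua,f(u)b+vc)$. Let $\mathcal D$ be the full subcategory of the $D$-modules $(U,V,f)$ such that $f$ is a monomorphism, $\operatorname{im}f$ generates $V$ as a $\Gamma/I$-module, and $V$ is a projective $\Gamma/I$-module. (The last condition is automatic if $\Gamma/I$ is semisimple,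 for instance if $I=\operatorname{rad}(\Lambda)=\operatorname{rad}(\Gamma)$.) Let $\mathrm{Tf}_\Lambda$ be the category of $R$-torsion-free $\Lambda$-modules. For $M\in\mathrm{Tf}_\Lambda$ let $M\Gamma$ be the $\Gamma$-submodule of $MQ=Q\otimes_RM$ generated by $M$, let $\sigma_M:M/MI\to M\Gamma/MI$ be induced by the inclusion $M\subseteq M\Gamma$, and let $$\mathbb F:\mathrm{Tf}_\Lambda\to\mathrm{Mod}\text{-}D,\qquad M\mapsto(M/MI,\;M\Gamma/MI,\;\sigma_M).$$ For a ring $S$, the Ziegler spectrum $\mathrm{Zg}_S$ is the set of isomorphism classes of indecomposable pure-injective $S$-modules, with the topology generated by the sets $(\varphi/\psi)=\{M:\varphi(M)\supsetneq\varphi(M)\cap\psi(M)\}$, where $\varphi,\psi$ are pp formulas in one variable. Let $\mathrm{Zg}_\Lambda^{tf}$ be the subspace of $\mathrm{Zg}_\Lambda$ of the $R$-torsion-free points. A module $M\in\mathrm{Tf}_\Lambda$ is $R$-reduced if $\bigcap_{i\in\mathbb N}M\pi^i=0$. Then the set of $R$-reduced points of $\mathrm{Zg}_\Lambda^{tf}$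 equals $(x=x/\pi|x)=\{M\in\mathrm{Zg}_\Lambda^{tf}:M\pi\neq M\}$ and is open in $\mathrm{Zg}_\Lambda^{tf}$; the set $\mathrm{Zg}(\mathcal D):=\mathrm{Zg}_D\cap\mathcal D$ is closed in $\mathrm{Zg}_D$; and $M\mapsto\mathbb FM$ induces a homeomorphism from the former to the latter, both with their subspace topologies. -/

import Mathlib

open CategoryTheory MulOpposite
open scoped TensorProduct

universe u

/-! Right modules over a ring `S` are modules over `Sᵐᵒᵖ`; the element `x · s` is written
`op s • x`. -/

section PositivePrimitive

/-- A (right) pp-`n`-formula `∃ y, (x y) A = 0` over `S`: the rows of the matrix `A` are indexed by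
the `n` free variables followed by the `numEx` bound variables, and each column is one equation. -/
structure PPFormula (S : Type*) (n : ℕ) where
  numEx : ℕ
  numEq : ℕ
  mat : Matrix (Fin n ⊕ Fin numEx) (Fin numEq) S

/-- The solution set `φ(M) ⊆ Mⁿ` of a pp-`n`-formula in a right `S`-module `M`. -/
def PPFormula.sol {S : Type*} [Ring S] {n : ℕ} (φ : PPFormula S n)
    (M : Type*) [AddCommGroup M] [Module Sᵐᵒᵖ M] : Set (Fin n → M) :=
  {x | ∃ y : Fin φ.numEx → M, ∀ j, ∑ i, op (φ.mat i j) • Sum.elim x y i = 0}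

/-- The formula `x = x`. -/
def PPFormula.top (S : Type*) : PPFormula S 1 where
  numEx := 0
  numEq := 0
  mat := fun _ j => j.elim0

/-- The formula `s | x`, that is, `∃ y, x + y · (-s) = 0`. -/
def PPFormula.dvd {S : Type*} [Ring S] (s : S) : PPFormula S 1 where
  numEx := 1
  numEq := 1
  mat := fun i _ => Sum.elim (fun _ => 1) (fun _ => -s) i

/-- Pure embeddings: `φ(B) ∩ iM = i φ(M)` for all pp-`1`-formulas `φ`. -/
def IsPureEmbedding {S : Type*} [Ring S] {M B : Type*} [AddCommGroup M] [Module Sᵐᵒᵖ M]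
    [AddCommGroup B] [Module Sᵐᵒᵖ B] (f : M →ₗ[Sᵐᵒᵖ] B) : Prop :=
  Function.Injective f ∧
    ∀ (φ : PPFormula S 1) (x : Fin 1 → M), (fun i => f (x i)) ∈ φ.sol B ↔ x ∈ φ.sol M

/-- A right `S`-module is pure-injective if every pure embedding of it splits. -/
def IsPureInjective {S : Type u} [Ring S] (M : ModuleCat.{u} Sᵐᵒᵖ) : Prop :=
  ∀ (B : ModuleCat.{u} Sᵐᵒᵖ) (f : M ⟶ B), IsPureEmbedding f.hom → IsSplitMono f

end PositivePrimitive

section ZieglerSpectrum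

/-- The modules that represent points of the Ziegler spectrum. -/
def IsZgModule {S : Type u} [Ring S] (M : ModuleCat.{u} Sᵐᵒᵖ) : Prop :=
  Indecomposable M ∧ IsPureInjective M

/-- The (right) Ziegler spectrum of `S`: isomorphism classes of indecomposable pure-injective
right `S`-modules. (Every such module has at most `2 ^ (|S| + ℵ₀)` elements, so none is lost by
staying in the universe of `S`.) -/
def Zg (S : Type u) [Ring S] : Type (u + 1) :=
  Quotient ((isIsomorphicSetoid (ModuleCat.{u} Sᵐᵒᵖ)).comap
    (Subtype.val : {M : ModuleCat.{u} Sᵐᵒᵖ // IsZgModule M} → ModuleCat.{u} Sᵐᵒᵖ))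

/-- The isomorphism class of an indecomposable pure-injective module. -/
def Zg.mk {S : Type u} [Ring S] (M : ModuleCat.{u} Sᵐᵒᵖ) (h : IsZgModule M) : Zg S :=
  Quotient.mk _ ⟨M, h⟩

/-- `Zg_S ∩ 𝒞` for a class `𝒞` of modules (closed under isomorphism in all uses). -/
def Zg.inter (S : Type u) [Ring S] (C : ModuleCat.{u} Sᵐᵒᵖ → Prop) : Set (Zg S) :=
  {p | ∃ (M : ModuleCat.{u} Sᵐᵒᵖ) (h : IsZgModule M), Zg.mk M h = p ∧ C M}

/-- The basic open set `(φ/ψ)`, consisting of the `M` with `φ(M) ⊋ ψ(M) ∩ φ(M)`. -/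
def Zg.basicOpen {S : Type u} [Ring S] (φ ψ : PPFormula S 1) : Set (Zg S) :=
  Zg.inter S fun M => ψ.sol M ∩ φ.sol M ⊂ φ.sol M

instance Zg.instTopologicalSpace (S : Type u) [Ring S] : TopologicalSpace (Zg S) :=
  TopologicalSpace.generateFrom {U | ∃ φ ψ : PPFormula S 1, U = Zg.basicOpen φ ψ}

end ZieglerSpectrum

section Orders

/-- A separable algebra over a field: it is finite-dimensional and stays semisimple under every
extension of the base field. -/
def IsSeparableAlg (Q : Type u) [Field Q] (A : Type u) [Ring A] [Algebra Q A] : Prop :=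
  Module.Finite Q A ∧
    ∀ (L : Type u) [Field L] [Algebra Q L], IsSemisimpleRing (L ⊗[Q] A)

/-- Right hereditary rings: every right ideal is projective. (For two-sided noetherian rings, in
particular for orders, this is the same as being left hereditary.) -/
def IsRightHereditary (S : Type*) [Ring S] : Prop :=
  ∀ J : Submodule Sᵐᵒᵖ S, Module.Projective Sᵐᵒᵖ J

variable (R : Type u) {Λ : Type u} [CommRing R] [Ring Λ] [Algebra R Λ]

/-- `R`-torsion-free right `Λ`-modules. -/
def IsTorsionFreeModule (M : ModuleCat.{u} Λᵐᵒᵖ) : Prop :=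
  ∀ (r : R) (m : M), op (algebraMap R Λ r) • m = 0 → r = 0 ∨ m = 0

variable (Λ) in
/-- The category of `R`-torsion-free right `Λ`-modules, a full subcategory of all modules. -/
abbrev Tf : Type (u + 1) :=
  ObjectProperty.FullSubcategory (C := ModuleCat.{u} Λᵐᵒᵖ) (IsTorsionFreeModule R)

variable {R} in
/-- `R`-reduced modules: the intersection of all `M πⁱ` is zero. -/
def IsReducedModule (π : R) (M : ModuleCat.{u} Λᵐᵒᵖ) : Prop :=
  ∀ m : M, (∀ i : ℕ, ∃ m' : M, op (algebraMap R Λ (π ^ i)) • m' = m) → m = 0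

variable (Λ) in
/-- The torsion-free part of the Ziegler spectrum of `Λ` (with the subspace topology). -/
def ZgTf : Set (Zg Λ) := Zg.inter Λ (IsTorsionFreeModule R)

variable (Λ) {R} in
/-- The set of `R`-reduced points of the torsion-free part of the Ziegler spectrum. -/
def ZgTf.reduced (π : R) : Set (ZgTf R Λ) :=
  {p | (p : Zg Λ) ∈ Zg.inter Λ (IsReducedModule π)}

variable (Λ) {R} in
/-- The set `(x = x / π | x)` in the torsion-free part of the Ziegler spectrum. -/
def ZgTf.notDivisible (π : R) : Set (ZgTf R Λ) :=
  {p | (p : Zg Λ) ∈ Zg.basicOpen (PPFormula.top Λ) (PPFormula.dvd (algebraMap R Λ π))}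

end Orders

section Triangular

/-- For a ring homomorphism `ι : S → T`, the ring of matrices `(a b; 0 c)` with `a ∈ S` and
`b, c ∈ T`. -/
@[ext]
structure TriangularRing {S T : Type*} [Ring S] [Ring T] (ι : S →+* T) where
  a : S
  b : T
  c : T

namespace TriangularRing

variable {S T : Type*} [Ring S] [Ring T] {ι : S →+* T}

instance : Zero (TriangularRing ι) := ⟨⟨0, 0, 0⟩⟩
instance : One (TriangularRing ι) := ⟨⟨1, 0, 1⟩⟩
instance : Add (TriangularRing ι) := ⟨fun x y => ⟨x.a + y.a, x.b + y.b, x.c + y.c⟩⟩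
instance : Neg (TriangularRing ι) := ⟨fun x => ⟨-x.a, -x.b, -x.c⟩⟩
instance : Mul (TriangularRing ι) :=
  ⟨fun x y => ⟨x.a * y.a, ι x.a * y.b + x.b * y.c, x.c * y.c⟩⟩

@[simp] theorem zero_a : (0 : TriangularRing ι).a = 0 := rfl
@[simp] theorem zero_b : (0 : TriangularRing ι).b = 0 := rfl
@[simp] theorem zero_c : (0 : TriangularRing ι).c = 0 := rfl
@[simp] theorem one_a : (1 : TriangularRing ι).a = 1 := rfl
@[simp] theorem one_b : (1 : TriangularRing ι).b = 0 := rfl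
@[simp] theorem one_c : (1 : TriangularRing ι).c = 1 := rfl
@[simp] theorem add_a (x y : TriangularRing ι) : (x + y).a = x.a + y.a := rfl
@[simp] theorem add_b (x y : TriangularRing ι) : (x + y).b = x.b + y.b := rfl
@[simp] theorem add_c (x y : TriangularRing ι) : (x + y).c = x.c + y.c := rfl
@[simp] theorem neg_a (x : TriangularRing ι) : (-x).a = -x.a := rfl
@[simp] theorem neg_b (x : TriangularRing ι) : (-x).b = -x.b := rfl
@[simp] theorem neg_c (x : TriangularRing ι) : (-x).c = -x.c := rfl
@[simp] theorem mul_a (x y : TriangularRing ι) : (x * y).a = x.a * y.a := rfl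
@[simp] theorem mul_b (x y : TriangularRing ι) : (x * y).b = ι x.a * y.b + x.b * y.c := rfl
@[simp] theorem mul_c (x y : TriangularRing ι) : (x * y).c = x.c * y.c := rfl

instance : Ring (TriangularRing ι) where
  add_assoc _ _ _ := by ext <;> simp [add_assoc]
  zero_add _ := by ext <;> simp
  add_zero _ := by ext <;> simp
  add_comm _ _ := by ext <;> simp [add_comm]
  neg_add_cancel _ := by ext <;> simp
  mul_assoc _ _ _ := by ext <;> simp [mul_add, add_mul, mul_assoc, add_assoc]
  one_mul _ := by ext <;> simp
  mul_one _ := by ext <;> simp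
  zero_mul _ := by ext <;> simp
  mul_zero _ := by ext <;> simp
  left_distrib _ _ _ := by
    ext <;> simp only [mul_a, mul_b, mul_c, add_a, add_b, add_c, mul_add] <;> abel
  right_distrib _ _ _ := by
    ext <;> simp only [mul_a, mul_b, mul_c, add_a, add_b, add_c, add_mul, map_add] <;> abel
  nsmul := nsmulRec
  zsmul := zsmulRec

end TriangularRing

/-- The underlying group `U × V` of the right module over `(S T; 0 T)` that corresponds to a triple
`(U, V, f)`, where `U` is a right `S`-module, `V` is a right `T`-module and `f : U → V` is
`S`-linear when `S` acts on `V` along `ι`. -/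
@[nolint unusedArguments]
def TripleModule {S T : Type*} [Ring S] [Ring T] {ι : S →+* T}
    {U V : Type*} [AddCommGroup U] [Module Sᵐᵒᵖ U] [AddCommGroup V] [Module Tᵐᵒᵖ V]
    (_f : U →ₛₗ[RingHom.op ι] V) : Type _ := U × V

namespace TripleModule

variable {S T : Type*} [Ring S] [Ring T] {ι : S →+* T}
  {U V : Type*} [AddCommGroup U] [Module Sᵐᵒᵖ U] [AddCommGroup V] [Module Tᵐᵒᵖ V]
  (f : U →ₛₗ[RingHom.op ι] V)

instance : AddCommGroup (TripleModule f) := inferInstanceAs (AddCommGroup (U × V))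

/-- `(u, v) · (a b; 0 c) = (u a, f(u) b + v c)`. -/
instance : Module (TriangularRing ι)ᵐᵒᵖ (TripleModule f) where
  smul d x := (op d.unop.a • x.1, op d.unop.b • f x.1 + op d.unop.c • x.2)
  one_smul := fun (u, v) => Prod.ext (one_smul _ u)
    (show op (0 : T) • f u + op (1 : T) • v = v by simp)
  mul_smul := fun d e (u, v) => Prod.ext (mul_smul (op d.unop.a) (op e.unop.a) u) (by
    change op (ι e.unop.a * d.unop.b + e.unop.b * d.unop.c) • f u
        + op (e.unop.c * d.unop.c) • v
      = op d.unop.b • f (op e.unop.a • u)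
        + op d.unop.c • (op e.unop.b • f u + op e.unop.c • v)
    rw [f.map_smulₛₗ]
    simp [add_smul, mul_smul, add_assoc])
  smul_zero d := Prod.ext (smul_zero (op d.unop.a))
    (show op d.unop.b • f 0 + op d.unop.c • (0 : V) = 0 by simp)
  smul_add := fun d (u, v) (u', v') => Prod.ext (smul_add (op d.unop.a) u u') (by
    change op d.unop.b • f (u + u') + op d.unop.c • (v + v')
      = (op d.unop.b • f u + op d.unop.c • v) + (op d.unop.b • f u' + op d.unop.c • v')
    simp only [map_add, smul_add]; abel)
  add_smul := fun d e (u, v) => Prod.ext (add_smul (op d.unop.a) (op e.unop.a) u) (by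
    change op (d.unop.b + e.unop.b) • f u + op (d.unop.c + e.unop.c) • v
      = (op d.unop.b • f u + op d.unop.c • v) + (op e.unop.b • f u + op e.unop.c • v)
    simp only [MulOpposite.op_add, add_smul]; abel)
  zero_smul := fun (u, v) => Prod.ext (zero_smul _ u)
    (show op (0 : T) • f u + op (0 : T) • v = 0 by simp)

variable {f}
variable {U' V' : Type*} [AddCommGroup U'] [Module Sᵐᵒᵖ U'] [AddCommGroup V'] [Module Tᵐᵒᵖ V']
  {f' : U' →ₛₗ[RingHom.op ι] V'}

/-- The module homomorphism that corresponds to a morphism `(α, β)` of triples. -/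
def map (α : U →ₗ[Sᵐᵒᵖ] U') (β : V →ₗ[Tᵐᵒᵖ] V') (h : ∀ u, β (f u) = f' (α u)) :
    TripleModule f →ₗ[(TriangularRing ι)ᵐᵒᵖ] TripleModule f' where
  toFun x := (α x.1, β x.2)
  map_add' := fun (u, v) (u', v') => Prod.ext (map_add α u u') (map_add β v v')
  map_smul' := fun d (u, v) => Prod.ext (map_smul α (op d.unop.a) u) (by
    change β (op d.unop.b • f u + op d.unop.c • v)
      = op d.unop.b • f' (α u) + op d.unop.c • β v
    rw [map_add, map_smul, map_smul, h])

end TripleModule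

/-- The class `𝒟` of the right modules over `(S T; 0 T)` that correspond to triples `(U, V, f)` such
that `f` is a monomorphism, the image of `f` generates `V` over `T`, and `V` is projective
over `T` (which is automatic if `T` is semisimple). -/
def IsGeneratingMonoTriple {S T : Type u} [Ring S] [Ring T] (ι : S →+* T)
    (X : ModuleCat.{u} (TriangularRing ι)ᵐᵒᵖ) : Prop :=
  ∃ (U V : Type u) (_ : AddCommGroup U) (_ : Module Sᵐᵒᵖ U) (_ : AddCommGroup V)
    (_ : Module Tᵐᵒᵖ V) (f : U →ₛₗ[RingHom.op ι] V),
    Function.Injective f ∧ Submodule.span Tᵐᵒᵖ (Set.range f) = ⊤ ∧ Module.Projective Tᵐᵒᵖ V ∧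
      Nonempty (X ≅ ModuleCat.of (TriangularRing ι)ᵐᵒᵖ (TripleModule f))

end Triangular

section QuotientAction

/-- A right `S`-module that is annihilated by a two-sided ideal `J` is a right `S/J`-module. -/
abbrev quotientRightModule {S : Type*} [Ring S] (J : Ideal S) [J.IsTwoSided]
    (X : Type*) [AddCommGroup X] [Module Sᵐᵒᵖ X]
    (h : ∀ s ∈ J, ∀ x : X, op s • x = 0) : Module (S ⧸ J)ᵐᵒᵖ X :=
  let act : S →+ AddMonoid.End X :=
    (Module.toAddMonoidEnd Sᵐᵒᵖ X).toAddMonoidHom.comp (opAddEquiv (α := S)).toAddMonoidHom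
  let qact : S ⧸ J →+ AddMonoid.End X :=
    QuotientAddGroup.lift J.toAddSubgroup act fun s hs => AddMonoidHom.ext (h s hs)
  { smul := fun s x => qact s.unop x
    one_smul := fun x => one_smul Sᵐᵒᵖ x
    mul_smul := fun s t x => by
      obtain ⟨s, rfl⟩ := op_surjective s
      obtain ⟨t, rfl⟩ := op_surjective t
      obtain ⟨s, rfl⟩ := Ideal.Quotient.mk_surjective s
      obtain ⟨t, rfl⟩ := Ideal.Quotient.mk_surjective t
      exact mul_smul (op s) (op t) x
    smul_zero := fun s => map_zero (qact s.unop)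
    smul_add := fun s => map_add (qact s.unop)
    add_smul := fun s t x => by
      change qact (s.unop + t.unop) x = qact s.unop x + qact t.unop x
      rw [map_add]; rfl
    zero_smul := fun x => by
      change qact 0 x = 0
      rw [map_zero]; rfl }

end QuotientAction

noncomputable section Functor

/-- `M Q = Q ⊗ M` for a right `Λ`-module `M`. -/
def ModQ (R Q M : Type u) [CommRing R] [Field Q] [Algebra R Q] [AddCommGroup M] [Module R M] :
    Type u := Q ⊗[R] M

instance (R Q M : Type u) [CommRing R] [Field Q] [Algebra R Q] [AddCommGroup M]
    [Module R M] : AddCommGroup (ModQ R Q M) := inferInstanceAs (AddCommGroup (Q ⊗[R] M))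

section Action

variable {R Q Λ M : Type u} [CommRing R] [Field Q] [Algebra R Q] [Ring Λ] [Algebra R Λ]
  [AddCommGroup M] [Module R M] [Module Λᵐᵒᵖ M] [IsScalarTower R Λᵐᵒᵖ M]

variable (R) in
/-- The element `q ⊗ m` of `M Q`. -/
def ModQ.tmul (q : Q) (m : M) : ModQ R Q M := q ⊗ₜ[R] m

variable (R Q Λ M) in
/-- The bilinear map `Q Λ × M Q → M Q` with `(q ⊗ s, p ⊗ m) ↦ q p ⊗ m s`. -/
def ModQ.act : Q ⊗[R] Λ →ₗ[R] Q ⊗[R] M →ₗ[R] Q ⊗[R] M :=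
  TensorProduct.map₂ (LinearMap.mul R Q)
    ((Algebra.lsmul R R M).toLinearMap ∘ₗ (opLinearEquiv R : Λ ≃ₗ[R] Λᵐᵒᵖ).toLinearMap)

theorem ModQ.act_tmul (q p : Q) (s : Λ) (m : M) :
    ModQ.act R Q Λ M (q ⊗ₜ s) (p ⊗ₜ m) = (q * p) ⊗ₜ (op s • m) := rfl

theorem ModQ.one_act (x : Q ⊗[R] M) : ModQ.act R Q Λ M 1 x = x := by
  change ModQ.act R Q Λ M (1 ⊗ₜ 1) x = x
  induction x using TensorProduct.induction_on with
  | zero => simp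
  | tmul p m => simp [ModQ.act_tmul]
  | add x y hx hy => rw [map_add, hx, hy]

theorem ModQ.mul_act (a b : Q ⊗[R] Λ) (x : Q ⊗[R] M) :
    ModQ.act R Q Λ M (b * a) x = ModQ.act R Q Λ M a (ModQ.act R Q Λ M b x) := by
  induction x using TensorProduct.induction_on with
  | zero => simp
  | add x y hx hy => simp only [map_add, hx, hy]
  | tmul p m =>
    induction a using TensorProduct.induction_on with
    | zero => simp
    | add x y hx hy => simp only [mul_add, map_add, LinearMap.add_apply, hx, hy]
    | tmul q s =>
      induction b using TensorProduct.induction_on with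
      | zero => simp
      | add x y hx hy => simp only [add_mul, map_add, LinearMap.add_apply, hx, hy]
      | tmul q' s' =>
        simp only [Algebra.TensorProduct.tmul_mul_tmul, ModQ.act_tmul, op_mul, mul_smul]
        congr 1; ring

/-- `M Q` is a right module over `Q Λ = Q ⊗ Λ`, with `(p ⊗ m) · (q ⊗ s) = q p ⊗ m s`. -/
instance ModQ.instModule : Module (Q ⊗[R] Λ)ᵐᵒᵖ (ModQ R Q M) where
  smul a x := ModQ.act R Q Λ M a.unop x
  one_smul x := ModQ.one_act x
  mul_smul a b x := ModQ.mul_act a.unop b.unop x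
  smul_zero a := map_zero (ModQ.act R Q Λ M a.unop)
  smul_add a := map_add (ModQ.act R Q Λ M a.unop)
  add_smul a b x := LinearMap.congr_fun (map_add (ModQ.act R Q Λ M) a.unop b.unop) x
  zero_smul x := LinearMap.congr_fun (map_zero (ModQ.act R Q Λ M)) x

theorem ModQ.op_tmul_smul (q p : Q) (s : Λ) (m : M) :
    (op (q ⊗ₜ s : Q ⊗[R] Λ)) • ModQ.tmul R p m = ModQ.tmul R (q * p) (op s • m) := rfl

/-- `M Q` as a right module over an order in `Q Λ`. -/
instance ModQ.instModuleOrder (Γ : Subalgebra R (Q ⊗[R] Λ)) : Module Γᵐᵒᵖ (ModQ R Q M) :=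
  Module.compHom _ (RingHom.op (Γ.val : Γ →+* Q ⊗[R] Λ))

theorem ModQ.op_smul_order {Γ : Subalgebra R (Q ⊗[R] Λ)} (g : Γ) (x : ModQ R Q M) :
    op g • x = op (g : Q ⊗[R] Λ) • x := rfl

end Action

variable {R Q Λ : Type u} [CommRing R] [Field Q] [Algebra R Q] [Ring Λ] [Algebra R Λ]

/-- The inclusion `Λ ⊆ Γ ⊆ Q Λ` as a ring homomorphism. -/
def orderIncl {Γ : Subalgebra R (Q ⊗[R] Λ)}
    (hΓ : (Algebra.TensorProduct.includeRight : Λ →ₐ[R] Q ⊗[R] Λ).range ≤ Γ) : Λ →+* Γ :=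
  ((Algebra.TensorProduct.includeRight : Λ →ₐ[R] Q ⊗[R] Λ).codRestrict Γ
    fun s => hΓ ⟨s, rfl⟩ : Λ →ₐ[R] Γ)

theorem coe_orderIncl {Γ : Subalgebra R (Q ⊗[R] Λ)}
    (hΓ : (Algebra.TensorProduct.includeRight : Λ →ₐ[R] Q ⊗[R] Λ).range ≤ Γ) (s : Λ) :
    (orderIncl hΓ s : Q ⊗[R] Λ) = 1 ⊗ₜ s := rfl

variable {Γ : Subalgebra R (Q ⊗[R] Λ)}
  (hΓ : (Algebra.TensorProduct.includeRight : Λ →ₐ[R] Q ⊗[R] Λ).range ≤ Γ)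
  (I : Ideal Γ) [I.IsTwoSided]

/-- The ideal `I` of `Γ`, intersected with `Λ`. (It is `I` itself if `I ⊆ Λ`.) -/
abbrev idealInΛ : Ideal Λ := I.comap (orderIncl hΓ)

/-- The ring homomorphism `Λ/I → Γ/I`. -/
abbrev quotIncl : Λ ⧸ idealInΛ hΓ I →+* Γ ⧸ I := Ideal.quotientMap I (orderIncl hΓ) le_rfl

/-- The ring `D = (Λ/I Γ/I; 0 Γ/I)`. -/
abbrev RingD : Type u := TriangularRing (quotIncl hΓ I)

section Objects

variable (M : Type u) [AddCommGroup M] [Module R M] [Module Λᵐᵒᵖ M] [IsScalarTower R Λᵐᵒᵖ M]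

/-- `M I` as a `Λ`-submodule of `M`. -/
def subMI : Submodule Λᵐᵒᵖ M :=
  Submodule.span Λᵐᵒᵖ {x | ∃ s ∈ idealInΛ hΓ I, ∃ m : M, op s • m = x}

variable (Γ) in
/-- `M Γ`, the `Γ`-submodule of `M Q` generated by (the image of) `M`. -/
def spanMΓ : Submodule Γᵐᵒᵖ (ModQ R Q M) :=
  Submodule.span Γᵐᵒᵖ (Set.range fun m : M => ModQ.tmul R (1 : Q) m)

variable (Γ) in
/-- `M Γ` as a right `Γ`-module. -/
def ModΓ : Type u := spanMΓ Γ M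

instance : AddCommGroup (ModΓ Γ M) := inferInstanceAs (AddCommGroup (spanMΓ Γ M))

instance : Module Γᵐᵒᵖ (ModΓ Γ M) := inferInstanceAs (Module Γᵐᵒᵖ (spanMΓ Γ M))

/-- The map `M → M Γ`, an inclusion if `M` is torsion-free. -/
def toMΓ (m : M) : ModΓ Γ M := ⟨ModQ.tmul R (1 : Q) m, Submodule.subset_span ⟨m, rfl⟩⟩

/-- `M I` as a `Γ`-submodule of `M Γ`. -/
def subMΓI : Submodule Γᵐᵒᵖ (ModΓ Γ M) :=
  Submodule.span Γᵐᵒᵖ {x | ∃ g ∈ I, ∃ m : M, op g • toMΓ M m = x}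

theorem toMΓ_smul (s : Λ) (m : M) :
    toMΓ M (op s • m) = op (orderIncl hΓ s) • (toMΓ M m : ModΓ Γ M) := by
  apply Subtype.ext
  change ModQ.tmul R (1 : Q) (op s • m) = op ((1 : Q) ⊗ₜ[R] s) • ModQ.tmul R (1 : Q) m
  rw [ModQ.op_tmul_smul, one_mul]

/-- The inclusion `M → M Γ` as a homomorphism of `Λ`-modules. -/
def inclMΓ : M →ₛₗ[RingHom.op (orderIncl hΓ)] ModΓ Γ M where
  toFun := toMΓ M
  map_add' m m' := Subtype.ext (TensorProduct.tmul_add _ m m')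
  map_smul' s m := toMΓ_smul hΓ M s.unop m

/-- `M / M I`. -/
abbrev quotM : Type u := M ⧸ subMI hΓ I M

/-- `M Γ / M I`. -/
abbrev quotMΓ : Type u := ModΓ Γ M ⧸ subMΓI I M

theorem smul_mem_subMΓI (x : ModΓ Γ M) : ∀ g ∈ I, op g • x ∈ subMΓI I M := by
  obtain ⟨x, hx⟩ := x
  induction hx using Submodule.span_induction with
  | mem x h =>
    obtain ⟨m, rfl⟩ := h
    exact fun g hg => Submodule.subset_span ⟨g, hg, m, rfl⟩
  | zero =>
    intro g _
    exact (smul_zero (op g) : op g • (0 : ModΓ Γ M) = 0) ▸ zero_mem _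
  | add x y hx hy ihx ihy =>
    intro g hg
    exact (smul_add (op g) (⟨x, hx⟩ : ModΓ Γ M) ⟨y, hy⟩) ▸ add_mem (ihx g hg) (ihy g hg)
  | smul c x hx ih =>
    intro g hg
    exact (mul_smul (op g) c (⟨x, hx⟩ : ModΓ Γ M)) ▸ ih (c.unop * g) (I.mul_mem_left _ hg)

instance quotM.instModule : Module (Λ ⧸ idealInΛ hΓ I)ᵐᵒᵖ (quotM hΓ I M) :=
  quotientRightModule (idealInΛ hΓ I) (M ⧸ subMI hΓ I M) (by
    intro s hs x
    obtain ⟨m, rfl⟩ := Submodule.Quotient.mk_surjective _ x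
    rw [← Submodule.Quotient.mk_smul, Submodule.Quotient.mk_eq_zero]
    exact Submodule.subset_span ⟨s, hs, m, rfl⟩)

instance quotMΓ.instModule : Module (Γ ⧸ I)ᵐᵒᵖ (quotMΓ I M) :=
  quotientRightModule I (ModΓ Γ M ⧸ subMΓI I M) (by
    intro g hg x
    obtain ⟨y, rfl⟩ := Submodule.Quotient.mk_surjective _ x
    rw [← Submodule.Quotient.mk_smul, Submodule.Quotient.mk_eq_zero]
    exact smul_mem_subMΓI I M y g hg)

theorem quotM.mk_smul (s : Λ) (x : quotM hΓ I M) :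
    op (Ideal.Quotient.mk (idealInΛ hΓ I) s) • x = op s • x := rfl

theorem quotMΓ.mk_smul (g : Γ) (x : quotMΓ I M) :
    op (Ideal.Quotient.mk I g) • x = op g • x := rfl

/-- The map `σ_M : M / M I → M Γ / M I` induced by the inclusion, over `Λ`. -/
def sigmaAux : quotM hΓ I M →ₛₗ[RingHom.op (orderIncl hΓ)] quotMΓ I M :=
  (subMI hΓ I M).liftQ ((subMΓI I M).mkQ.comp (inclMΓ hΓ M)) (by
    rw [subMI, Submodule.span_le]
    rintro _ ⟨s, hs, m, rfl⟩
    rw [SetLike.mem_coe, LinearMap.mem_ker]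
    refine (Submodule.Quotient.mk_eq_zero _).2 ?_
    exact Submodule.subset_span ⟨orderIncl hΓ s, hs, m, (toMΓ_smul hΓ M s m).symm⟩)

/-- The map `σ_M : M / M I → M Γ / M I` induced by the inclusion, over `Λ / I`. -/
def sigma : quotM hΓ I M →ₛₗ[RingHom.op (quotIncl hΓ I)] quotMΓ I M where
  toFun := sigmaAux hΓ I M
  map_add' := map_add _
  map_smul' s x := by
    obtain ⟨s, rfl⟩ := op_surjective s
    obtain ⟨s, rfl⟩ := Ideal.Quotient.mk_surjective s
    exact (sigmaAux hΓ I M).map_smulₛₗ (op s) x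

theorem sigma_mk (m : M) :
    sigma hΓ I M (Submodule.Quotient.mk m) = Submodule.Quotient.mk (toMΓ M m) := rfl

end Objects

section Morphisms

variable {M N : Type u} [AddCommGroup M] [Module R M] [Module Λᵐᵒᵖ M] [IsScalarTower R Λᵐᵒᵖ M]
  [AddCommGroup N] [Module R N] [Module Λᵐᵒᵖ N] [IsScalarTower R Λᵐᵒᵖ N]
  (g : M →ₗ[Λᵐᵒᵖ] N)

theorem lTensor_act (a : Q ⊗[R] Λ) (x : Q ⊗[R] M) :
    (g.restrictScalars R).lTensor Q (ModQ.act R Q Λ M a x)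
      = ModQ.act R Q Λ N a ((g.restrictScalars R).lTensor Q x) := by
  induction x using TensorProduct.induction_on with
  | zero => simp
  | add x y hx hy => simp only [map_add, hx, hy]
  | tmul p m =>
    induction a using TensorProduct.induction_on with
    | zero => simp
    | add a b ha hb => simp only [map_add, LinearMap.add_apply, ha, hb]
    | tmul q s =>
      simp only [ModQ.act_tmul, LinearMap.lTensor_tmul, LinearMap.coe_restrictScalars, map_smul]

variable (Q) in
/-- The homomorphism `M Q → N Q` induced by `g : M → N`. -/
def mapModQ : ModQ R Q M →ₗ[(Q ⊗[R] Λ)ᵐᵒᵖ] ModQ R Q N where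
  toFun := (g.restrictScalars R).lTensor Q
  map_add' := map_add ((g.restrictScalars R).lTensor Q)
  map_smul' a x := lTensor_act g a.unop x

theorem mapModQ_tmul (q : Q) (m : M) :
    mapModQ (R := R) Q g (ModQ.tmul R q m) = ModQ.tmul R q (g m) := rfl

variable (Γ) in
/-- `M Q → N Q` as a homomorphism of `Γ`-modules. -/
def mapModQOrder : ModQ R Q M →ₗ[Γᵐᵒᵖ] ModQ R Q N where
  toFun := mapModQ Q g
  map_add' := map_add _
  map_smul' a x := (mapModQ Q g).map_smul (op (a.unop : Q ⊗[R] Λ)) x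

variable (Γ) in
/-- The homomorphism `M Γ → N Γ` induced by `g : M → N`. -/
def mapMΓ : ModΓ Γ M →ₗ[Γᵐᵒᵖ] ModΓ Γ N :=
  (mapModQOrder Γ g).restrict (p := spanMΓ Γ M) (q := spanMΓ Γ N) (by
    intro x hx
    have hle : spanMΓ Γ M ≤ (spanMΓ Γ N).comap (mapModQOrder Γ g) := by
      rw [spanMΓ, Submodule.span_le]
      rintro _ ⟨m, rfl⟩
      exact Submodule.subset_span ⟨g m, rfl⟩
    exact hle hx)

theorem mapMΓ_toMΓ (m : M) : mapMΓ Γ g (toMΓ M m) = toMΓ N (g m) := rfl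

/-- The homomorphism `M / M I → N / N I` induced by `g : M → N`. -/
def mapQuotM : quotM hΓ I M →ₗ[(Λ ⧸ idealInΛ hΓ I)ᵐᵒᵖ] quotM hΓ I N where
  toFun := (subMI hΓ I M).mapQ (subMI hΓ I N) g (by
    rw [subMI, Submodule.span_le]
    rintro _ ⟨s, hs, m, rfl⟩
    exact Submodule.subset_span ⟨s, hs, g m, (map_smul g (op s) m).symm⟩)
  map_add' := map_add _
  map_smul' s x := by
    obtain ⟨s, rfl⟩ := op_surjective s
    obtain ⟨s, rfl⟩ := Ideal.Quotient.mk_surjective s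
    exact map_smul ((subMI hΓ I M).mapQ (subMI hΓ I N) g _) (op s) x

/-- The homomorphism `M Γ / M I → N Γ / N I` induced by `g : M → N`. -/
def mapQuotMΓ : quotMΓ I M →ₗ[(Γ ⧸ I)ᵐᵒᵖ] quotMΓ I N where
  toFun := (subMΓI I M).mapQ (subMΓI I N) (mapMΓ Γ g) (by
    rw [subMΓI, Submodule.span_le]
    rintro _ ⟨s, hs, m, rfl⟩
    exact Submodule.subset_span ⟨s, hs, g m, by rw [map_smul, mapMΓ_toMΓ]⟩)
  map_add' := map_add _
  map_smul' s x := by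
    obtain ⟨s, rfl⟩ := op_surjective s
    obtain ⟨s, rfl⟩ := Ideal.Quotient.mk_surjective s
    exact map_smul ((subMΓI I M).mapQ (subMΓI I N) (mapMΓ Γ g) _) (op s) x

/-- The `D`-module homomorphism induced by `g : M → N`. -/
def mapTriple : TripleModule (sigma hΓ I M) →ₗ[(RingD hΓ I)ᵐᵒᵖ] TripleModule (sigma hΓ I N) :=
  TripleModule.map (mapQuotM hΓ I g) (mapQuotMΓ I g) (by
    intro u
    obtain ⟨m, rfl⟩ := Submodule.Quotient.mk_surjective _ u
    rfl)

theorem mapMΓ_id (x : ModΓ Γ M) : mapMΓ Γ (LinearMap.id : M →ₗ[Λᵐᵒᵖ] M) x = x :=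
  Subtype.ext (LinearMap.lTensor_id_apply Q M x.1)

theorem mapMΓ_comp {P : Type u} [AddCommGroup P] [Module R P] [Module Λᵐᵒᵖ P]
    [IsScalarTower R Λᵐᵒᵖ P] (h : N →ₗ[Λᵐᵒᵖ] P) (x : ModΓ Γ M) :
    mapMΓ Γ (h ∘ₗ g) x = mapMΓ Γ h (mapMΓ Γ g x) :=
  Subtype.ext (LinearMap.lTensor_comp_apply Q (h.restrictScalars R) (g.restrictScalars R) x.1)

theorem mapTriple_id : mapTriple hΓ I (LinearMap.id : M →ₗ[Λᵐᵒᵖ] M) = LinearMap.id := by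
  apply LinearMap.ext
  rintro ⟨u, v⟩
  obtain ⟨m, rfl⟩ := Submodule.Quotient.mk_surjective _ u
  obtain ⟨y, rfl⟩ := Submodule.Quotient.mk_surjective _ v
  exact Prod.ext rfl (congrArg Submodule.Quotient.mk (mapMΓ_id y))

theorem mapTriple_comp {P : Type u} [AddCommGroup P] [Module R P] [Module Λᵐᵒᵖ P]
    [IsScalarTower R Λᵐᵒᵖ P] (h : N →ₗ[Λᵐᵒᵖ] P) :
    mapTriple hΓ I (h ∘ₗ g) = mapTriple hΓ I h ∘ₗ mapTriple hΓ I g := by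
  apply LinearMap.ext
  rintro ⟨u, v⟩
  obtain ⟨m, rfl⟩ := Submodule.Quotient.mk_surjective _ u
  obtain ⟨y, rfl⟩ := Submodule.Quotient.mk_surjective _ v
  exact Prod.ext rfl (congrArg Submodule.Quotient.mk (mapMΓ_comp g h y))

end Morphisms

variable (R) in
/-- Every right `Λ`-module is an `R`-module by `r • x = x · r`. -/
abbrev moduleOverBase (M : ModuleCat.{u} Λᵐᵒᵖ) : Module R M := Module.restrictScalars R Λᵐᵒᵖ M

variable (R) in
theorem moduleOverBase_isScalarTower (M : ModuleCat.{u} Λᵐᵒᵖ) :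
    letI := moduleOverBase R M
    IsScalarTower R Λᵐᵒᵖ M :=
  IsScalarTower.restrictScalars R Λᵐᵒᵖ M

attribute [local instance] moduleOverBase moduleOverBase_isScalarTower

/-- The functor `𝔽 : Tf_Λ → Mod-D`, `M ↦ (M / M I, M Γ / M I, σ_M)`. -/
def functorF : Tf R Λ ⥤ ModuleCat.{u} (RingD hΓ I)ᵐᵒᵖ where
  obj M := ModuleCat.of _ (TripleModule (sigma hΓ I M.obj))
  map g := ModuleCat.ofHom (mapTriple hΓ I g.hom.hom)
  map_id _ := congrArg ModuleCat.ofHom (mapTriple_id hΓ I)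
  map_comp f g := congrArg ModuleCat.ofHom (mapTriple_comp hΓ I f.hom.hom g.hom.hom)

/-- The closed subset `Zg(𝒟) = Zg_D ∩ 𝒟` of the Ziegler spectrum of `D`. -/
def ZgD : Set (Zg (RingD hΓ I)) := Zg.inter _ (IsGeneratingMonoTriple (quotIncl hΓ I))

end Functor

/-!
The functor `𝔽` only sees the pair `M ⊆ M Γ` modulo `M I = M Γ I`. Accordingly, the proof works with
presentations: a semilinear embedding `i : M → P` of a torsion-free `Λ`-module into a torsion-free
`Γ`-module that it generates (`IsHull`), and an additive map `q : M × P → X` that identifies a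
`D`-module `X` with `(M / M I, P / P I, ī)` (`IsTriplePres`). The hull `P` is unique and functorial
in `M` (`IsHull.exists_map`), so that `X` presented by `M` means `X ≅ 𝔽 M`.

Three facts about the pair of orders carry the comparison.

* Since `Γ` is hereditary, quotients of injective `Γ`-modules are injective, and maps from a
  torsion-free `P` to `P' / P' I` lift to `P'` if `P'` is `π`-adically complete
  (`exists_lift_of_complete`). As `P' I ⊆ M'`, the lift takes `M` to `M'`; so `𝔽` is full on
  modules with complete hull (`IsTriplePres.exists_lift`). Since `I ⊆ rad Λ` is nilpotent modulo
  `π`, a lift of the identity is an isomorphism (`IsTriplePres.bijective`).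
* Every triple in `𝒟` is presented by a module with complete hull
  (`IsGeneratingMonoTriple.exists_pres`): a projective `Γ / I`-module is a direct summand of the
  reduction of a module of null sequences over `Γ`, and a shift argument of Eilenberg–Mazur type
  lifts the summand. `M` is the inverse image of `U` in the lift of `V`.
* Since `Q Λ` is semisimple, the divisible part of a torsion-free module splits off
  (`exists_retraction_divisiblePart`). Hence points are reduced or divisible, which gives the
  description of the reduced points by the pp pair `(x = x / π ∣ x)`.

Pure-injectivity and the topology are handled through reduced products along a filter. A module is
pure-injective when its diagonal embeddings into its reduced powers split
(`isPureInjective_of_diag`), and a pure-injective `X` that is not separated by a pp pair from a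
class of modules is a direct summand of a reduced product of members of the class
(`IsPureInjective.exists_separation_or`); the index set carries a function to `ℕ` that tends to
infinity, which makes such a reduced product precomplete (`RedProd.isCPrecomplete`). Similarly, a
pure-injective module is a direct summand of a countable reduced power of itself, and is therefore
complete if it is reduced. Presentations commute with reduced products
(`IsTriplePres.exists_redProd`), because `Γ` is finite over `Λ` and `I` is finitely generated, and
do not change when the divisible parts are factored out. So a direct summand of a reduced product on
one side yields one on the other side, which shows that `𝔽` and its inverse are continuous and
that `𝒟` is closed.
-/

/-! ### Reduced products -/

section ReducedProduct

/-- The families that vanish eventually along the filter `l`. -/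
def eventuallyZero (B : Type*) [Ring B] {K : Type u} (l : Filter K) (Y : K → Type u)
    [∀ k, AddCommGroup (Y k)] [∀ k, Module B (Y k)] : Submodule B (∀ k, Y k) where
  carrier := {f | ∀ᶠ k in l, f k = 0}
  add_mem' hf hg := by
    filter_upwards [hf, hg] with k h1 h2
    simp [h1, h2]
  zero_mem' := Filter.Eventually.of_forall fun _ => rfl
  smul_mem' b f hf := by
    filter_upwards [hf] with k h
    simp [h]

/-- The reduced product of a family of modules along a filter. -/
abbrev RedProd (B : Type*) [Ring B] {K : Type u} (l : Filter K) (Y : K → Type u)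
    [∀ k, AddCommGroup (Y k)] [∀ k, Module B (Y k)] : Type u :=
  (∀ k, Y k) ⧸ eventuallyZero B l Y

namespace RedProd

variable {B : Type*} [Ring B] {K : Type u} {l : Filter K} {Y : K → Type u}
  [∀ k, AddCommGroup (Y k)] [∀ k, Module B (Y k)]

variable (B l) in
/-- The class of a family in the reduced product. -/
abbrev mk (f : ∀ k, Y k) : RedProd B l Y := (eventuallyZero B l Y).mkQ f

theorem mk_surjective (x : RedProd B l Y) : ∃ f, mk B l f = x :=
  Submodule.mkQ_surjective _ x

theorem mk_add (f g : ∀ k, Y k) : mk B l (f + g) = mk B l f + mk B l g :=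
  map_add (eventuallyZero B l Y).mkQ f g

theorem mk_smul (b : B) (f : ∀ k, Y k) : mk B l (b • f) = b • mk B l f :=
  map_smul (eventuallyZero B l Y).mkQ b f

theorem mk_eq_zero {f : ∀ k, Y k} : mk B l f = 0 ↔ ∀ᶠ k in l, f k = 0 :=
  Submodule.Quotient.mk_eq_zero _

theorem mk_eq_mk {f g : ∀ k, Y k} : mk B l f = mk B l g ↔ ∀ᶠ k in l, f k = g k := by
  rw [← sub_eq_zero, ← map_sub, mk_eq_zero]
  simp only [Pi.sub_apply, sub_eq_zero]

variable (B l) in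
/-- The diagonal embedding of a module into its reduced power. -/
def diag (X : Type u) [AddCommGroup X] [Module B X] : X →ₗ[B] RedProd B l fun _ : K => X :=
  (eventuallyZero B l fun _ : K => X).mkQ ∘ₗ
    LinearMap.pi (φ := fun _ : K => X) fun _ => LinearMap.id

theorem diag_apply (X : Type u) [AddCommGroup X] [Module B X] (x : X) :
    diag B l X x = mk B l fun _ : K => x := rfl

end RedProd

end ReducedProduct

/-! ### Positive primitive formulas -/

section PP

variable {S : Type u} [Ring S]

theorem PPFormula.sol_map {n : ℕ} (φ : PPFormula S n) {M N : Type*} [AddCommGroup M]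
    [Module Sᵐᵒᵖ M] [AddCommGroup N] [Module Sᵐᵒᵖ N] (f : M →ₗ[Sᵐᵒᵖ] N) {x : Fin n → M}
    (hx : x ∈ φ.sol M) : (fun i => f (x i)) ∈ φ.sol N := by
  obtain ⟨y, hy⟩ := hx
  refine ⟨fun i => f (y i), fun j => ?_⟩
  have := congrArg f (hy j)
  rw [map_sum, map_zero] at this
  rw [← this]
  refine Finset.sum_congr rfl fun i _ => ?_
  rw [map_smul]
  cases i <;> rfl

/-- Łoś's theorem for pp formulas and reduced products. -/
theorem PPFormula.mem_sol_redProd {n : ℕ} (φ : PPFormula S n) {K : Type u} (l : Filter K)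
    (Y : K → Type u) [∀ k, AddCommGroup (Y k)] [∀ k, Module Sᵐᵒᵖ (Y k)]
    (x : Fin n → ∀ k, Y k) :
    (fun i => RedProd.mk Sᵐᵒᵖ l (x i)) ∈ φ.sol (RedProd Sᵐᵒᵖ l Y) ↔
      ∀ᶠ k in l, (fun i => x i k) ∈ φ.sol (Y k) := by
  classical
  have key : ∀ (y : Fin φ.numEx → ∀ k, Y k) (j : Fin φ.numEq),
      ∑ i, op (φ.mat i j) • Sum.elim (fun i => RedProd.mk Sᵐᵒᵖ l (x i))
        (fun i => RedProd.mk Sᵐᵒᵖ l (y i)) i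
        = RedProd.mk Sᵐᵒᵖ l fun k => ∑ i, op (φ.mat i j) •
          Sum.elim (fun i => x i k) (fun i => y i k) i := by
    intro y j
    have : (fun k => ∑ i, op (φ.mat i j) • Sum.elim (fun i => x i k) (fun i => y i k) i)
        = ∑ i, op (φ.mat i j) • Sum.elim x y i := by
      funext k
      rw [Finset.sum_apply]
      refine Finset.sum_congr rfl fun i _ => ?_
      cases i <;> rfl
    rw [this]
    refine Eq.trans ?_ (map_sum (eventuallyZero Sᵐᵒᵖ l Y).mkQ _ _).symm
    refine Finset.sum_congr rfl fun i _ => ?_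
    cases i <;> exact (map_smul (eventuallyZero Sᵐᵒᵖ l Y).mkQ _ _).symm
  constructor
  · rintro ⟨y, hy⟩
    choose z hz using fun i => RedProd.mk_surjective (y i)
    obtain rfl : (fun i => RedProd.mk Sᵐᵒᵖ l (z i)) = y := funext hz
    have h : ∀ j, ∀ᶠ k in l, ∑ i, op (φ.mat i j) •
        Sum.elim (fun i => x i k) (fun i => z i k) i = 0 := fun j => by
      rw [← RedProd.mk_eq_zero (B := Sᵐᵒᵖ), ← key]
      exact hy j
    filter_upwards [Filter.eventually_all.2 h] with k hk
    exact ⟨fun i => z i k, hk⟩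
  · intro h
    let y : Fin φ.numEx → ∀ k, Y k := fun i k =>
      if hk : (fun i => x i k) ∈ φ.sol (Y k) then hk.choose i else 0
    refine ⟨fun i => RedProd.mk Sᵐᵒᵖ l (y i), fun j => ?_⟩
    rw [key, RedProd.mk_eq_zero]
    filter_upwards [h] with k hk
    simp only [y, dif_pos hk]
    exact hk.choose_spec j

/-- A finite system of linear equations in variables indexed by a module `X`, with one
distinguished variable, is expressed by a pp formula in that variable. -/
theorem PPFormula.exists_of_system {X : Type u} (θ : Finset (X →₀ Sᵐᵒᵖ)) (x₀ : X) :
    ∃ φ : PPFormula S 1, ∀ (M : Type u) [AddCommGroup M] [Module Sᵐᵒᵖ M] (v : Fin 1 → M),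
      v ∈ φ.sol M ↔
        ∃ w : X → M, (∀ r ∈ θ, Finsupp.linearCombination Sᵐᵒᵖ w r = 0) ∧ w x₀ = v 0 := by
  classical
  let s : Finset X := insert x₀ (θ.biUnion Finsupp.support)
  let ev := Fintype.equivFin s
  let eq := Fintype.equivFin (Option θ)
  have hx₀ : x₀ ∈ s := Finset.mem_insert_self _ _
  -- the column `none` says `w x₀ = v 0`, the column of `r ∈ θ` says `∑ w x · r x = 0`
  let A : Fin 1 ⊕ s → Option θ → S := fun i t =>
    match i, t with
    | Sum.inl _, none => -1
    | Sum.inl _, some _ => 0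
    | Sum.inr x, none => if (x : X) = x₀ then 1 else 0
    | Sum.inr x, some r => (r.1 x).unop
  refine ⟨⟨_, _, fun i t => A (i.map id ev.symm) (eq.symm t)⟩, fun M _ _ v => ?_⟩
  have hlin : ∀ (w : X → M), ∀ r ∈ θ, Finsupp.linearCombination Sᵐᵒᵖ w r
      = ∑ x : s, r x • w x := by
    intro w r hr
    rw [Finsupp.linearCombination_apply, Finsupp.sum_of_support_subset r (s := s)
      ((Finset.subset_biUnion_of_mem _ hr).trans (Finset.subset_insert _ _))
      (fun a r => r • w a) (fun _ _ => zero_smul _ _), ← Finset.sum_coe_sort]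
  have hsum : ∀ (z : s → M) (t : Option θ),
      ∑ i : Fin 1 ⊕ Fin (Fintype.card s), op (A (i.map id ev.symm) t) •
        Sum.elim v (fun i => z (ev.symm i)) i
      = op (A (Sum.inl 0) t) • v 0 + ∑ x : s, op (A (Sum.inr x) t) • z x := by
    intro z t
    rw [Fintype.sum_sum_type]
    congr 1
    · simp
    · exact ev.symm.sum_comp fun x => op (A (Sum.inr x) t) • z x
  constructor
  · rintro ⟨y, hy⟩
    obtain ⟨z, rfl⟩ : ∃ z : s → M, (fun i => z (ev.symm i)) = y :=
      ⟨fun x => y (ev x), by funext i; simp⟩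
    have hz : ∀ t, op (A (Sum.inl 0) t) • v 0 + ∑ x : s, op (A (Sum.inr x) t) • z x = 0 := by
      intro t
      have := hy (eq t)
      simp only [Equiv.symm_apply_apply] at this
      rw [← hsum]
      exact this
    refine ⟨fun x => if hx : x ∈ s then z ⟨x, hx⟩ else 0, fun r hr => ?_, ?_⟩
    · rw [hlin _ r hr]
      have := hz (some ⟨r, hr⟩)
      simp only [A, op_zero, zero_smul, zero_add, op_unop] at this
      rw [← this]
      exact Finset.sum_congr rfl fun x _ => by simp
    · have := hz none
      rw [Fintype.sum_eq_single (⟨x₀, hx₀⟩ : s) (fun x hx => by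
        have : (x : X) ≠ x₀ := fun h => hx (Subtype.ext h)
        simp [A, this])] at this
      simp only [A, if_pos, MulOpposite.op_neg, op_one, neg_smul, one_smul] at this
      simp only [dif_pos hx₀]
      exact (neg_add_eq_zero.1 this).symm
  · rintro ⟨w, hw, h0⟩
    refine ⟨fun i => w (ev.symm i), fun t => ?_⟩
    refine (hsum (fun x => w x) (eq.symm t)).trans ?_
    cases eq.symm t with
    | none =>
      rw [Fintype.sum_eq_single (⟨x₀, hx₀⟩ : s) (fun x hx => by
        have : (x : X) ≠ x₀ := fun h => hx (Subtype.ext h)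
        simp [A, this])]
      simp [A, h0]
    | some r =>
      simp only [A, op_zero, zero_smul, zero_add, op_unop]
      rw [← hlin w r r.2]
      exact hw r r.2

theorem PPFormula.sol_subset_of_retract (φ ψ : PPFormula S 1) {M N : Type*} [AddCommGroup M]
    [Module Sᵐᵒᵖ M] [AddCommGroup N] [Module Sᵐᵒᵖ N] (f : M →ₗ[Sᵐᵒᵖ] N) (g : N →ₗ[Sᵐᵒᵖ] M)
    (hgf : ∀ x, g (f x) = x) (h : φ.sol N ⊆ ψ.sol N) : φ.sol M ⊆ ψ.sol M := by
  intro x hx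
  have := ψ.sol_map g (h (φ.sol_map f hx))
  simpa only [hgf] using this

theorem PPFormula.sol_subset_redProd (φ ψ : PPFormula S 1) {K : Type u} (l : Filter K)
    (Y : K → Type u) [∀ k, AddCommGroup (Y k)] [∀ k, Module Sᵐᵒᵖ (Y k)]
    (h : ∀ k, φ.sol (Y k) ⊆ ψ.sol (Y k)) :
    φ.sol (RedProd Sᵐᵒᵖ l Y) ⊆ ψ.sol (RedProd Sᵐᵒᵖ l Y) := by
  intro x hx
  choose z hz using fun i => RedProd.mk_surjective (x i)
  obtain rfl : (fun i => RedProd.mk Sᵐᵒᵖ l (z i)) = x := funext hz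
  rw [PPFormula.mem_sol_redProd] at hx ⊢
  exact hx.mono fun k hk => h k hk

/-- A homomorphism that reflects pp-`1`-formulas is a pure embedding. -/
theorem isPureEmbedding_of_reflects {M B : Type*} [AddCommGroup M] [Module Sᵐᵒᵖ M]
    [AddCommGroup B] [Module Sᵐᵒᵖ B] (f : M →ₗ[Sᵐᵒᵖ] B)
    (h : ∀ (φ : PPFormula S 1) (x : Fin 1 → M), (fun i => f (x i)) ∈ φ.sol B → x ∈ φ.sol M) :
    IsPureEmbedding f := by
  refine ⟨(injective_iff_map_eq_zero f).2 fun a ha => ?_, fun φ x => ⟨h φ x, φ.sol_map f⟩⟩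
  -- the formula `x = 0`
  let φ : PPFormula S 1 := ⟨0, 1, fun _ _ => 1⟩
  obtain ⟨y, hy⟩ := h φ (fun _ => a) ⟨fun i => i.elim0, fun j => by simp [φ, ha]⟩
  simpa [φ] using hy 0

theorem isPureEmbedding_diag {K : Type u} (l : Filter K) [l.NeBot] (X : Type u) [AddCommGroup X]
    [Module Sᵐᵒᵖ X] : IsPureEmbedding (RedProd.diag Sᵐᵒᵖ l X) :=
  isPureEmbedding_of_reflects _ fun φ x hx => by
    have := (φ.mem_sol_redProd l (fun _ => X) fun i _ => x i).1 hx
    exact this.exists.choose_spec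

theorem IsPureInjective.exists_retraction {X : ModuleCat.{u} Sᵐᵒᵖ} (hX : IsPureInjective X)
    {B : Type u} [AddCommGroup B] [Module Sᵐᵒᵖ B] (f : X →ₗ[Sᵐᵒᵖ] B) (hf : IsPureEmbedding f) :
    ∃ g : B →ₗ[Sᵐᵒᵖ] X, ∀ x, g (f x) = x := by
  obtain ⟨⟨r, hr⟩⟩ := hX (ModuleCat.of Sᵐᵒᵖ B) (ModuleCat.ofHom f) hf
  exact ⟨r.hom, fun x => congrArg (fun h => h.hom x) hr⟩

/-- A finite system of homogeneous equations that is solvable in `B`, with some of the variables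
taking given values in a pure submodule `M`, is solvable in `M` with the same given values. -/
theorem IsPureEmbedding.exists_solution {M B : Type u} [AddCommGroup M] [Module Sᵐᵒᵖ M]
    [AddCommGroup B] [Module Sᵐᵒᵖ B] {f : M →ₗ[Sᵐᵒᵖ] B} (hf : IsPureEmbedding f)
    {X : Type u} (θ : Finset (X →₀ Sᵐᵒᵖ)) (J : Finset X) (x : X → M) (b : X → B)
    (hb : ∀ r ∈ θ, Finsupp.linearCombination Sᵐᵒᵖ b r = 0) (hbx : ∀ j ∈ J, b j = f (x j)) :
    ∃ a : X → M, (∀ r ∈ θ, Finsupp.linearCombination Sᵐᵒᵖ a r = 0) ∧ ∀ j ∈ J, a j = x j := by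
  classical
  have hcomb : ∀ (a : X → M) (r : X →₀ Sᵐᵒᵖ), Finsupp.linearCombination Sᵐᵒᵖ (fun j => f (a j)) r
      = f (Finsupp.linearCombination Sᵐᵒᵖ a r) := fun a r => by
    rw [Finsupp.apply_linearCombination]; rfl
  induction J using Finset.induction_on with
  | empty => exact ⟨0, fun r _ => by simp, by simp⟩
  | insert j₀ J hj₀ ih =>
    obtain ⟨a, ha, hax⟩ := ih fun j hj => hbx j (Finset.mem_insert_of_mem hj)
    -- `b - f a` vanishes on `J`, so purity for one formula in the variable `j₀` corrects `a`
    obtain ⟨φ, hφ⟩ := PPFormula.exists_of_system (S := S)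
      (θ ∪ J.image fun j => Finsupp.single j 1) j₀
    have h1 : (fun _ : Fin 1 => f (x j₀ - a j₀)) ∈ φ.sol B := by
      rw [hφ]
      refine ⟨b - fun j => f (a j), fun r hr => ?_, ?_⟩
      · rcases Finset.mem_union.1 hr with hr | hr
        · have : Finsupp.linearCombination Sᵐᵒᵖ (b - fun j => f (a j)) r
              = Finsupp.linearCombination Sᵐᵒᵖ b r
                - Finsupp.linearCombination Sᵐᵒᵖ (fun j => f (a j)) r := by
            simp [Finsupp.linearCombination_apply, Finsupp.sum, smul_sub]
          rw [this, hcomb, hb r hr, ha r hr, map_zero, sub_zero]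
        · obtain ⟨j, hj, rfl⟩ := Finset.mem_image.1 hr
          simp [hbx j (Finset.mem_insert_of_mem hj), hax j hj]
      · simp [hbx j₀ (Finset.mem_insert_self _ _)]
    obtain ⟨w, hw, hw0⟩ := (hφ M _).1 ((hf.2 φ fun _ => x j₀ - a j₀).1 h1)
    refine ⟨a + w, fun r hr => ?_, fun j hj => ?_⟩
    · have : Finsupp.linearCombination Sᵐᵒᵖ (a + w) r
          = Finsupp.linearCombination Sᵐᵒᵖ a r + Finsupp.linearCombination Sᵐᵒᵖ w r := by
        simp [Finsupp.linearCombination_apply, Finsupp.sum, smul_add, Finset.sum_add_distrib]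
      rw [this, ha r hr, hw r (Finset.mem_union_left _ hr), add_zero]
    · rcases Finset.mem_insert.1 hj with rfl | hj
      · simp [hw0]
      · have := hw (Finsupp.single j 1)
          (Finset.mem_union_right _ (Finset.mem_image_of_mem _ hj))
        simp only [Finsupp.linearCombination_single, one_smul] at this
        simp [this, hax j hj]

/-- The map into a reduced product given by a family of maps that are eventually linear: each
linear relation of `X` is eventually respected. -/
theorem RedProd.exists_linearMap {B : Type u} [Ring B] {K : Type u} (l : Filter K) (Y : K → Type u)
    [∀ k, AddCommGroup (Y k)] [∀ k, Module B (Y k)] {X : Type u} [AddCommGroup X] [Module B X]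
    (a : ∀ k, X → Y k)
    (ha : ∀ r : X →₀ B, Finsupp.linearCombination B (id : X → X) r = 0 →
      ∀ᶠ k in l, Finsupp.linearCombination B (a k) r = 0) :
    ∃ f : X →ₗ[B] RedProd B l Y, ∀ x, f x = mk B l fun k => a k x := by
  refine ⟨{ toFun := fun x => mk B l fun k => a k x, map_add' := fun x y => ?_,
            map_smul' := fun b x => ?_ }, fun x => rfl⟩
  · rw [← map_add, mk_eq_mk]
    have := ha (Finsupp.single (x + y) 1 - Finsupp.single x 1 - Finsupp.single y 1) (by simp)
    filter_upwards [this] with k hk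
    simp only [map_sub, Finsupp.linearCombination_single, one_smul] at hk
    rw [sub_sub] at hk
    exact sub_eq_zero.1 hk
  · rw [RingHom.id_apply, ← map_smul, mk_eq_mk]
    have := ha (Finsupp.single (b • x) 1 - Finsupp.single x b) (by simp)
    filter_upwards [this] with k hk
    simp only [map_sub, Finsupp.linearCombination_single, one_smul] at hk
    exact sub_eq_zero.1 hk

/-- A module is pure-injective if its diagonal embeddings into reduced powers split: every pure
extension of `X` maps to a reduced power of `X`, over the diagonal. -/
theorem isPureInjective_of_diag (X : ModuleCat.{u} Sᵐᵒᵖ)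
    (h : ∀ (K : Type u) (l : Filter K) [l.NeBot],
      ∃ g : (RedProd Sᵐᵒᵖ l fun _ : K => X) →ₗ[Sᵐᵒᵖ] X, ∀ x, g (RedProd.diag Sᵐᵒᵖ l X x) = x) :
    IsPureInjective X := by
  classical
  intro B f hf
  let K := Finset (B →₀ Sᵐᵒᵖ)
  let s (k : K) : Finset B := k.biUnion Finsupp.support
  have hinj : Function.Injective f.hom := hf.1
  -- the relations of `B` in `k` are solved in `X`, keeping the values of the variables from `X`
  have hsol : ∀ k : K, ∃ a : B → X,
      (∀ r ∈ k, Finsupp.linearCombination Sᵐᵒᵖ (id : B → B) r = 0 →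
        Finsupp.linearCombination Sᵐᵒᵖ a r = 0) ∧ ∀ x : X, a (f.hom x) = x := by
    intro k
    let x : B → X := Function.invFun f.hom
    have hx : ∀ y, x (f.hom y) = y := Function.leftInverse_invFun hinj
    obtain ⟨a, ha, hax⟩ := hf.exists_solution
      (k.filter fun r => Finsupp.linearCombination Sᵐᵒᵖ (id : B → B) r = 0)
      ((s k).filter fun b => b ∈ Set.range f.hom) x id
      (fun r hr => (Finset.mem_filter.1 hr).2) (fun b hb => by
        obtain ⟨y, rfl⟩ := (Finset.mem_filter.1 hb).2
        rw [hx, id])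
    refine ⟨fun b => if b ∈ Set.range f.hom then x b else a b, fun r hr hr0 => ?_, fun y => ?_⟩
    · rw [← ha r (Finset.mem_filter.2 ⟨hr, hr0⟩)]
      simp only [Finsupp.linearCombination_apply, Finsupp.sum]
      refine Finset.sum_congr rfl fun b hb => ?_
      have hbs : b ∈ s k := Finset.mem_biUnion.2 ⟨r, hr, hb⟩
      split_ifs with hbr
      · rw [hax b (Finset.mem_filter.2 ⟨hbs, hbr⟩)]
      · rfl
    · exact (if_pos ⟨y, rfl⟩).trans (hx y)
  choose a ha hax using hsol
  obtain ⟨F, hF⟩ := RedProd.exists_linearMap (Filter.atTop : Filter K) (fun _ => X) a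
    fun r hr => (Filter.eventually_ge_atTop ({r} : Finset _)).mono fun k hk =>
      ha k r (hk (Finset.mem_singleton_self r)) hr
  obtain ⟨g, hg⟩ := h K Filter.atTop
  refine ⟨⟨⟨ModuleCat.ofHom (g ∘ₗ F), ?_⟩⟩⟩
  ext x
  change g (F (f.hom x)) = x
  rw [hF]
  simp only [hax]
  exact hg x

/-- If every pp-pair that is open on `X` is open on some module in the class `C`, then `X` embeds
purely into a reduced product of modules from `C`. The index set carries a function to `ℕ` that
tends to infinity, which makes the reduced product algebraically compact enough to be complete. -/
theorem exists_pureEmbedding_redProd (X : Type u) [AddCommGroup X] [Module Sᵐᵒᵖ X]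
    (C : ModuleCat.{u} Sᵐᵒᵖ → Prop)
    (h : ∀ φ ψ : PPFormula S 1, ¬ φ.sol X ⊆ ψ.sol X →
      ∃ Y : ModuleCat.{u} Sᵐᵒᵖ, C Y ∧ ¬ φ.sol Y ⊆ ψ.sol Y) :
    ∃ (K : Type u) (l : Filter K) (ht : K → ℕ) (Y : K → ModuleCat.{u} Sᵐᵒᵖ)
      (f : X →ₗ[Sᵐᵒᵖ] RedProd Sᵐᵒᵖ l fun k => Y k),
      Filter.Tendsto ht l Filter.atTop ∧ (∀ k, C (Y k)) ∧ IsPureEmbedding f := by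
  classical
  let L : (X →₀ Sᵐᵒᵖ) →ₗ[Sᵐᵒᵖ] X := Finsupp.linearCombination Sᵐᵒᵖ (id : X → X)
  let K := {p : X × PPFormula S 1 // (fun _ => p.1) ∉ p.2.sol X} × Finset (X →₀ Sᵐᵒᵖ) × ℕ
  let l : Filter K := Filter.comap Prod.snd Filter.atTop
  have hY : ∀ k : K, ∃ (Y : ModuleCat.{u} Sᵐᵒᵖ) (a : X → Y), C Y ∧
      (∀ r ∈ k.2.1, L r = 0 → Finsupp.linearCombination Sᵐᵒᵖ a r = 0) ∧
      (fun _ => a k.1.1.1) ∉ k.1.1.2.sol Y := by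
    rintro ⟨⟨⟨x, ψ⟩, hx⟩, θ, n⟩
    obtain ⟨φ, hφ⟩ := PPFormula.exists_of_system (θ.filter fun r => L r = 0) x
    obtain ⟨Y, hYC, hYφ⟩ := h φ ψ fun hsub => hx (hsub ((hφ X _).2
      ⟨id, fun r hr => (Finset.mem_filter.1 hr).2, rfl⟩))
    obtain ⟨v, hv, hvψ⟩ := Set.not_subset.1 hYφ
    obtain ⟨a, ha, hav⟩ := (hφ Y v).1 hv
    refine ⟨Y, a, hYC, fun r hr h0 => ha r (Finset.mem_filter.2 ⟨hr, h0⟩), ?_⟩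
    have : v = fun _ => a x := by
      funext i
      rw [hav, Subsingleton.elim i 0]
    rwa [this] at hvψ
  choose Y a hC ha hψ using hY
  have htends : Filter.Tendsto (Prod.snd : K → _) l Filter.atTop := Filter.tendsto_comap
  obtain ⟨f, hf⟩ := RedProd.exists_linearMap l (fun k => Y k) a fun r hr => by
    have := htends.eventually (Filter.eventually_ge_atTop (({r} : Finset _), 0))
    exact this.mono fun k hk => ha k r (hk.1 (Finset.mem_singleton_self r)) hr
  refine ⟨K, l, fun k => k.2.2, fun k => Y k, f, ?_, hC, isPureEmbedding_of_reflects f ?_⟩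
  · rw [← Filter.prod_atTop_atTop_eq] at htends
    exact Filter.tendsto_snd.comp htends
  · intro ψ x hx
    by_contra hx'
    have hx0 : x = fun _ => x 0 := funext fun i => by rw [Subsingleton.elim i 0]
    rw [hx0] at hx hx'
    simp only [hf] at hx
    rw [PPFormula.mem_sol_redProd ψ l (fun k => Y k) (fun _ k => a k (x 0))] at hx
    obtain ⟨t, ht, hsub⟩ := Filter.mem_comap.1 hx
    obtain ⟨b, hb⟩ := Filter.mem_atTop_sets.1 ht
    let k : K := (⟨(x 0, ψ), hx'⟩, b)
    exact hψ k (hsub (show k ∈ Prod.snd ⁻¹' t from hb b le_rfl))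

end PP

/-! ### Lifting along kernels of finite exponent over hereditary rings -/

section Hereditary

variable {B : Type u} [Ring B]

/-- Over a hereditary ring, quotients of injective modules are injective. -/
theorem Module.Injective.of_surjective_of_hereditary (hB : ∀ J : Ideal B, Module.Projective B J)
    {E E' : Type u} [AddCommGroup E] [Module B E] [AddCommGroup E'] [Module B E']
    [Module.Injective B E] (p : E →ₗ[B] E') (hp : Function.Surjective p) :
    Module.Injective B E' := by
  refine Module.Baer.injective fun J g => ?_
  have := hB J
  obtain ⟨g₁, hg₁⟩ := Module.projective_lifting_property p g hp
  obtain ⟨g₂, hg₂⟩ := Module.Baer.of_injective (R := B) (Q := E) inferInstance J g₁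
  exact ⟨p ∘ₗ g₂, fun x hx => by rw [LinearMap.comp_apply, hg₂ x hx, ← hg₁]; rfl⟩

theorem exists_injective_embedding (W : Type u) [AddCommGroup W] [Module B W] :
    ∃ (E : ModuleCat.{u} B) (j : W →ₗ[B] E), Module.Injective B E ∧ Function.Injective j := by
  let E := Injective.under (ModuleCat.of B W)
  have hE : Injective (ModuleCat.of B E) :=
    inferInstanceAs (Injective (Injective.under (ModuleCat.of B W)))
  exact ⟨E, (Injective.ι (ModuleCat.of B W)).hom, Module.injective_module_of_injective_object B E,
    (ModuleCat.mono_iff_injective _).1 inferInstance⟩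

/-- Multiplication by a central element. -/
def centralSMul (c : B) (hc : ∀ b, b * c = c * b) (P : Type*) [AddCommGroup P] [Module B P] :
    P →ₗ[B] P where
  toFun p := c • p
  map_add' := smul_add c
  map_smul' b p := by rw [RingHom.id_apply, ← mul_smul, ← mul_smul, hc]

theorem commute_pow_central {c : B} (hc : ∀ b, b * c = c * b) (n : ℕ) (b : B) :
    b * c ^ n = c ^ n * b :=
  (Commute.pow_right (hc b) n).eq

/-- Let `c` be central in the hereditary ring `B`. A map from a `c`-torsion-free module lifts along
each epimorphism whose kernel is annihilated by `c`. The obstruction lies in an `Ext¹` on which `c`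
acts as zero but, as `Ext²` vanishes, also surjectively; in terms of an injective resolution
`E → E'` of the kernel, a map to `E'` is divisible by `c`, and `c : E' → E'` factors through `E`. -/
theorem exists_lift_of_smul_ker_eq_zero (hB : ∀ J : Ideal B, Module.Projective B J) (c : B)
    (hc : ∀ b, b * c = c * b) {P W W' : Type u} [AddCommGroup P] [Module B P] [AddCommGroup W]
    [Module B W] [AddCommGroup W'] [Module B W'] (hP : ∀ p : P, c • p = 0 → p = 0)
    (f : W →ₗ[B] W') (hf : Function.Surjective f) (hk : ∀ w, f w = 0 → c • w = 0)
    (g : P →ₗ[B] W') : ∃ h : P →ₗ[B] W, ∀ p, f (h p) = g p := by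
  obtain ⟨E, j, hE, hj⟩ := exists_injective_embedding (B := B) W
  let Y : Submodule B E := (LinearMap.ker f).map j
  have hE' : Module.Injective B (E ⧸ Y) :=
    Module.Injective.of_surjective_of_hereditary hB Y.mkQ (Submodule.mkQ_surjective _)
  -- the map `W' → E / Y` induced by `j`
  obtain ⟨t, ht⟩ : ∃ t : W' →ₗ[B] E ⧸ Y, ∀ w, t (f w) = Y.mkQ (j w) := by
    let e := f.quotKerEquivOfSurjective hf
    refine ⟨(LinearMap.ker f).mapQ Y j (fun w hw => Submodule.mem_map_of_mem hw) ∘ₗ e.symm,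
      fun w => ?_⟩
    have : e.symm (f w) = (LinearMap.ker f).mkQ w := by
      rw [LinearEquiv.symm_apply_eq]; rfl
    rw [LinearMap.comp_apply, LinearEquiv.coe_coe, this]; rfl
  obtain ⟨h', hh'⟩ := hE'.out (centralSMul c hc P)
    ((injective_iff_map_eq_zero _).2 hP) (t ∘ₗ g)
  let μ : E ⧸ Y →ₗ[B] E := Y.liftQ (centralSMul c hc E) (by
    rintro _ ⟨w, hw, rfl⟩
    change c • j w = 0
    rw [← map_smul, hk w hw, map_zero])
  have hμ : ∀ x, Y.mkQ (μ x) = c • x := fun x => by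
    obtain ⟨e, rfl⟩ := Submodule.mkQ_surjective _ x
    exact map_smul Y.mkQ c e
  have hs : ∀ p, ∃ w, j w = μ (h' p) ∧ f w = g p := by
    intro p
    obtain ⟨w, hw⟩ := hf (g p)
    have h1 : Y.mkQ (μ (h' p)) = Y.mkQ (j w) := by
      rw [hμ, ← map_smul, ← ht, hw]
      exact hh' p
    obtain ⟨y, hy, hy'⟩ := (Submodule.Quotient.eq Y).1 h1
    exact ⟨w + y, by rw [map_add, hy', add_sub_cancel],
      by rw [map_add, hw, LinearMap.mem_ker.1 hy, add_zero]⟩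
  choose w hjw hfw using hs
  refine ⟨{ toFun := w, map_add' := fun p q => hj ?_, map_smul' := fun b p => hj ?_ }, hfw⟩
  · simp only [map_add, hjw]
  · simp only [map_smul, hjw, RingHom.id_apply]

end Hereditary

/-! ### Completeness with respect to a central element -/

section Complete

variable {B : Type*} [Ring B] (c : B) (P : Type*) [AddCommGroup P] [Module B P]

/-- The intersection of all `cᵏ P` is zero. -/
def IsCReduced : Prop := ∀ x : P, (∀ k : ℕ, ∃ y : P, c ^ k • y = x) → x = 0

/-- Every sequence with `s (k + 1) - s k ∈ cᵏ P` has a limit in the `c`-adic topology. -/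
def IsCPrecomplete : Prop :=
  ∀ s : ℕ → P, (∀ k, ∃ y, s (k + 1) - s k = c ^ k • y) → ∃ l, ∀ k, ∃ y, l - s k = c ^ k • y

variable {c P}

theorem IsCPrecomplete.of_retract {P' : Type*} [AddCommGroup P'] [Module B P']
    (h : IsCPrecomplete c P) (f : P' →ₗ[B] P) (g : P →ₗ[B] P') (hgf : ∀ x, g (f x) = x) :
    IsCPrecomplete c P' := by
  intro s hs
  obtain ⟨l, hl⟩ := h (fun k => f (s k)) fun k => by
    obtain ⟨y, hy⟩ := hs k
    exact ⟨f y, by rw [← map_sub, hy, map_smul]⟩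
  refine ⟨g l, fun k => ?_⟩
  obtain ⟨y, hy⟩ := hl k
  exact ⟨g y, by rw [← map_smul, ← hy, map_sub, hgf]⟩

/-- If some power of `h` maps the complete module `P` into `c P`, then `1 - h` is bijective: its
inverse is given by the geometric series. -/
theorem bijective_of_pow_mem_smul (hred : IsCReduced c P) (hpre : IsCPrecomplete c P)
    (g h : P →ₗ[B] P) (hgh : ∀ p, g p = p - h p) (m : ℕ) (hm : ∀ p, ∃ y, (h ^ m) p = c • y) :
    Function.Bijective g := by
  have hpow : ∀ k p, ∃ y, ((h ^ m) ^ k) p = c ^ k • y := by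
    intro k
    induction k with
    | zero => exact fun p => ⟨p, by simp⟩
    | succ k ih =>
      intro p
      obtain ⟨y, hy⟩ := ih p
      obtain ⟨z, hz⟩ := hm y
      exact ⟨z, by rw [pow_succ', Module.End.mul_apply, hy, map_smul, hz, pow_succ, mul_smul]⟩
  have hg : g = 1 - h := LinearMap.ext hgh
  constructor
  · rw [injective_iff_map_eq_zero]
    intro p hp
    have hp : h p = p := by rw [hgh, sub_eq_zero] at hp; exact hp.symm
    refine hred p fun k => ?_
    obtain ⟨y, hy⟩ := hpow k p
    refine ⟨y, ?_⟩
    rw [← hy, ← pow_mul]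
    generalize m * k = n
    induction n with
    | zero => rfl
    | succ n ih => rw [pow_succ, Module.End.mul_apply, hp, ih]
  · intro y
    let s : ℕ → P := fun k => (∑ j ∈ Finset.range k, (h ^ m) ^ j) y
    obtain ⟨l, hl⟩ := hpre s fun k => by
      obtain ⟨z, hz⟩ := hpow k y
      exact ⟨z, by rw [← hz]; simp only [s, Finset.sum_range_succ, LinearMap.add_apply,
        add_sub_cancel_left]⟩
    have h1 : (1 - h ^ m) l = y := by
      rw [← sub_eq_zero]
      refine hred _ fun k => ?_
      obtain ⟨z, hz⟩ := hl k
      obtain ⟨z', hz'⟩ := hpow k y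
      refine ⟨(1 - h ^ m) z - z', ?_⟩
      have h2 : (1 - h ^ m) (s k) = y - c ^ k • z' := by
        rw [← hz', ← Module.End.mul_apply, mul_neg_geom_sum]; rfl
      rw [smul_sub, ← map_smul, ← hz, map_sub, h2]
      abel
    refine ⟨(∑ i ∈ Finset.range m, h ^ i) l, ?_⟩
    rw [hg, ← Module.End.mul_apply, mul_neg_geom_sum, h1]

/-- A reduced product is precomplete if its filter is not countably complete. -/
theorem RedProd.isCPrecomplete (c : B) {K : Type u} {l : Filter K} {ht : K → ℕ}
    (hht : Filter.Tendsto ht l Filter.atTop) (Y : K → Type u) [∀ k, AddCommGroup (Y k)]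
    [∀ k, Module B (Y k)] : IsCPrecomplete c (RedProd B l Y) := by
  intro s hs
  choose y hy using hs
  choose z hz using fun k => RedProd.mk_surjective (y k)
  obtain ⟨a, ha⟩ := RedProd.mk_surjective (s 0)
  -- representatives whose differences are divisible on the nose; the limit is diagonal
  let t : ℕ → ∀ k, Y k := fun n => a + ∑ j ∈ Finset.range n, c ^ j • z j
  have ht' : ∀ n, mk B l (t n) = s n := by
    intro n
    induction n with
    | zero => simpa [t] using ha
    | succ n ih =>
      have : t (n + 1) = t n + c ^ n • z n := by
        simp only [t, Finset.sum_range_succ, add_assoc]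
      rw [this, mk_add, mk_smul, ih, hz, ← hy, add_sub_cancel]
  have hdiff : ∀ n k, n ≤ ht k → ∃ w, t (ht k) k - t n k = c ^ n • w := by
    intro n k hn
    refine ⟨∑ j ∈ Finset.Ico n (ht k), c ^ (j - n) • z j k, ?_⟩
    have : t (ht k) - t n = ∑ j ∈ Finset.Ico n (ht k), c ^ j • z j := by
      simp only [t, add_sub_add_left_eq_sub]
      rw [Finset.sum_Ico_eq_sub _ hn]
    rw [← Pi.sub_apply, this, Finset.sum_apply, Finset.smul_sum]
    refine Finset.sum_congr rfl fun j hj => ?_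
    rw [Pi.smul_apply, ← mul_smul, ← pow_add, Nat.add_sub_cancel' (Finset.mem_Ico.1 hj).1]
  refine ⟨mk B l fun k => t (ht k) k, fun n => ?_⟩
  classical
  let w : ∀ k, Y k := fun k => if h : n ≤ ht k then (hdiff n k h).choose else 0
  refine ⟨mk B l w, ?_⟩
  rw [← ht', ← map_sub, ← map_smul, mk_eq_mk]
  filter_upwards [hht.eventually_ge_atTop n] with k hk
  simp only [Pi.sub_apply, Pi.smul_apply, w, dif_pos hk]
  exact (hdiff n k hk).choose_spec

/-- A pure-injective module is a direct summand of a countable reduced power of itself, and is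
therefore precomplete. -/
theorem IsPureInjective.isCPrecomplete {S : Type u} [Ring S] {X : ModuleCat.{u} Sᵐᵒᵖ}
    (hX : IsPureInjective X) (c : Sᵐᵒᵖ) : IsCPrecomplete c X := by
  let l : Filter (ULift.{u} ℕ) := Filter.comap ULift.down Filter.atTop
  have : l.NeBot := Filter.NeBot.comap_of_surj inferInstance ULift.down_surjective
  obtain ⟨g, hg⟩ := hX.exists_retraction _ (isPureEmbedding_diag (S := S) l X)
  exact (RedProd.isCPrecomplete c (l := l) (ht := ULift.down) Filter.tendsto_comap
    fun _ => X).of_retract _ g hg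

/-- Over a hereditary ring, maps from a torsion-free module `P` to `P' / N` lift to `P'`, if `P'` is
complete and `P' / N` has finite exponent. -/
theorem exists_lift_of_complete {B : Type u} [Ring B] (hB : ∀ J : Ideal B, Module.Projective B J)
    {c : B} (hc : ∀ b, b * c = c * b) {P P' : Type u} [AddCommGroup P] [Module B P]
    [AddCommGroup P'] [Module B P'] (hP : ∀ p : P, c • p = 0 → p = 0)
    (hred : IsCReduced c P') (hpre : IsCPrecomplete c P') (N : Submodule B P') (n : ℕ)
    (hN : ∀ x, c ^ n • x ∈ N) (g : P →ₗ[B] P' ⧸ N) :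
    ∃ h : P →ₗ[B] P', ∀ p, N.mkQ (h p) = g p := by
  have hPn : ∀ (n : ℕ) (p : P), c ^ n • p = 0 → p = 0 := by
    intro n
    induction n with
    | zero => intro p hp; simpa using hp
    | succ n ih => exact fun p hp => hP p (ih _ (by rwa [← mul_smul, ← pow_succ]))
  let D : ℕ → Submodule B P' := fun k =>
    LinearMap.range (centralSMul (c ^ k) (commute_pow_central hc k) P')
  have hD : ∀ k x, x ∈ D k ↔ ∃ y, x = c ^ k • y := fun k x =>
    ⟨fun ⟨y, hy⟩ => ⟨y, hy.symm⟩, fun ⟨y, hy⟩ => ⟨y, hy.symm⟩⟩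
  have hDN : D n ≤ N := by
    rintro _ ⟨y, rfl⟩
    exact hN y
  have hDle : ∀ {j k}, j ≤ k → D k ≤ D j := by
    intro j k hjk x hx
    obtain ⟨y, rfl⟩ := (hD k x).1 hx
    exact (hD j _).2 ⟨c ^ (k - j) • y, by rw [← mul_smul, ← pow_add, Nat.add_sub_cancel' hjk]⟩
  obtain ⟨G₀, hG₀⟩ : ∃ G₀ : P →ₗ[B] P' ⧸ D n, ∀ p, Submodule.factor hDN (G₀ p) = g p := by
    refine exists_lift_of_smul_ker_eq_zero hB (c ^ n) (commute_pow_central hc n) (hPn n) _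
      (Submodule.factor_surjective hDN) (fun w _ => ?_) g
    obtain ⟨x, rfl⟩ := Submodule.mkQ_surjective _ w
    rw [← map_smul]
    exact (Submodule.Quotient.mk_eq_zero _).2 ((hD n _).2 ⟨x, rfl⟩)
  have hstep : ∀ (k : ℕ) (G : P →ₗ[B] P' ⧸ D (n + k)), ∃ G' : P →ₗ[B] P' ⧸ D (n + (k + 1)),
      ∀ p, Submodule.factor (hDle (Nat.le_succ (n + k))) (G' p) = G p := by
    intro k G
    refine exists_lift_of_smul_ker_eq_zero hB c hc hP _
      (Submodule.factor_surjective (hDle (Nat.le_succ (n + k)))) (fun w hw => ?_) G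
    obtain ⟨x, rfl⟩ := Submodule.mkQ_surjective _ w
    obtain ⟨y, rfl⟩ := (hD _ _).1 ((Submodule.Quotient.mk_eq_zero _).1 hw)
    rw [← map_smul]
    refine (Submodule.Quotient.mk_eq_zero _).2 ((hD _ _).2 ⟨y, ?_⟩)
    rw [← mul_smul, ← pow_succ']
  choose next hnext using hstep
  let G : ∀ k, P →ₗ[B] P' ⧸ D (n + k) := fun k => Nat.rec G₀ next k
  have hG : ∀ k p, Submodule.factor (hDle (Nat.le_succ (n + k))) (G (k + 1) p) = G k p :=
    fun k p => hnext k (G k) p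
  have hG' : ∀ k p, Submodule.factor (hDle (Nat.le_add_right n k)) (G k p) = G₀ p := by
    intro k p
    induction k with
    | zero =>
      obtain ⟨x, hx⟩ := Submodule.mkQ_surjective _ (G₀ p)
      change Submodule.factor _ (G₀ p) = G₀ p
      rw [← hx]; rfl
    | succ k ih =>
      rw [← ih, ← hG k]
      obtain ⟨x, hx⟩ := Submodule.mkQ_surjective _ (G (k + 1) p)
      rw [← hx]; rfl
  have hlim : ∀ p, ∃ x, ∀ k y, G k p = (D (n + k)).mkQ y → x - y ∈ D k := by
    intro p
    choose s hs using fun k => Submodule.mkQ_surjective _ (G k p)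
    have hs' : ∀ k, s (k + 1) - s k ∈ D (n + k) := by
      intro k
      refine (Submodule.Quotient.eq _).1 (Eq.trans ?_ (hs k).symm)
      exact (congrArg (Submodule.factor (hDle (Nat.le_succ (n + k)))) (hs (k + 1))).trans
        (hG k p)
    obtain ⟨x, hx⟩ := hpre s fun k => (hD k _).1 (hDle (Nat.le_add_left k n) (hs' k))
    refine ⟨x, fun k y hy => ?_⟩
    rw [← sub_add_sub_cancel x (s k) y]
    exact add_mem ((hD k _).2 (hx k)) (hDle (Nat.le_add_left k n)
      ((Submodule.Quotient.eq _).1 ((hs k).trans hy)))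
  have huniq : ∀ p x x', (∀ k y, G k p = (D (n + k)).mkQ y → x - y ∈ D k) →
      (∀ k y, G k p = (D (n + k)).mkQ y → x' - y ∈ D k) → x = x' := by
    intro p x x' hx hx'
    rw [← sub_eq_zero]
    refine hred _ fun k => ?_
    obtain ⟨y, hy⟩ := Submodule.mkQ_surjective _ (G k p)
    obtain ⟨z, hz⟩ := (hD k _).1 (sub_mem (hx k y hy.symm) (hx' k y hy.symm))
    exact ⟨z, by rw [← hz, sub_sub_sub_cancel_right]⟩
  choose h hh using hlim
  refine ⟨{ toFun := h, map_add' := fun p q => huniq (p + q) _ _ (hh _) fun k y hy => ?_,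
            map_smul' := fun b p => huniq (b • p) _ _ (hh _) fun k y hy => ?_ }, fun p => ?_⟩
  · obtain ⟨y₁, hy₁⟩ := Submodule.mkQ_surjective _ (G k p)
    obtain ⟨y₂, hy₂⟩ := Submodule.mkQ_surjective _ (G k q)
    have h3 : y₁ + y₂ - y ∈ D k := by
      refine hDle (Nat.le_add_left k n) ((Submodule.Quotient.eq _).1 ?_)
      exact (map_add (D (n + k)).mkQ y₁ y₂).trans (by rw [hy₁, hy₂, ← map_add, hy]; rfl)
    have := add_mem (add_mem (hh p k y₁ hy₁.symm) (hh q k y₂ hy₂.symm)) h3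
    convert this using 1
    abel
  · obtain ⟨y₁, hy₁⟩ := Submodule.mkQ_surjective _ (G k p)
    have h3 : b • y₁ - y ∈ D k := by
      refine hDle (Nat.le_add_left k n) ((Submodule.Quotient.eq _).1 ?_)
      exact (map_smul (D (n + k)).mkQ b y₁).trans (by rw [hy₁, ← map_smul, hy]; rfl)
    have := add_mem ((D k).smul_mem b (hh p k y₁ hy₁.symm)) h3
    convert this using 1
    rw [RingHom.id_apply, smul_sub]
    abel
  · rw [← hG₀, ← hG' n]
    obtain ⟨y, hy⟩ := Submodule.mkQ_surjective _ (G n p)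
    rw [← hy]
    exact (Submodule.Quotient.eq _).2 (hDN (hh p n y hy.symm))

end Complete

/-! ### Hereditary pairs of orders -/

section Hull

/-- The properties of a pair of orders `ι : Λ → Γ` and of an ideal `I` of `Γ` on which the
comparison of `Λ`-modules with triples rests. -/
structure IsHereditaryPair {R Λ Γ : Type u} [CommRing R] [Ring Λ] [Ring Γ] [Algebra R Λ]
    [Algebra R Γ] (ι : Λ →+* Γ) (I : Ideal Γ) (π : R) : Prop where
  map_algebraMap : ∀ r, ι (algebraMap R Λ r) = algebraMap R Γ r
  hereditary : ∀ J : Ideal Γᵐᵒᵖ, Module.Projective Γᵐᵒᵖ J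
  exists_preimage : ∀ x ∈ I, ∃ s, ι s = x
  exists_pow_mem : ∃ n, algebraMap R Γ π ^ n ∈ I
  exists_pow_le : ∃ m, ∀ x ∈ I ^ m, ∃ y, x = algebraMap R Γ π * y
  finite : ∃ t : Finset Γ, ∀ y, ∃ s : Γ → Λ, y = ∑ g ∈ t, ι (s g) * g
  fg : I.FG

variable {R Λ Γ : Type u} [CommRing R] [Ring Λ] [Ring Γ] [Algebra R Λ] [Algebra R Γ]

/-- The element `r` of the base ring, acting on right modules. -/
abbrev baseOp (S : Type u) [Ring S] [Algebra R S] (r : R) : Sᵐᵒᵖ := op (algebraMap R S r)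

theorem baseOp_central (S : Type u) [Ring S] [Algebra R S] (r : R) (b : Sᵐᵒᵖ) :
    b * baseOp S r = baseOp S r * b :=
  unop_injective (Algebra.commutes r b.unop)

/-- `P J` for a right module `P` and a left ideal `J`. -/
def rightMul (J : Ideal Γ) (P : Type u) [AddCommGroup P] [Module Γᵐᵒᵖ P] : Submodule Γᵐᵒᵖ P :=
  Submodule.span Γᵐᵒᵖ {x | ∃ g ∈ J, ∃ p : P, op g • p = x}

section RightMul

variable (I : Ideal Γ) {P : Type u} [AddCommGroup P] [Module Γᵐᵒᵖ P]

theorem smul_mem_rightMul {g : Γ} (hg : g ∈ I) (p : P) : op g • p ∈ rightMul I P :=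
  Submodule.subset_span ⟨g, hg, p, rfl⟩

variable [I.IsTwoSided]

theorem rightMul_induction {C : P → Prop} (h : ∀ g ∈ I, ∀ p : P, C (op g • p)) (h0 : C 0)
    (hadd : ∀ x y, C x → C y → C (x + y)) {x : P} (hx : x ∈ rightMul I P) : C x := by
  suffices H : ∀ γ : Γᵐᵒᵖ, C (γ • x) by simpa using H 1
  induction hx using Submodule.span_induction with
  | mem x hx =>
    obtain ⟨g, hg, p, rfl⟩ := hx
    intro γ
    have := h (g * γ.unop) (I.mul_mem_right _ hg) p
    rwa [op_mul, mul_smul] at this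
  | zero => intro γ; rwa [smul_zero]
  | add x y _ _ ihx ihy => intro γ; rw [smul_add]; exact hadd _ _ (ihx γ) (ihy γ)
  | smul a x _ ih => intro γ; rw [← mul_smul]; exact ih _

theorem map_mem_rightMul {P' : Type u} [AddCommGroup P'] [Module Γᵐᵒᵖ P'] (f : P →ₗ[Γᵐᵒᵖ] P')
    {x : P} (hx : x ∈ rightMul I P) : f x ∈ rightMul I P' := by
  refine rightMul_induction I (C := fun x => f x ∈ rightMul I P') ?_ ?_ ?_ hx
  · intro g hg p; rw [map_smul]; exact smul_mem_rightMul I hg _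
  · rw [map_zero]; exact zero_mem _
  · intro x y hx hy; rw [map_add]; exact add_mem hx hy

omit [I.IsTwoSided] in
theorem sum_mem_rightMul {t : Finset Γ} (ht : ∀ g ∈ t, g ∈ I) (a : Γ → P) :
    ∑ g ∈ t, op g • a g ∈ rightMul I P :=
  sum_mem fun g hg => smul_mem_rightMul I (ht g hg) _

/-- If `t` generates `I` as a left ideal, then `P I = ∑ P g`, the sum being over `g` in `t`. -/
theorem exists_sum_of_mem_rightMul {t : Finset Γ} (ht : Ideal.span (t : Set Γ) = I) {x : P}
    (hx : x ∈ rightMul I P) : ∃ a : Γ → P, x = ∑ g ∈ t, op g • a g := by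
  refine rightMul_induction I (C := fun x => ∃ a : Γ → P, x = ∑ g ∈ t, op g • a g) ?_ ?_ ?_ hx
  · intro g hg p
    rw [← ht] at hg
    obtain ⟨s, -, rfl⟩ := Submodule.mem_span_finset.1 hg
    refine ⟨fun g => op (s g) • p, ?_⟩
    rw [Finset.op_sum, Finset.sum_smul]
    exact Finset.sum_congr rfl fun g _ => by rw [smul_eq_mul, op_mul, mul_smul]
  · exact ⟨0, by simp⟩
  · rintro _ _ ⟨a, rfl⟩ ⟨b, rfl⟩
    exact ⟨a + b, by simp [Finset.sum_add_distrib]⟩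

/-- An endomorphism with image in `P I` has its powers in `P Iᵏ`. -/
theorem pow_mem_rightMul_pow (h : P →ₗ[Γᵐᵒᵖ] P) (hI : ∀ p, h p ∈ rightMul I P) (k : ℕ) (p : P) :
    (h ^ k) p ∈ rightMul (I ^ k) P := by
  induction k generalizing p with
  | zero =>
    have := smul_mem_rightMul (I ^ 0) (g := 1)
      (by rw [Submodule.pow_zero, Ideal.one_eq_top]; trivial) p
    simpa using this
  | succ k ih =>
    rw [pow_succ, Module.End.mul_apply]
    refine rightMul_induction I (C := fun x => (h ^ k) x ∈ rightMul (I ^ (k + 1)) P) ?_ ?_ ?_ (hI p)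
    · intro g hg p
      rw [map_smul]
      refine rightMul_induction (I ^ k) (C := fun y => op g • y ∈ rightMul (I ^ (k + 1)) P)
        ?_ ?_ ?_ (ih p)
      · intro x hx z
        rw [← mul_smul, ← op_mul]
        refine smul_mem_rightMul _ ?_ z
        rw [Submodule.pow_succ]
        exact Ideal.mul_mem_mul hx hg
      · rw [smul_zero]; exact zero_mem _
      · intro x y hx hy; rw [smul_add]; exact add_mem hx hy
    · rw [map_zero]; exact zero_mem _
    · intro x y hx hy; rw [map_add]; exact add_mem hx hy

end RightMul

end Hull

/-! ### Hulls and presentations -/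

section Presentation

variable {R Λ Γ : Type u} [CommRing R] [Ring Λ] [Ring Γ] [Algebra R Λ] [Algebra R Γ]
  {ι : Λ →+* Γ} {I : Ideal Γ} [I.IsTwoSided] {π : R}

/-- `i : M → P` exhibits `P` as the hull `M Γ` of a torsion-free `Λ`-module `M`. -/
structure IsHull (π : R) {M P : Type u} [AddCommGroup M] [Module Λᵐᵒᵖ M] [AddCommGroup P]
    [Module Γᵐᵒᵖ P] (i : M →ₛₗ[RingHom.op ι] P) : Prop where
  injective : Function.Injective i
  span_range : Submodule.span Γᵐᵒᵖ (Set.range i) = ⊤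
  torsionFree : ∀ p : P, baseOp Γ π • p = 0 → p = 0

/-- The ring of triples attached to `ι : Λ → Γ` and `I`. -/
abbrev TripleRing (ι : Λ →+* Γ) (I : Ideal Γ) [I.IsTwoSided] : Type u :=
  TriangularRing (Ideal.quotientMap I ι (le_refl (I.comap ι)))

/-- The element of the ring of triples with given representatives of its entries. -/
abbrev tripleEntry (ι : Λ →+* Γ) (I : Ideal Γ) [I.IsTwoSided] (a : Λ) (b c : Γ) :
    TripleRing ι I :=
  ⟨Ideal.Quotient.mk _ a, Ideal.Quotient.mk I b, Ideal.Quotient.mk I c⟩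

/-- The additive map `q : M × P → X` presents the module `X` over the ring of triples as the triple
`(M / (M ∩ P I), P / P I, ī)`. -/
structure IsTriplePres (I : Ideal Γ) [I.IsTwoSided] {M P : Type u} [AddCommGroup M]
    [Module Λᵐᵒᵖ M] [AddCommGroup P] [Module Γᵐᵒᵖ P] (i : M →ₛₗ[RingHom.op ι] P) {X : Type u}
    [AddCommGroup X] [Module (TripleRing ι I)ᵐᵒᵖ X] (q : M × P →+ X) : Prop where
  apply_smul : ∀ a b c m p,
    q (op a • m, op b • i m + op c • p) = op (tripleEntry ι I a b c) • q (m, p)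
  surjective : Function.Surjective q
  apply_eq_zero : ∀ m p, q (m, p) = 0 ↔ i m ∈ rightMul I P ∧ p ∈ rightMul I P

variable {M P : Type u} [AddCommGroup M] [Module Λᵐᵒᵖ M] [AddCommGroup P]
  [Module Γᵐᵒᵖ P] {i : M →ₛₗ[RingHom.op ι] P}
  {M' P' : Type u} [AddCommGroup M'] [Module Λᵐᵒᵖ M'] [AddCommGroup P']
  [Module Γᵐᵒᵖ P'] {i' : M' →ₛₗ[RingHom.op ι] P'}

theorem semilinear_op_smul (i : M →ₛₗ[RingHom.op ι] P) (a : Λ) (m : M) :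
    i (op a • m) = op (ι a) • i m :=
  i.map_smulₛₗ (op a) m

omit [Algebra R Λ] in
/-- `P I` is contained in the image of `M`; in fact it is the image of `M I`. -/
theorem IsHull.exists_preimage (hi : IsHull π i) (hI : ∀ x ∈ I, ∃ s, ι s = x) {x : P}
    (hx : x ∈ rightMul I P) : ∃ m, i m = x ∧
      m ∈ Submodule.span Λᵐᵒᵖ {y | ∃ s ∈ I.comap ι, ∃ m : M, op s • m = y} := by
  refine rightMul_induction I (C := fun x => ∃ m, i m = x ∧
      m ∈ Submodule.span Λᵐᵒᵖ {y | ∃ s ∈ I.comap ι, ∃ m : M, op s • m = y}) ?_ ?_ ?_ hx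
  · intro g hg p
    have hp : p ∈ Submodule.span Γᵐᵒᵖ (Set.range i) := hi.span_range ▸ Submodule.mem_top
    induction hp using Submodule.span_induction generalizing g with
    | mem x hx =>
      obtain ⟨m, rfl⟩ := hx
      obtain ⟨s, rfl⟩ := hI g hg
      exact ⟨op s • m, semilinear_op_smul i s m, Submodule.subset_span ⟨s, hg, m, rfl⟩⟩
    | zero => exact ⟨0, by simp, zero_mem _⟩
    | add x y _ _ ihx ihy =>
      obtain ⟨a, ha, ha'⟩ := ihx g hg
      obtain ⟨b, hb, hb'⟩ := ihy g hg
      exact ⟨a + b, by rw [map_add, ha, hb, smul_add], add_mem ha' hb'⟩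
    | smul γ x _ ih =>
      rw [← mul_smul]
      exact ih (γ.unop * g) (I.mul_mem_left _ hg)
  · exact ⟨0, map_zero i, zero_mem _⟩
  · rintro _ _ ⟨a, rfl, ha⟩ ⟨b, rfl, hb⟩
    exact ⟨a + b, map_add i a b, add_mem ha hb⟩

omit [Algebra R Λ] in
/-- Maps that agree on `M` agree on its hull. -/
theorem IsHull.ext (hi : IsHull π i) {f g : P →ₗ[Γᵐᵒᵖ] P'} (h : ∀ m, f (i m) = g (i m)) :
    f = g :=
  LinearMap.ext_on_range hi.span_range h

section Maps

variable {X : Type u} [AddCommGroup X] [Module (TripleRing ι I)ᵐᵒᵖ X] {q : M × P →+ X}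
  {X' : Type u} [AddCommGroup X'] [Module (TripleRing ι I)ᵐᵒᵖ X'] {q' : M' × P' →+ X'}

/-- The matrix `(0 0; 0 c)` picks the second component. -/
theorem IsTriplePres.smul_snd (hq : IsTriplePres I i q) (c : Γ) (m : M) (p : P) :
    op (tripleEntry ι I 0 0 c) • q (m, p) = q (0, op c • p) := by
  rw [← hq.apply_smul]; simp

theorem IsTriplePres.smul_fst (hq : IsTriplePres I i q) (a : Λ) (m : M) (p : P) :
    op (tripleEntry ι I a 0 0) • q (m, p) = q (op a • m, 0) := by
  rw [← hq.apply_smul]; simp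

/-- The matrix `(0 1; 0 0)` induces the structure map of the triple. -/
theorem IsTriplePres.smul_offDiag (hq : IsTriplePres I i q) (m : M) (p : P) :
    op (tripleEntry ι I 0 1 0) • q (m, p) = q (0, i m) := by
  rw [← hq.apply_smul]; simp

theorem IsTriplePres.eq_add (q : M × P →+ X) (m : M) (p : P) :
    q (m, p) = q (m, 0) + q (0, p) := by
  rw [← map_add]; simp

omit [Module (TripleRing ι I)ᵐᵒᵖ X] in
theorem map_eq_map_iff_sub {q : M × P →+ X} (x y : M × P) : q x = q y ↔ q (x - y) = 0 := by
  rw [map_sub, sub_eq_zero]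

theorem tripleRing_smul_eq (d : (TripleRing ι I)ᵐᵒᵖ) :
    ∃ a b c, d = op (tripleEntry ι I a b c) := by
  obtain ⟨a, ha⟩ := Ideal.Quotient.mk_surjective d.unop.a
  obtain ⟨b, hb⟩ := Ideal.Quotient.mk_surjective d.unop.b
  obtain ⟨c, hc⟩ := Ideal.Quotient.mk_surjective d.unop.c
  exact ⟨a, b, c, unop_injective (TriangularRing.ext ha.symm hb.symm hc.symm)⟩

/-- A map of hulls induces a map of the presented modules. -/
theorem IsTriplePres.exists_map (hq : IsTriplePres I i q) (hq' : IsTriplePres I i' q')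
    (α : M →ₗ[Λᵐᵒᵖ] M') (β : P →ₗ[Γᵐᵒᵖ] P') (h : ∀ m, β (i m) = i' (α m)) :
    ∃ e : X →ₗ[(TripleRing ι I)ᵐᵒᵖ] X', ∀ m p, e (q (m, p)) = q' (α m, β p) := by
  have key : ∀ x y : M × P, q x = q y → q' (α x.1, β x.2) = q' (α y.1, β y.2) := by
    rintro ⟨m, p⟩ ⟨m', p'⟩ hxy
    rw [map_eq_map_iff_sub] at hxy ⊢
    obtain ⟨h1, h2⟩ := (hq.apply_eq_zero _ _).1 hxy
    simp only [Prod.mk_sub_mk, ← map_sub]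
    refine (hq'.apply_eq_zero _ _).2 ⟨?_, map_mem_rightMul I β h2⟩
    rw [← h]
    exact map_mem_rightMul I β h1
  choose s hs using hq.surjective
  have hs' : ∀ m p, q' (α (s (q (m, p))).1, β (s (q (m, p))).2) = q' (α m, β p) :=
    fun m p => key _ (m, p) (hs _)
  refine ⟨{ toFun := fun x => q' (α (s x).1, β (s x).2), map_add' := fun x y => ?_,
            map_smul' := fun d x => ?_ }, hs'⟩
  · rw [← map_add, Prod.mk_add_mk, ← map_add, ← map_add]
    exact key _ (s x + s y) (by rw [hs, map_add, hs, hs])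
  · obtain ⟨a, b, c, rfl⟩ := tripleRing_smul_eq d
    rw [RingHom.id_apply, ← hq'.apply_smul, ← map_smul α, ← h, ← map_smul β, ← map_smul β,
      ← map_add]
    exact key _ (op a • (s x).1, op b • i (s x).1 + op c • (s x).2) (by
      rw [hs, hq.apply_smul, Prod.mk.eta, hs])

theorem IsTriplePres.nonempty_equiv (hq : IsTriplePres I i q) (hq' : IsTriplePres I i' q')
    (α : M ≃ₗ[Λᵐᵒᵖ] M') (β : P ≃ₗ[Γᵐᵒᵖ] P') (h : ∀ m, β (i m) = i' (α m)) :
    Nonempty (X ≃ₗ[(TripleRing ι I)ᵐᵒᵖ] X') := by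
  obtain ⟨e, he⟩ := hq.exists_map hq' α.toLinearMap β.toLinearMap h
  obtain ⟨e', he'⟩ := hq'.exists_map hq α.symm.toLinearMap β.symm.toLinearMap fun m => by
    rw [LinearEquiv.coe_coe, LinearEquiv.coe_coe, LinearEquiv.symm_apply_eq, h,
      LinearEquiv.apply_symm_apply]
  refine ⟨LinearEquiv.ofLinearMap e e' (LinearMap.ext fun x => ?_) (LinearMap.ext fun x => ?_)⟩
  · obtain ⟨⟨m, p⟩, rfl⟩ := hq'.surjective x
    simp [he, he']
  · obtain ⟨⟨m, p⟩, rfl⟩ := hq.surjective x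
    simp [he, he']

/-- A presentation can be transported along an isomorphism. -/
theorem IsTriplePres.comp_equiv (hq : IsTriplePres I i q)
    (e : X ≃ₗ[(TripleRing ι I)ᵐᵒᵖ] X') :
    IsTriplePres I i ((e : X →+ X').comp q) where
  apply_smul a b c m p := by
    change e (q _) = _ • e (q _)
    rw [hq.apply_smul, map_smul]
  surjective := e.surjective.comp hq.surjective
  apply_eq_zero m p := by
    rw [← hq.apply_eq_zero]
    exact e.map_eq_zero_iff

/-- If the hull `P'` is complete, every map of the presented modules is induced by a map of
hulls: the map `P → P' / P' I` lifts to `P → P'` as `Γ` is hereditary, and the lift maps `M` to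
`M'` since `P' I` is contained in `M'`. -/
theorem IsTriplePres.exists_lift (H : IsHereditaryPair ι I π) (hi : IsHull π i)
    (hi' : IsHull π i') (hred : IsCReduced (baseOp Γ π) P') (hpre : IsCPrecomplete (baseOp Γ π) P')
    (hq : IsTriplePres I i q) (hq' : IsTriplePres I i' q') (e : X →ₗ[(TripleRing ι I)ᵐᵒᵖ] X') :
    ∃ (α : M →ₗ[Λᵐᵒᵖ] M') (β : P →ₗ[Γᵐᵒᵖ] P'), (∀ m, β (i m) = i' (α m)) ∧
      ∀ m p, e (q (m, p)) = q' (α m, β p) := by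
  have h2 : ∀ p, ∃ p', e (q (0, p)) = q' (0, p') := fun p => by
    obtain ⟨⟨m', p'⟩, h⟩ := hq'.surjective (e (q (0, p)))
    refine ⟨op (1 : Γ) • p', ?_⟩
    rw [← hq'.smul_snd 1 m' p', h, ← map_smul, hq.smul_snd, op_one, one_smul]
  have h1 : ∀ m, ∃ m', e (q (m, 0)) = q' (m', 0) := fun m => by
    obtain ⟨⟨m', p'⟩, h⟩ := hq'.surjective (e (q (m, 0)))
    refine ⟨op (1 : Λ) • m', ?_⟩
    rw [← hq'.smul_fst 1 m' p', h, ← map_smul, hq.smul_fst, op_one, one_smul]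
  choose b hb using h2
  choose a ha using h1
  have hz : ∀ p', q' (0, p') = 0 → p' ∈ rightMul I P' := fun p' h =>
    ((hq'.apply_eq_zero _ _).1 h).2
  let g : P →ₗ[Γᵐᵒᵖ] P' ⧸ rightMul I P' :=
    { toFun := fun p => (rightMul I P').mkQ (b p)
      map_add' := fun p₁ p₂ => by
        rw [← map_add]
        refine (Submodule.Quotient.eq _).2 (hz _ ?_)
        have : ((0 : M'), b (p₁ + p₂) - (b p₁ + b p₂))
          = (0, b (p₁ + p₂)) - ((0, b p₁) + (0, b p₂)) := by simp
        rw [this, map_sub, map_add, ← hb, ← hb, ← hb, ← map_add, ← map_add, Prod.mk_add_mk,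
          add_zero, sub_self]
      map_smul' := fun γ p => by
        rw [RingHom.id_apply, ← map_smul]
        refine (Submodule.Quotient.eq _).2 (hz _ ?_)
        have : ((0 : M'), b (γ • p) - γ • b p) = (0, b (γ • p)) - (0, γ • b p) := by simp
        have h3 := hq'.smul_snd γ.unop 0 (b p)
        rw [← hb, ← map_smul, hq.smul_snd, op_unop] at h3
        rw [this, map_sub, ← hb, h3, sub_self] }
  obtain ⟨n, hn⟩ := H.exists_pow_mem
  obtain ⟨β, hβ⟩ := exists_lift_of_complete H.hereditary (baseOp_central Γ π) hi.torsionFree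
    hred hpre (rightMul I P') n (fun x => by
      rw [← op_pow]; exact smul_mem_rightMul I hn x) g
  have hβq : ∀ p, e (q (0, p)) = q' (0, β p) := by
    intro p
    rw [hb, map_eq_map_iff_sub, Prod.mk_sub_mk, sub_zero]
    refine (hq'.apply_eq_zero _ _).2 ⟨by rw [map_zero]; exact zero_mem _, ?_⟩
    exact (Submodule.Quotient.eq _).1 (hβ p).symm
  -- `i' (a m)` and `β (i m)` agree modulo `P' I`
  have hcmp : ∀ m, i' (a m) - β (i m) ∈ rightMul I P' := by
    intro m
    refine hz _ ?_
    have : ((0 : M'), i' (a m) - β (i m)) = (0, i' (a m)) - (0, β (i m)) := by simp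
    rw [this, map_sub, ← hβq, ← hq'.smul_offDiag _ 0, ← ha, ← map_smul, hq.smul_offDiag,
      sub_self]
  have hα : ∀ m, ∃ m', i' m' = β (i m) := by
    intro m
    obtain ⟨m', hm', -⟩ := hi'.exists_preimage H.exists_preimage (hcmp m)
    exact ⟨a m - m', by rw [map_sub, hm', sub_sub_cancel]⟩
  choose α hα using hα
  refine ⟨{ toFun := α, map_add' := fun x y => hi'.injective ?_,
            map_smul' := fun s x => hi'.injective ?_ }, β, fun m => (hα m).symm, fun m p => ?_⟩
  · simp only [map_add, hα]
  · rw [RingHom.id_apply, i'.map_smulₛₗ, hα, hα, i.map_smulₛₗ, map_smul]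
  · change _ = q' (α m, β p)
    rw [IsTriplePres.eq_add q m p, map_add, hβq, IsTriplePres.eq_add q' (α m), ha]
    congr 1
    rw [map_eq_map_iff_sub, Prod.mk_sub_mk, sub_zero]
    refine (hq'.apply_eq_zero _ _).2 ⟨?_, zero_mem _⟩
    rw [map_sub, hα]
    exact hcmp m

theorem IsHereditaryPair.exists_pow_mem_smul (H : IsHereditaryPair ι I π) :
    ∃ m, ∀ (P : Type u) [AddCommGroup P] [Module Γᵐᵒᵖ P] (x : P),
      x ∈ rightMul (I ^ m) P → ∃ y, x = baseOp Γ π • y := by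
  obtain ⟨m, hm⟩ := H.exists_pow_le
  refine ⟨m, fun P _ _ x hx => ?_⟩
  refine rightMul_induction (I ^ m) (C := fun x => ∃ y, x = baseOp Γ π • y) ?_ ?_ ?_ hx
  · intro g hg p
    obtain ⟨y, rfl⟩ := hm g hg
    exact ⟨op y • p, by rw [← mul_smul, ← op_mul, Algebra.commutes]⟩
  · exact ⟨0, (smul_zero _).symm⟩
  · rintro _ _ ⟨x, rfl⟩ ⟨y, rfl⟩
    exact ⟨x + y, (smul_add _ _ _).symm⟩

/-- An endomorphism of a complete `Γ`-module that is the identity modulo `P I` is bijective. -/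
theorem IsHereditaryPair.bijective_of_sub_mem (H : IsHereditaryPair ι I π)
    (hred : IsCReduced (baseOp Γ π) P) (hpre : IsCPrecomplete (baseOp Γ π) P) (β : P →ₗ[Γᵐᵒᵖ] P)
    (hβ : ∀ p, p - β p ∈ rightMul I P) : Function.Bijective β := by
  obtain ⟨m, hm⟩ := H.exists_pow_mem_smul
  refine bijective_of_pow_mem_smul hred hpre β (LinearMap.id - β) (fun p => ?_) m fun p =>
    hm P _ (pow_mem_rightMul_pow I _ hβ m p)
  simp

/-- An idempotent endomorphism of a reduced `Γ`-module with image in `P I` is zero. -/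
theorem IsHereditaryPair.eq_zero_of_idempotent (H : IsHereditaryPair ι I π)
    (hred : IsCReduced (baseOp Γ π) P) (β : P →ₗ[Γᵐᵒᵖ] P) (hβ : ∀ p, β p ∈ rightMul I P)
    (hidem : ∀ p, β (β p) = β p) (p : P) : β p = 0 := by
  obtain ⟨m, hm⟩ := H.exists_pow_mem_smul
  have hpow : ∀ k p, (β ^ k) (β p) = β p := by
    intro k p
    induction k with
    | zero => rfl
    | succ k ih => rw [pow_succ, Module.End.mul_apply, hidem, ih]
  refine hred _ fun k => ?_
  induction k with
  | zero => exact ⟨β p, by simp⟩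
  | succ k ih =>
    obtain ⟨y, hy⟩ := ih
    obtain ⟨z, hz⟩ := hm P _ (pow_mem_rightMul_pow I β hβ m y)
    refine ⟨z, ?_⟩
    rw [pow_succ, mul_smul, ← hz, ← map_smul, hy, hpow]

theorem IsTriplePres.sub_mem (hq : IsTriplePres I i q) {p p' : P} (h : q (0, p) = q (0, p')) :
    p - p' ∈ rightMul I P := by
  rw [map_eq_map_iff_sub, Prod.mk_sub_mk, sub_zero] at h
  exact ((hq.apply_eq_zero _ _).1 h).2

/-- An endomorphism of a complete hull that induces the identity on the triple is bijective. -/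
theorem IsTriplePres.bijective (H : IsHereditaryPair ι I π) (hi : IsHull π i)
    (hred : IsCReduced (baseOp Γ π) P) (hpre : IsCPrecomplete (baseOp Γ π) P)
    (hq : IsTriplePres I i q) (α : M →ₗ[Λᵐᵒᵖ] M) (β : P →ₗ[Γᵐᵒᵖ] P)
    (h : ∀ m, β (i m) = i (α m)) (hid : ∀ m p, q (m, p) = q (α m, β p)) :
    Function.Bijective α := by
  have hβ : ∀ p, p - β p ∈ rightMul I P := fun p => by
    have := hid 0 p
    rw [map_zero] at this
    exact hq.sub_mem this
  have hb := H.bijective_of_sub_mem hred hpre β hβ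
  constructor
  · intro x y hxy
    refine hi.injective (hb.1 ?_)
    rw [h, h, hxy]
  · intro m
    obtain ⟨p, hp⟩ := hb.2 (i m)
    obtain ⟨m', hm', -⟩ := hi.exists_preimage H.exists_preimage (hβ p)
    refine ⟨m + m', hi.injective ?_⟩
    rw [← h, map_add, hm', hp, add_sub_cancel, hp]

end Maps

end Presentation

/-! ### The divisible part -/

section Divisible

variable {B : Type*} [Ring B]

/-- The intersection of all `cᵏ P`, for a central element `c`. -/
def divisiblePart (c : B) (hc : ∀ b, b * c = c * b) (P : Type*) [AddCommGroup P] [Module B P] :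
    Submodule B P where
  carrier := {x | ∀ k : ℕ, ∃ y : P, c ^ k • y = x}
  add_mem' {x y} hx hy k := by
    obtain ⟨a, rfl⟩ := hx k
    obtain ⟨b, rfl⟩ := hy k
    exact ⟨a + b, smul_add _ _ _⟩
  zero_mem' k := ⟨0, smul_zero _⟩
  smul_mem' b x hx k := by
    obtain ⟨a, rfl⟩ := hx k
    exact ⟨b • a, by rw [← mul_smul, ← mul_smul, commute_pow_central hc]⟩

variable {c : B} (hc : ∀ b, b * c = c * b) {P : Type*} [AddCommGroup P] [Module B P]

theorem mem_divisiblePart {x : P} :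
    x ∈ divisiblePart c hc P ↔ ∀ k : ℕ, ∃ y : P, c ^ k • y = x := Iff.rfl

theorem isCReduced_quotient_divisiblePart : IsCReduced c (P ⧸ divisiblePart c hc P) := by
  intro x hx
  obtain ⟨x, rfl⟩ := Submodule.mkQ_surjective _ x
  refine (Submodule.Quotient.mk_eq_zero _).2 fun k => ?_
  obtain ⟨y, hy⟩ := hx k
  obtain ⟨y, rfl⟩ := Submodule.mkQ_surjective _ y
  rw [← map_smul] at hy
  obtain ⟨z, hz⟩ := ((Submodule.Quotient.eq _).1 hy.symm : x - c ^ k • y ∈ _) k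
  exact ⟨y + z, by rw [smul_add, hz, add_sub_cancel]⟩

theorem IsCPrecomplete.quotient_divisiblePart (h : IsCPrecomplete c P) :
    IsCPrecomplete c (P ⧸ divisiblePart c hc P) := by
  intro s hs
  choose t ht using fun k => Submodule.mkQ_surjective _ (s k)
  obtain rfl : (fun k => (divisiblePart c hc P).mkQ (t k)) = s := funext ht
  obtain ⟨l, hl⟩ := h t fun k => by
    obtain ⟨y, hy⟩ := hs k
    obtain ⟨y, rfl⟩ := Submodule.mkQ_surjective _ y
    rw [← map_smul, ← map_sub] at hy
    obtain ⟨z, hz⟩ := ((Submodule.Quotient.eq _).1 hy : t (k + 1) - t k - c ^ k • y ∈ _) k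
    exact ⟨y + z, by rw [smul_add, hz, add_sub_cancel]⟩
  refine ⟨(divisiblePart c hc P).mkQ l, fun k => ?_⟩
  obtain ⟨y, hy⟩ := hl k
  exact ⟨(divisiblePart c hc P).mkQ y, by rw [← map_sub, hy, map_smul]⟩

theorem mem_divisiblePart_of_smul_mem (hP : ∀ p : P, c • p = 0 → p = 0) {x : P}
    (hx : c • x ∈ divisiblePart c hc P) : x ∈ divisiblePart c hc P := by
  intro k
  obtain ⟨y, hy⟩ := hx (k + 1)
  refine ⟨y, ?_⟩
  rw [← sub_eq_zero]
  refine hP _ ?_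
  rw [smul_sub, ← mul_smul, ← pow_succ', hy, sub_self]

end Divisible

/-! ### Reduced products of hulls -/

section HullProduct

variable {R Λ Γ : Type u} [CommRing R] [Ring Λ] [Ring Γ] [Algebra R Λ] [Algebra R Γ]
  {ι : Λ →+* Γ} {I : Ideal Γ} [I.IsTwoSided] {π : R}
  {M P : Type u} [AddCommGroup M] [Module Λᵐᵒᵖ M] [AddCommGroup P]
  [Module Γᵐᵒᵖ P] {i : M →ₛₗ[RingHom.op ι] P}

omit [I.IsTwoSided] in
theorem IsHereditaryPair.map_base_smul (H : IsHereditaryPair ι I π)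
    (i : M →ₛₗ[RingHom.op ι] P) (k : ℕ) (m : M) :
    i (baseOp Λ π ^ k • m) = baseOp Γ π ^ k • i m := by
  rw [← op_pow, ← op_pow, semilinear_op_smul, map_pow, H.map_algebraMap]

theorem torsionFree_pow (hP : ∀ p : P, baseOp Γ π • p = 0 → p = 0) (k : ℕ) {p p' : P}
    (h : baseOp Γ π ^ k • p = baseOp Γ π ^ k • p') : p = p' := by
  induction k with
  | zero => simpa using h
  | succ k ih =>
    refine ih ?_
    rw [← sub_eq_zero]
    refine hP _ ?_
    rw [smul_sub, ← mul_smul, ← mul_smul, ← pow_succ', h, sub_self]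

/-- A power of `π` maps the hull of `M` into `M`. -/
theorem IsHull.exists_smul_mem (H : IsHereditaryPair ι I π) :
    ∃ n, ∀ {M P : Type u} [AddCommGroup M] [Module Λᵐᵒᵖ M] [AddCommGroup P]
      [Module Γᵐᵒᵖ P] {i : M →ₛₗ[RingHom.op ι] P}, IsHull π i →
        ∀ p, ∃ m, i m = baseOp Γ π ^ n • p := by
  obtain ⟨n, hn⟩ := H.exists_pow_mem
  refine ⟨n, fun hi p => ?_⟩
  obtain ⟨m, hm, -⟩ := hi.exists_preimage H.exists_preimage (smul_mem_rightMul I hn p)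
  exact ⟨m, by rw [hm, op_pow]⟩

theorem IsHull.isCReduced (H : IsHereditaryPair ι I π) (hi : IsHull π i)
    (hM : IsCReduced (baseOp Λ π) M) : IsCReduced (baseOp Γ π) P := by
  obtain ⟨n, hn⟩ := IsHull.exists_smul_mem H
  intro p hp
  obtain ⟨m, hm⟩ := hn hi p
  have : m = 0 := hM m fun k => by
    obtain ⟨p', rfl⟩ := hp k
    obtain ⟨m', hm'⟩ := hn hi p'
    refine ⟨m', hi.injective ?_⟩
    rw [H.map_base_smul, hm', hm, ← mul_smul, ← mul_smul, ← pow_add, ← pow_add, add_comm]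
  refine torsionFree_pow hi.torsionFree n ?_
  rw [← hm, this, map_zero, smul_zero]

theorem IsHull.isCPrecomplete (H : IsHereditaryPair ι I π) (hi : IsHull π i)
    (hM : IsCPrecomplete (baseOp Λ π) M) : IsCPrecomplete (baseOp Γ π) P := by
  obtain ⟨n, hn⟩ := IsHull.exists_smul_mem H
  intro s hs
  choose m hm using fun k => hn hi (s k)
  obtain ⟨l, hl⟩ := hM m fun k => by
    obtain ⟨y, hy⟩ := hs k
    obtain ⟨m', hm'⟩ := hn hi y
    refine ⟨m', hi.injective ?_⟩
    rw [map_sub, hm, hm, ← smul_sub, hy, H.map_base_smul, hm', ← mul_smul, ← mul_smul, ← pow_add,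
      ← pow_add, add_comm]
  -- `π ^ n` divides `i l`, and the quotient is the limit
  obtain ⟨y, hy⟩ := hl n
  have hp : i l = baseOp Γ π ^ n • (s n + i y) := by
    rw [smul_add, ← H.map_base_smul, ← hy, map_sub, hm, add_sub_cancel]
  refine ⟨s n + i y, fun k => ?_⟩
  obtain ⟨z, hz⟩ := hl (k + n)
  have hstep : ∀ j, ∃ w, s (k + j) - s k = baseOp Γ π ^ k • w := by
    intro j
    induction j with
    | zero => exact ⟨0, by simp⟩
    | succ j ih =>
      obtain ⟨w, hw⟩ := ih
      obtain ⟨w', hw'⟩ := hs (k + j)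
      refine ⟨w + baseOp Γ π ^ j • w', ?_⟩
      rw [smul_add, ← mul_smul, ← pow_add, ← hw, ← hw', ← add_assoc]
      abel
  obtain ⟨w, hw⟩ := hstep n
  refine ⟨i z + w, ?_⟩
  have h1 : s n + i y - s (k + n) = baseOp Γ π ^ k • i z := by
    refine torsionFree_pow hi.torsionFree n ?_
    rw [smul_sub, ← hp, ← hm, ← map_sub, hz, H.map_base_smul, ← mul_smul, ← pow_add, add_comm]
  rw [smul_add, ← hw, ← h1]
  abel

/-- The map of reduced products induced by a family of semilinear maps. -/
def RedProd.map {B B' : Type*} [Ring B] [Ring B'] {σ : B →+* B'} {K : Type u} (l : Filter K)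
    {Y Y' : K → Type u} [∀ k, AddCommGroup (Y k)] [∀ k, Module B (Y k)]
    [∀ k, AddCommGroup (Y' k)] [∀ k, Module B' (Y' k)] (f : ∀ k, Y k →ₛₗ[σ] Y' k) :
    RedProd B l Y →ₛₗ[σ] RedProd B' l Y' :=
  (eventuallyZero B l Y).mapQ (eventuallyZero B' l Y')
    { toFun := fun y k => f k (y k)
      map_add' := fun x y => funext fun k => map_add (f k) _ _
      map_smul' := fun b x => funext fun k => (f k).map_smulₛₗ b _ }
    fun y hy => hy.mono fun k hk => by
      change f k (y k) = 0
      rw [hk, map_zero]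

variable {K : Type u} {l : Filter K} {Mf Pf : K → Type u}
  [∀ k, AddCommGroup (Mf k)] [∀ k, Module Λᵐᵒᵖ (Mf k)] [∀ k, AddCommGroup (Pf k)]
  [∀ k, Module Γᵐᵒᵖ (Pf k)] {jf : ∀ k, Mf k →ₛₗ[RingHom.op ι] Pf k}

theorem RedProd.map_mk (m : ∀ k, Mf k) :
    RedProd.map l jf (mk Λᵐᵒᵖ l m) = mk Γᵐᵒᵖ l fun k => jf k (m k) := rfl

omit [I.IsTwoSided] in
/-- Reduced products commute with the formation of hulls, as `Γ` is finite over `Λ`. -/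
theorem IsHull.redProd (H : IsHereditaryPair ι I π) (hj : ∀ k, IsHull π (jf k)) :
    IsHull π (RedProd.map l jf) where
  injective := by
    rw [injective_iff_map_eq_zero]
    intro x hx
    obtain ⟨m, rfl⟩ := RedProd.mk_surjective x
    rw [RedProd.map_mk, RedProd.mk_eq_zero] at hx
    rw [RedProd.mk_eq_zero]
    exact hx.mono fun k hk => (hj k).injective (by rw [hk, map_zero])
  span_range := by
    obtain ⟨t, ht⟩ := H.finite
    have hgen : ∀ k (p : Pf k), ∃ a : Γ → Mf k, p = ∑ g ∈ t, op g • jf k (a g) := by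
      intro k p
      have hp : p ∈ Submodule.span Γᵐᵒᵖ (Set.range (jf k)) := (hj k).span_range ▸ Submodule.mem_top
      induction hp using Submodule.span_induction with
      | mem x hx =>
        obtain ⟨m, rfl⟩ := hx
        obtain ⟨s, hs⟩ := ht 1
        refine ⟨fun g => op (s g) • m, ?_⟩
        simp_rw [semilinear_op_smul, ← mul_smul, ← op_mul]
        rw [← Finset.sum_smul, ← Finset.op_sum, ← hs, op_one, one_smul]
      | zero => exact ⟨0, by simp⟩
      | add x y _ _ hx hy =>
        obtain ⟨a, rfl⟩ := hx
        obtain ⟨b, rfl⟩ := hy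
        exact ⟨a + b, by simp [Finset.sum_add_distrib]⟩
      | smul γ x _ hx =>
        obtain ⟨a, rfl⟩ := hx
        choose s hs using fun g : Γ => ht (g * γ.unop)
        refine ⟨fun g' => ∑ g ∈ t, op (s g g') • a g, ?_⟩
        simp_rw [map_sum, semilinear_op_smul, Finset.smul_sum]
        rw [Finset.sum_comm]
        refine Finset.sum_congr rfl fun g _ => ?_
        simp_rw [← mul_smul, ← op_mul]
        rw [← Finset.sum_smul, ← Finset.op_sum, ← hs, op_mul, op_unop]
    rw [eq_top_iff]
    rintro x -
    obtain ⟨p, rfl⟩ := RedProd.mk_surjective x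
    choose a ha using fun k => hgen k (p k)
    have : RedProd.mk Γᵐᵒᵖ l p
        = ∑ g ∈ t, op g • RedProd.map l jf (RedProd.mk Λᵐᵒᵖ l fun k => a k g) := by
      have h1 : p = ∑ g ∈ t, op g • fun k => jf k (a k g) := by
        funext k
        rw [Finset.sum_apply]
        exact ha k
      refine (congrArg (RedProd.mk Γᵐᵒᵖ l) h1).trans ?_
      refine (map_sum (eventuallyZero Γᵐᵒᵖ l Pf).mkQ _ _).trans ?_
      exact Finset.sum_congr rfl fun g _ => RedProd.mk_smul _ _
    rw [this]
    exact sum_mem fun g _ => Submodule.smul_mem _ _ (Submodule.subset_span ⟨_, rfl⟩)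
  torsionFree x hx := by
    obtain ⟨p, rfl⟩ := RedProd.mk_surjective x
    rw [← RedProd.mk_smul, RedProd.mk_eq_zero] at hx
    rw [RedProd.mk_eq_zero]
    exact hx.mono fun k hk => (hj k).torsionFree _ hk

theorem mem_rightMul_redProd (hfg : I.FG) (p : ∀ k, Pf k) :
    RedProd.mk Γᵐᵒᵖ l p ∈ rightMul I (RedProd Γᵐᵒᵖ l Pf) ↔
      ∀ᶠ k in l, p k ∈ rightMul I (Pf k) := by
  classical
  obtain ⟨t, ht⟩ := hfg
  have htI : ∀ g ∈ t, g ∈ I := fun g hg => ht ▸ Ideal.subset_span hg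
  have hsum : ∀ a : Γ → ∀ k, Pf k, RedProd.mk Γᵐᵒᵖ l (fun k => ∑ g ∈ t, op g • a g k)
      = ∑ g ∈ t, op g • RedProd.mk Γᵐᵒᵖ l (a g) := by
    intro a
    have h1 : (fun k => ∑ g ∈ t, op g • a g k) = ∑ g ∈ t, op g • a g := by
      funext k
      rw [Finset.sum_apply]; rfl
    rw [h1]
    refine (map_sum (eventuallyZero Γᵐᵒᵖ l Pf).mkQ _ _).trans ?_
    exact Finset.sum_congr rfl fun g _ => RedProd.mk_smul _ _
  constructor
  · intro h
    obtain ⟨a, ha⟩ := exists_sum_of_mem_rightMul I ht h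
    choose b hb using fun g => RedProd.mk_surjective (a g)
    obtain rfl : (fun g => RedProd.mk Γᵐᵒᵖ l (b g)) = a := funext hb
    rw [← hsum, RedProd.mk_eq_mk] at ha
    filter_upwards [ha] with k hk
    rw [hk]
    exact sum_mem_rightMul I htI fun g => b g k
  · intro h
    let a : Γ → ∀ k, Pf k := fun g k =>
      if hk : p k ∈ rightMul I (Pf k) then (exists_sum_of_mem_rightMul I ht hk).choose g else 0
    have : RedProd.mk Γᵐᵒᵖ l p = RedProd.mk Γᵐᵒᵖ l (fun k => ∑ g ∈ t, op g • a g k) := by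
      rw [RedProd.mk_eq_mk]
      filter_upwards [h] with k hk
      simp only [a, dif_pos hk]
      exact (exists_sum_of_mem_rightMul I ht hk).choose_spec
    rw [this, hsum]
    exact sum_mem_rightMul I htI _

variable {Xf : K → Type u} [∀ k, AddCommGroup (Xf k)] [∀ k, Module (TripleRing ι I)ᵐᵒᵖ (Xf k)]

/-- Reduced products of presentations are presentations. -/
theorem IsTriplePres.exists_redProd (hfg : I.FG) {q : ∀ k, Mf k × Pf k →+ Xf k}
    (hq : ∀ k, IsTriplePres I (jf k) (q k)) :
    ∃ q' : RedProd Λᵐᵒᵖ l Mf × RedProd Γᵐᵒᵖ l Pf →+ RedProd (TripleRing ι I)ᵐᵒᵖ l Xf,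
      IsTriplePres I (RedProd.map l jf) q' ∧ ∀ m p, q' (RedProd.mk _ l m, RedProd.mk _ l p)
        = RedProd.mk _ l fun k => q k (m k, p k) := by
  choose r hr using fun x : RedProd Λᵐᵒᵖ l Mf => RedProd.mk_surjective x
  choose s hs using fun x : RedProd Γᵐᵒᵖ l Pf => RedProd.mk_surjective x
  let F : RedProd Λᵐᵒᵖ l Mf × RedProd Γᵐᵒᵖ l Pf → RedProd (TripleRing ι I)ᵐᵒᵖ l Xf :=
    fun x => RedProd.mk _ l fun k => q k (r x.1 k, s x.2 k)
  have hF : ∀ m p, F (RedProd.mk _ l m, RedProd.mk _ l p)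
      = RedProd.mk _ l fun k => q k (m k, p k) := by
    intro m p
    rw [RedProd.mk_eq_mk]
    filter_upwards [RedProd.mk_eq_mk.1 (hr (RedProd.mk _ l m)),
      RedProd.mk_eq_mk.1 (hs (RedProd.mk _ l p))] with k h1 h2
    rw [h1, h2]
  refine ⟨AddMonoidHom.mk' F ?_, ⟨?_, ?_, ?_⟩, hF⟩
  · rintro ⟨x, y⟩ ⟨x', y'⟩
    obtain ⟨m, rfl⟩ := RedProd.mk_surjective x
    obtain ⟨m', rfl⟩ := RedProd.mk_surjective x'
    obtain ⟨p, rfl⟩ := RedProd.mk_surjective y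
    obtain ⟨p', rfl⟩ := RedProd.mk_surjective y'
    rw [Prod.mk_add_mk, ← RedProd.mk_add, ← RedProd.mk_add, hF, hF, hF, ← RedProd.mk_add]
    congr 1
    funext k
    exact map_add (q k) (m k, p k) (m' k, p' k)
  · intro a b c x y
    obtain ⟨m, rfl⟩ := RedProd.mk_surjective x
    obtain ⟨p, rfl⟩ := RedProd.mk_surjective y
    rw [RedProd.map_mk, ← RedProd.mk_smul, ← RedProd.mk_smul, ← RedProd.mk_smul,
      ← RedProd.mk_add]
    refine (hF _ _).trans (Eq.trans ?_ (congrArg _ (hF m p).symm))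
    rw [← RedProd.mk_smul]
    congr 1
    funext k
    exact (hq k).apply_smul a b c (m k) (p k)
  · intro x
    obtain ⟨x, rfl⟩ := RedProd.mk_surjective x
    choose y hy using fun k => (hq k).surjective (x k)
    refine ⟨(RedProd.mk _ l fun k => (y k).1, RedProd.mk _ l fun k => (y k).2),
      (hF _ _).trans ?_⟩
    congr 1
    funext k
    exact hy k
  · intro x y
    obtain ⟨m, rfl⟩ := RedProd.mk_surjective x
    obtain ⟨p, rfl⟩ := RedProd.mk_surjective y
    change F _ = 0 ↔ _
    rw [hF, RedProd.mk_eq_zero, RedProd.map_mk, mem_rightMul_redProd hfg,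
      mem_rightMul_redProd hfg, ← Filter.eventually_and]
    exact Filter.eventually_congr (Filter.Eventually.of_forall fun k =>
      (hq k).apply_eq_zero _ _)

/-- The map induced by `i : M → P` on the quotients by the divisible parts. -/
def quotientDivisible (H : IsHereditaryPair ι I π) (i : M →ₛₗ[RingHom.op ι] P) :
    (M ⧸ divisiblePart (baseOp Λ π) (baseOp_central Λ π) M) →ₛₗ[RingHom.op ι]
      (P ⧸ divisiblePart (baseOp Γ π) (baseOp_central Γ π) P) :=
  (divisiblePart (baseOp Λ π) (baseOp_central Λ π) M).mapQ _ i fun x hx k => by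
    obtain ⟨y, rfl⟩ := hx k
    exact ⟨i y, (H.map_base_smul i k y).symm⟩

theorem IsHull.quotientDivisible (H : IsHereditaryPair ι I π) (hi : IsHull π i) :
    IsHull π (quotientDivisible H i) where
  injective := by
    rw [injective_iff_map_eq_zero]
    intro x hx
    obtain ⟨m, rfl⟩ := Submodule.mkQ_surjective _ x
    have hx : i m ∈ divisiblePart (baseOp Γ π) (baseOp_central Γ π) P :=
      (Submodule.Quotient.mk_eq_zero _).1 hx
    obtain ⟨n, hn⟩ := IsHull.exists_smul_mem H
    refine (Submodule.Quotient.mk_eq_zero _).2 fun k => ?_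
    obtain ⟨p, hp⟩ := hx (k + n)
    obtain ⟨m', hm'⟩ := hn hi p
    refine ⟨m', hi.injective ?_⟩
    rw [H.map_base_smul, hm', ← hp, ← mul_smul, ← pow_add]
  span_range := by
    rw [eq_top_iff]
    rintro x -
    obtain ⟨p, rfl⟩ := Submodule.mkQ_surjective _ x
    have hp : p ∈ Submodule.span Γᵐᵒᵖ (Set.range i) := hi.span_range ▸ Submodule.mem_top
    have := Submodule.mem_map_of_mem
      (f := (divisiblePart (baseOp Γ π) (baseOp_central Γ π) P).mkQ) hp
    rw [Submodule.map_span] at this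
    refine Submodule.span_mono ?_ this
    rintro _ ⟨_, ⟨m, rfl⟩, rfl⟩
    exact ⟨Submodule.mkQ _ m, rfl⟩
  torsionFree x hx := by
    obtain ⟨p, rfl⟩ := Submodule.mkQ_surjective _ x
    rw [← map_smul] at hx
    exact (Submodule.Quotient.mk_eq_zero _).2 (mem_divisiblePart_of_smul_mem _ hi.torsionFree
      ((Submodule.Quotient.mk_eq_zero _).1 hx))

/-- The presented module does not change if the divisible parts are factored out. -/
theorem IsTriplePres.exists_quotientDivisible (H : IsHereditaryPair ι I π) {X : Type u}
    [AddCommGroup X] [Module (TripleRing ι I)ᵐᵒᵖ X] {q : M × P →+ X}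
    (hq : IsTriplePres I i q) : ∃ q', IsTriplePres (X := X) I (quotientDivisible H i) q' := by
  let DM := divisiblePart (baseOp Λ π) (baseOp_central Λ π) M
  let DP := divisiblePart (baseOp Γ π) (baseOp_central Γ π) P
  obtain ⟨n, hn⟩ := H.exists_pow_mem
  have hDP : ∀ p ∈ DP, p ∈ rightMul I P := by
    intro p hp
    obtain ⟨y, rfl⟩ := hp n
    rw [← op_pow]
    exact smul_mem_rightMul I hn y
  have hmem : ∀ p, DP.mkQ p ∈ rightMul I (P ⧸ DP) ↔ p ∈ rightMul I P := by
    intro p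
    refine ⟨fun h => ?_, map_mem_rightMul I DP.mkQ⟩
    obtain ⟨t, ht⟩ := H.fg
    obtain ⟨a, ha⟩ := exists_sum_of_mem_rightMul I ht h
    choose b hb using fun g => Submodule.mkQ_surjective DP (a g)
    obtain rfl : (fun g => DP.mkQ (b g)) = a := funext hb
    have h1 : DP.mkQ p = DP.mkQ (∑ g ∈ t, op g • b g) := by
      rw [ha, map_sum]
      exact Finset.sum_congr rfl fun g _ => (map_smul _ _ _).symm
    rw [← sub_add_cancel p (∑ g ∈ t, op g • b g)]
    exact add_mem (hDP _ ((Submodule.Quotient.eq _).1 h1))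
      (sum_mem_rightMul I (fun g hg => ht ▸ Ideal.subset_span hg) _)
  have hi0 : ∀ m ∈ DM, i m ∈ rightMul I P := by
    intro m hm
    obtain ⟨y, rfl⟩ := hm n
    rw [H.map_base_smul, ← op_pow]
    exact smul_mem_rightMul I hn _
  choose r hr using Submodule.mkQ_surjective DM
  choose s hs using Submodule.mkQ_surjective DP
  let F : (M ⧸ DM) × (P ⧸ DP) → X := fun x => q (r x.1, s x.2)
  have hF : ∀ m p, F (DM.mkQ m, DP.mkQ p) = q (m, p) := by
    intro m p
    rw [map_eq_map_iff_sub, Prod.mk_sub_mk, hq.apply_eq_zero]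
    exact ⟨hi0 _ ((Submodule.Quotient.eq _).1 (hr _)), hDP _ ((Submodule.Quotient.eq _).1 (hs _))⟩
  refine ⟨AddMonoidHom.mk' F ?_, ⟨?_, ?_, ?_⟩⟩
  · rintro ⟨x, y⟩ ⟨x', y'⟩
    obtain ⟨m, rfl⟩ := Submodule.mkQ_surjective _ x
    obtain ⟨m', rfl⟩ := Submodule.mkQ_surjective _ x'
    obtain ⟨p, rfl⟩ := Submodule.mkQ_surjective _ y
    obtain ⟨p', rfl⟩ := Submodule.mkQ_surjective _ y'
    rw [Prod.mk_add_mk, ← map_add, ← map_add, hF, hF, hF, ← map_add, Prod.mk_add_mk]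
  · intro a b c x y
    obtain ⟨m, rfl⟩ := Submodule.mkQ_surjective _ x
    obtain ⟨p, rfl⟩ := Submodule.mkQ_surjective _ y
    refine Eq.trans ?_ ((hq.apply_smul a b c m p).trans (congrArg _ (hF m p).symm))
    exact hF (op a • m) (op b • i m + op c • p)
  · intro x
    obtain ⟨⟨m, p⟩, rfl⟩ := hq.surjective x
    exact ⟨(DM.mkQ m, DP.mkQ p), hF m p⟩
  · intro x y
    obtain ⟨m, rfl⟩ := Submodule.mkQ_surjective _ x
    obtain ⟨p, rfl⟩ := Submodule.mkQ_surjective _ y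
    change F _ = 0 ↔ DP.mkQ (i m) ∈ _ ∧ _
    rw [hF, hq.apply_eq_zero, hmem, hmem]

end HullProduct

/-! ### Reduction modulo `I` and lifting of projective modules -/

section Reduction

variable {R Λ Γ : Type u} [CommRing R] [Ring Λ] [Ring Γ] [Algebra R Λ] [Algebra R Γ]
  {ι : Λ →+* Γ} {I : Ideal Γ} [I.IsTwoSided] {π : R}
  {P V : Type u} [AddCommGroup P] [Module Γᵐᵒᵖ P] [AddCommGroup V] [Module (Γ ⧸ I)ᵐᵒᵖ V]
  {P' V' : Type u} [AddCommGroup P'] [Module Γᵐᵒᵖ P'] [AddCommGroup V'] [Module (Γ ⧸ I)ᵐᵒᵖ V']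

/-- `ρ : P → V` induces an isomorphism `P / P I ≅ V`. -/
structure IsReductionMod (I : Ideal Γ) [I.IsTwoSided] {P V : Type u} [AddCommGroup P]
    [Module Γᵐᵒᵖ P] [AddCommGroup V] [Module (Γ ⧸ I)ᵐᵒᵖ V]
    (ρ : P →ₛₗ[RingHom.op (Ideal.Quotient.mk I)] V) : Prop where
  surjective : Function.Surjective ρ
  apply_eq_zero : ∀ p, ρ p = 0 ↔ p ∈ rightMul I P

theorem reduction_op_smul (ρ : P →ₛₗ[RingHom.op (Ideal.Quotient.mk I)] V) (γ : Γ) (p : P) :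
    ρ (op γ • p) = op (Ideal.Quotient.mk I γ) • ρ p :=
  ρ.map_smulₛₗ (op γ) p

/-- If `Γ` is hereditary and `P` is torsion-free, then `P / P I` is projective over `Γ / I`. -/
theorem IsReductionMod.projective (H : IsHereditaryPair ι I π)
    (hP : ∀ p : P, baseOp Γ π • p = 0 → p = 0)
    {ρ : P →ₛₗ[RingHom.op (Ideal.Quotient.mk I)] V} (hρ : IsReductionMod I ρ) :
    Module.Projective (Γ ⧸ I)ᵐᵒᵖ V := by
  obtain ⟨n, hn⟩ := H.exists_pow_mem
  let F := V →₀ (Γ ⧸ I)ᵐᵒᵖ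
  let _ : Module Γᵐᵒᵖ F := Module.compHom F (RingHom.op (Ideal.Quotient.mk I))
  let _ : Module Γᵐᵒᵖ V := Module.compHom V (RingHom.op (Ideal.Quotient.mk I))
  have hF : ∀ γ ∈ I, ∀ x : F, op γ • x = 0 := by
    intro γ hγ x
    change op (Ideal.Quotient.mk I γ) • x = 0
    rw [Ideal.Quotient.eq_zero_iff_mem.2 hγ, op_zero, zero_smul]
  let L : F →ₗ[(Γ ⧸ I)ᵐᵒᵖ] V := Finsupp.linearCombination _ id
  let f : F →ₗ[Γᵐᵒᵖ] V :=
    { toFun := L, map_add' := map_add L, map_smul' := fun γ x => L.map_smul _ x }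
  let g : P →ₗ[Γᵐᵒᵖ] V :=
    { toFun := ρ, map_add' := map_add ρ, map_smul' := fun γ x => ρ.map_smulₛₗ γ x }
  obtain ⟨h, hh⟩ := exists_lift_of_smul_ker_eq_zero H.hereditary (baseOp Γ π ^ n)
    (commute_pow_central (baseOp_central Γ π) n)
    (fun p hp => torsionFree_pow hP n (by rw [hp, smul_zero])) f
    (fun v => ⟨Finsupp.single v 1, (Finsupp.linearCombination_single _ _ _).trans (one_smul _ v)⟩)
    (fun w _ => by rw [← op_pow]; exact hF _ hn w) g
  have hker : ∀ p, ρ p = 0 → h p = 0 := fun p hp => by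
    refine rightMul_induction I (C := fun p => h p = 0) ?_ ?_ ?_ ((hρ.apply_eq_zero p).1 hp)
    · intro γ hγ p; rw [map_smul, hF γ hγ]
    · exact map_zero h
    · intro x y hx hy; rw [map_add, hx, hy, add_zero]
  have hker' : ∀ p p', ρ p = ρ p' → h p = h p' := fun p p' hp => by
    rw [← sub_eq_zero, ← map_sub] at hp ⊢
    exact hker _ hp
  choose s hs using hρ.surjective
  refine ⟨⟨{ toFun := fun v => h (s v), map_add' := fun v w => ?_, map_smul' := fun t v => ?_ },
    fun v => ?_⟩⟩
  · rw [← map_add]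
    exact hker' _ _ (by rw [hs, map_add, hs, hs])
  · obtain ⟨γ, hγ⟩ := Ideal.Quotient.mk_surjective t.unop
    have ht : t = op (Ideal.Quotient.mk I γ) := unop_injective hγ.symm
    rw [RingHom.id_apply, ht]
    refine (hker' _ (op γ • s v) ?_).trans (map_smul h (op γ) (s v))
    rw [hs, reduction_op_smul, hs]
  · exact (hh (s v)).trans (hs v)

/-- Maps modulo `I` lift to maps from torsion-free modules to complete modules. -/
theorem IsReductionMod.exists_lift (H : IsHereditaryPair ι I π)
    (hP : ∀ p : P, baseOp Γ π • p = 0 → p = 0)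
    (hred : IsCReduced (baseOp Γ π) P') (hpre : IsCPrecomplete (baseOp Γ π) P')
    (ρ : P →ₛₗ[RingHom.op (Ideal.Quotient.mk I)] V)
    {ρ' : P' →ₛₗ[RingHom.op (Ideal.Quotient.mk I)] V'} (hρ' : IsReductionMod I ρ')
    (e : V →ₗ[(Γ ⧸ I)ᵐᵒᵖ] V') : ∃ β : P →ₗ[Γᵐᵒᵖ] P', ∀ p, ρ' (β p) = e (ρ p) := by
  choose s hs using hρ'.surjective
  have hmk : ∀ x y, ρ' x = ρ' y ↔ (rightMul I P').mkQ x = (rightMul I P').mkQ y := by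
    intro x y
    rw [← sub_eq_zero, ← map_sub, hρ'.apply_eq_zero]
    exact (Submodule.Quotient.eq _).symm
  let g : P →ₗ[Γᵐᵒᵖ] P' ⧸ rightMul I P' :=
    { toFun := fun p => (rightMul I P').mkQ (s (e (ρ p)))
      map_add' := fun p₁ p₂ => by
        rw [← map_add, ← hmk]
        simp only [map_add, hs]
      map_smul' := fun γ p => by
        rw [RingHom.id_apply, ← map_smul, ← hmk, hs, ρ'.map_smulₛₗ, hs, ρ.map_smulₛₗ, map_smul] }
  obtain ⟨n, hn⟩ := H.exists_pow_mem
  obtain ⟨β, hβ⟩ := exists_lift_of_complete H.hereditary (baseOp_central Γ π) hP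
    hred hpre (rightMul I P') n (fun x => by
      rw [← op_pow]; exact smul_mem_rightMul I hn x) g
  exact ⟨β, fun p => by rw [(hmk _ _).2 (hβ p), hs]⟩

section Pi

variable {B W : Type*} [Ring B] [AddCommGroup W] [Module B W] {c : B}

theorem IsCReduced.pi (h : IsCReduced c W) (Y : Type*) : IsCReduced c (Y → W) := by
  intro x hx
  funext y
  refine h _ fun k => ?_
  obtain ⟨z, hz⟩ := hx k
  exact ⟨z y, congrFun hz y⟩

theorem IsCPrecomplete.pi (h : IsCPrecomplete c W) (Y : Type*) : IsCPrecomplete c (Y → W) := by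
  intro s hs
  choose z hz using hs
  choose l hl using fun y => h (fun k => s k y) fun k => ⟨z k y, congrFun (hz k) y⟩
  refine ⟨l, fun k => ?_⟩
  choose w hw using fun y => hl y k
  exact ⟨w, funext hw⟩

theorem IsCReduced.submodule (h : IsCReduced c W) (N : Submodule B W) : IsCReduced c N := by
  intro x hx
  refine Subtype.ext (h _ fun k => ?_)
  obtain ⟨z, hz⟩ := hx k
  exact ⟨z, congrArg Subtype.val hz⟩

end Pi

theorem mem_rightMul_pi (hfg : I.FG) {Y : Type} {f : Y → P} (hf : ∀ y, f y ∈ rightMul I P) :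
    f ∈ rightMul I (Y → P) := by
  obtain ⟨t, ht⟩ := hfg
  choose a ha using fun y => exists_sum_of_mem_rightMul I ht (hf y)
  have : f = ∑ g ∈ t, op g • fun y => a y g := by
    funext y
    rw [Finset.sum_apply]
    exact ha y
  rw [this]
  exact sum_mem_rightMul I (fun g hg => ht ▸ Ideal.subset_span hg) fun g y => a y g

/-- A direct summand `V` of the reduction of a complete torsion-free module `W` is the reduction of
a complete torsion-free module. Let `e` be a lift to `W` of the idempotent given by `V`. On `W^ℕ`
the map `i` that shifts the image of `e` to the right and fixes that of `1 - e` has, modulo `I`,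
the obvious left inverse `r` and cokernel `V`. As `r i` is the identity modulo `I`, it is
invertible, so that `ker r` is a direct summand of `W^ℕ`; it reduces to `V`. -/
theorem IsReductionMod.exists_of_retract (H : IsHereditaryPair ι I π)
    (hP : ∀ p : P, baseOp Γ π • p = 0 → p = 0)
    (hred : IsCReduced (baseOp Γ π) P) (hpre : IsCPrecomplete (baseOp Γ π) P)
    {ρ : P →ₛₗ[RingHom.op (Ideal.Quotient.mk I)] V} (hρ : IsReductionMod I ρ)
    (a : V' →ₗ[(Γ ⧸ I)ᵐᵒᵖ] V) (b : V →ₗ[(Γ ⧸ I)ᵐᵒᵖ] V') (hba : ∀ v, b (a v) = v) :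
    ∃ (P₁ : ModuleCat.{u} Γᵐᵒᵖ) (ρ₁ : P₁ →ₛₗ[RingHom.op (Ideal.Quotient.mk I)] V'),
      IsReductionMod I ρ₁ ∧ (∀ p : P₁, baseOp Γ π • p = 0 → p = 0) ∧
      IsCReduced (baseOp Γ π) P₁ ∧ IsCPrecomplete (baseOp Γ π) P₁ := by
  obtain ⟨e, he⟩ := IsReductionMod.exists_lift H hP hred hpre ρ hρ (a ∘ₗ b)
  replace he : ∀ p, ρ (e p) = a (b (ρ p)) := he
  have hWP : IsCReduced (baseOp Γ π) (ℕ → P) := hred.pi _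
  have hWc : IsCPrecomplete (baseOp Γ π) (ℕ → P) := hpre.pi _
  have hWI : ∀ f : ℕ → P, (∀ n, ρ (f n) = 0) → f ∈ rightMul I (ℕ → P) := fun f hf =>
    mem_rightMul_pi H.fg fun n => (hρ.apply_eq_zero _).1 (hf n)
  have hWI' : ∀ f : ℕ → P, f ∈ rightMul I (ℕ → P) → ∀ n, ρ (f n) = 0 := fun f hf n =>
    (hρ.apply_eq_zero _).2 (map_mem_rightMul I (LinearMap.proj (R := Γᵐᵒᵖ) (n)) hf)
  let pr (n : ℕ) : (ℕ → P) →ₗ[Γᵐᵒᵖ] P := LinearMap.proj n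
  let i : (ℕ → P) →ₗ[Γᵐᵒᵖ] ℕ → P :=
    LinearMap.pi fun n => pr n - e ∘ₗ pr n + Nat.casesOn n 0 fun m => e ∘ₗ pr m
  let r : (ℕ → P) →ₗ[Γᵐᵒᵖ] ℕ → P :=
    LinearMap.pi fun n => pr n - e ∘ₗ pr n + e ∘ₗ pr (n + 1)
  have hi0 : ∀ f : ℕ → P, i f 0 = f 0 - e (f 0) := fun f => add_zero _
  have hi1 : ∀ (f : ℕ → P) n, i f (n + 1) = f (n + 1) - e (f (n + 1)) + e (f n) := fun f n => rfl
  have hr : ∀ (f : ℕ → P) n, r f n = f n - e (f n) + e (f (n + 1)) := fun f n => rfl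
  have hri : ∀ f, f - (r ∘ₗ i) f ∈ rightMul I (ℕ → P) := by
    intro f
    refine hWI _ fun n => ?_
    change ρ (f n - r (i f) n) = 0
    rw [hr, hi1]
    cases n with
    | zero => rw [hi0]; simp [he, hba]
    | succ n => rw [hi1]; simp [he, hba]
  obtain ⟨u, hu⟩ : ∃ u : (ℕ → P) ≃ₗ[Γᵐᵒᵖ] (ℕ → P), ∀ f, u f = r (i f) :=
    ⟨LinearEquiv.ofBijective (r ∘ₗ i) (H.bijective_of_sub_mem hWP hWc _ hri), fun f => rfl⟩
  let ε : (ℕ → P) →ₗ[Γᵐᵒᵖ] LinearMap.ker r :=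
    (LinearMap.id - i ∘ₗ u.symm.toLinearMap ∘ₗ r).codRestrict _ fun f => by
      rw [LinearMap.mem_ker, LinearMap.sub_apply, map_sub]
      change r f - r (i (u.symm (r f))) = 0
      rw [← hu, LinearEquiv.apply_symm_apply, sub_self]
  have hε : ∀ f : LinearMap.ker r, ε f = f := fun f => Subtype.ext (by
    change (f : ℕ → P) - i (u.symm (r f)) = f
    rw [LinearMap.mem_ker.1 f.2, map_zero, map_zero, sub_zero])
  let ρ₁ : LinearMap.ker r →ₛₗ[RingHom.op (Ideal.Quotient.mk I)] V' :=
    { toFun := fun f => b (ρ ((f : ℕ → P) 0))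
      map_add' := fun f g => by simp
      map_smul' := fun γ f => by
        rw [← map_smul, ← ρ.map_smulₛₗ]; rfl }
  refine ⟨ModuleCat.of _ (LinearMap.ker r), ρ₁,
    ⟨fun v => ?_, fun p => ⟨fun hp => ?_, fun hp => ?_⟩⟩,
    fun p hp => ?_, hWP.submodule _, hWc.of_retract (LinearMap.ker r).subtype ε hε⟩
  · obtain ⟨w, hw⟩ := hρ.surjective (a v)
    let g : ℕ → P := fun n => Nat.casesOn n w fun _ => 0
    have hg : r g ∈ rightMul I (ℕ → P) := by
      refine hWI _ fun n => ?_
      rw [hr]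
      cases n with
      | zero =>
        change ρ (w - e w + e 0) = 0
        simp [he, hw, hba]
      | succ n =>
        change ρ (0 - e 0 + e 0) = 0
        simp
    refine ⟨ε g, ?_⟩
    have h0 : ρ (i (u.symm (r g)) 0) = 0 :=
      hWI' _ (map_mem_rightMul I i (map_mem_rightMul I u.symm.toLinearMap hg)) 0
    change b (ρ (w - i (u.symm (r g)) 0)) = v
    rw [map_sub, h0, sub_zero, hw, hba]
  · obtain ⟨f, hf⟩ := p
    replace hp : b (ρ (f 0)) = 0 := hp
    have h1 : ∀ n, ρ (f n) - a (b (ρ (f n))) + a (b (ρ (f (n + 1)))) = 0 := by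
      intro n
      rw [← he, ← he, ← map_sub, ← map_add, ← hr, LinearMap.mem_ker.1 hf]
      exact map_zero ρ
    have h2 : ∀ n, b (ρ (f n)) = 0 := by
      intro n
      cases n with
      | zero => exact hp
      | succ n =>
        have := congrArg b (h1 n)
        simpa [hba] using this
    have h3 : f ∈ rightMul I (ℕ → P) := hWI f fun n => by
      have := h1 n
      rwa [h2, h2, map_zero, sub_zero, add_zero] at this
    have h4 := map_mem_rightMul I ε h3
    rwa [hε ⟨f, hf⟩] at h4
  · have h1 := map_mem_rightMul I (LinearMap.ker r).subtype hp
    exact (congrArg b (hWI' _ h1 0)).trans (map_zero b)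
  · refine Subtype.ext (funext fun n => hP _ ?_)
    exact congrFun (congrArg Subtype.val hp) n

end Reduction

/-! ### Families converging to zero -/

section ZeroAtInfinity

variable {B : Type*} [Ring B] (c : B) (hc : ∀ b, b * c = c * b) (Y : Type*) (W : Type*)
  [AddCommGroup W] [Module B W]

/-- The families `Y → W` that tend to zero `c`-adically along the cofinite filter. For `W = B` and
complete `B` this is the completion of the free module on `Y`. -/
def zeroAtInfinity : Submodule B (Y → W) where
  carrier := {f | ∀ k, {y | ¬ ∃ z, f y = c ^ k • z}.Finite}
  add_mem' {f g} hf hg k := by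
    refine ((hf k).union (hg k)).subset fun y hy => ?_
    by_contra h
    simp only [Set.mem_union, Set.mem_ofPred_eq, not_or, not_not] at h
    obtain ⟨⟨z, hz⟩, w, hw⟩ := h
    exact hy ⟨z + w, by rw [Pi.add_apply, hz, hw, smul_add]⟩
  zero_mem' k := by
    convert Set.finite_empty
    ext y
    simpa using ⟨0, (smul_zero _).symm⟩
  smul_mem' b f hf k := by
    refine (hf k).subset fun y hy => ?_
    rintro ⟨z, hz⟩
    exact hy ⟨b • z, by rw [Pi.smul_apply, hz, ← mul_smul, ← mul_smul, commute_pow_central hc]⟩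

variable {c W}

theorem IsCPrecomplete.zeroAtInfinity (h : IsCPrecomplete c W)
    (hW : ∀ w : W, c • w = 0 → w = 0) : IsCPrecomplete c (zeroAtInfinity c hc Y W) := by
  have hinj : ∀ (k : ℕ) {w w' : W}, c ^ k • w = c ^ k • w' → w = w' := by
    intro k
    induction k with
    | zero => intro w w' h; simpa using h
    | succ k ih =>
      intro w w' h
      refine ih (sub_eq_zero.1 (hW _ ?_))
      rw [smul_sub, ← mul_smul, ← mul_smul, ← pow_succ', h, sub_self]
  intro s hs
  obtain ⟨l, hl⟩ := h.pi Y (fun k => s k) fun k => by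
    obtain ⟨z, hz⟩ := hs k
    exact ⟨z, congrArg Subtype.val hz⟩
  choose z hz using hl
  have hlmem : l ∈ _root_.zeroAtInfinity c hc Y W := by
    intro k
    refine ((s k).2 k).subset fun y hy => ?_
    rintro ⟨w, hw⟩
    refine hy ⟨w + z k y, ?_⟩
    rw [smul_add, ← hw]
    exact (add_eq_of_eq_sub' (congrFun (hz k) y).symm).symm
  have hzmem : ∀ k, z k ∈ _root_.zeroAtInfinity c hc Y W := by
    intro k j
    refine ((sub_mem hlmem (s k).2) (k + j)).subset fun y hy => ?_
    rintro ⟨w, hw⟩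
    refine hy ⟨w, hinj k ?_⟩
    rw [← mul_smul, ← pow_add, ← hw]
    exact (congrFun (hz k) y).symm
  exact ⟨⟨l, hlmem⟩, fun k => ⟨⟨z k, hzmem k⟩, Subtype.ext (hz k)⟩⟩

end ZeroAtInfinity

/-! ### Lifting triples -/

section Density

variable {R Λ Γ : Type u} [CommRing R] [Ring Λ] [Ring Γ] [Algebra R Λ] [Algebra R Γ]
  {ι : Λ →+* Γ} {I : Ideal Γ} [I.IsTwoSided] {π : R}

/-- Projective modules over `Γ / I` lift to complete torsion-free `Γ`-modules. -/
theorem exists_isReductionMod_of_projective (H : IsHereditaryPair ι I π)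
    (hΓ : ∀ x : Γ, baseOp Γ π • x = 0 → x = 0) (hred : IsCReduced (baseOp Γ π) Γ)
    (hpre : IsCPrecomplete (baseOp Γ π) Γ) (V : Type u) [AddCommGroup V] [Module (Γ ⧸ I)ᵐᵒᵖ V]
    [Module.Projective (Γ ⧸ I)ᵐᵒᵖ V] :
    ∃ (P : ModuleCat.{u} Γᵐᵒᵖ) (ρ : P →ₛₗ[RingHom.op (Ideal.Quotient.mk I)] V),
      IsReductionMod I ρ ∧ (∀ p : P, baseOp Γ π • p = 0 → p = 0) ∧
      IsCReduced (baseOp Γ π) P ∧ IsCPrecomplete (baseOp Γ π) P := by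
  classical
  let W := zeroAtInfinity (baseOp Γ π) (baseOp_central Γ π) V Γ
  obtain ⟨n, hn⟩ := H.exists_pow_mem
  have hfin : ∀ f : W, {v | Ideal.Quotient.mk I (f.1 v) ≠ 0}.Finite := fun f => by
    refine (f.2 n).subset fun v hv => ?_
    rintro ⟨z, hz⟩
    refine hv (Ideal.Quotient.eq_zero_iff_mem.2 ?_)
    rw [hz, ← op_pow]
    exact I.mul_mem_left z hn
  have hsupp : ∀ f : W, (Function.support fun v => op (Ideal.Quotient.mk I (f.1 v)) • v).Finite :=
    fun f => (hfin f).subset fun v hv h => hv (by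
      change op (Ideal.Quotient.mk I (f.1 v)) • v = 0
      rw [h, op_zero, zero_smul])
  let g : W →ₛₗ[RingHom.op (Ideal.Quotient.mk I)] V :=
    { toFun := fun f => ∑ᶠ v, op (Ideal.Quotient.mk I (f.1 v)) • v
      map_add' := fun f f' => by
        rw [← finsum_add_distrib (hsupp f) (hsupp f')]
        refine finsum_congr fun v => ?_
        rw [← add_smul, ← MulOpposite.op_add, ← map_add]; rfl
      map_smul' := fun γ f => by
        rw [smul_finsum' _ (hsupp f)]
        refine finsum_congr fun v => ?_
        rw [← mul_smul]
        refine congrArg (· • v) (unop_injective ?_)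
        exact map_mul (Ideal.Quotient.mk I) (f.1 v) γ.unop }
  have hg : Function.Surjective g := by
    intro v
    refine ⟨⟨Pi.single v 1, fun k => (Set.finite_singleton v).subset fun w hw => ?_⟩, ?_⟩
    · by_contra h
      exact hw ⟨0, by rw [smul_zero, Pi.single_eq_of_ne h]⟩
    · refine (finsum_eq_single _ v fun w hw => ?_).trans ?_
      · change op (Ideal.Quotient.mk I (Pi.single (M := fun _ : V => Γ) v 1 w)) • w = 0
        rw [Pi.single_eq_of_ne hw, map_zero, op_zero, zero_smul]
      · change op (Ideal.Quotient.mk I (Pi.single (M := fun _ : V => Γ) v 1 v)) • v = v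
        rw [Pi.single_eq_same, map_one, op_one, one_smul]
  have hgI : rightMul I W ≤ LinearMap.ker g := fun x hx => by
    refine rightMul_induction I (C := fun x => g x = 0) ?_ ?_ ?_ hx
    · intro γ hγ p
      rw [reduction_op_smul, Ideal.Quotient.eq_zero_iff_mem.2 hγ, op_zero, zero_smul]
    · exact map_zero g
    · intro x y hx hy; rw [map_add, hx, hy, add_zero]
  let _ : Module (Γ ⧸ I)ᵐᵒᵖ (W ⧸ rightMul I W) :=
    quotientRightModule I (W ⧸ rightMul I W) (by
      intro s hs x
      obtain ⟨m, rfl⟩ := Submodule.Quotient.mk_surjective _ x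
      rw [← Submodule.Quotient.mk_smul, Submodule.Quotient.mk_eq_zero]
      exact smul_mem_rightMul I hs m)
  let ρ₀ : W →ₛₗ[RingHom.op (Ideal.Quotient.mk I)] W ⧸ rightMul I W :=
    { toFun := (rightMul I W).mkQ
      map_add' := map_add _
      map_smul' := fun γ x => rfl }
  have hρ₀ : IsReductionMod I ρ₀ :=
    ⟨Submodule.mkQ_surjective _, fun p => Submodule.Quotient.mk_eq_zero _⟩
  let b : (W ⧸ rightMul I W) →ₗ[(Γ ⧸ I)ᵐᵒᵖ] V :=
    { toFun := (rightMul I W).liftQ g hgI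
      map_add' := map_add _
      map_smul' := fun t x => by
        obtain ⟨x, rfl⟩ := Submodule.mkQ_surjective _ x
        obtain ⟨γ, hγ⟩ := Ideal.Quotient.mk_surjective t.unop
        obtain rfl : op (Ideal.Quotient.mk I γ) = t := unop_injective hγ
        exact reduction_op_smul g γ x }
  have hb : Function.Surjective b := fun v => by
    obtain ⟨f, rfl⟩ := hg v
    exact ⟨(rightMul I W).mkQ f, rfl⟩
  obtain ⟨a, ha⟩ := Module.projective_lifting_property b LinearMap.id hb
  refine IsReductionMod.exists_of_retract H (fun p hp => ?_)
    ((hred.pi V).submodule W) (hpre.zeroAtInfinity _ V hΓ) hρ₀ a b fun v => LinearMap.congr_fun ha v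
  exact Subtype.ext (funext fun v => hΓ _ (congrFun (congrArg Subtype.val hp) v))

/-- Each generating monomorphic triple with projective second component comes from a complete
hull: lift `V` to `P`, and let `M` be the inverse image of `U` in `P`. -/
theorem IsGeneratingMonoTriple.exists_pres (H : IsHereditaryPair ι I π)
    (hΓ : ∀ x : Γ, baseOp Γ π • x = 0 → x = 0) (hred : IsCReduced (baseOp Γ π) Γ)
    (hpre : IsCPrecomplete (baseOp Γ π) Γ) {X : ModuleCat.{u} (TripleRing ι I)ᵐᵒᵖ}
    (hX : IsGeneratingMonoTriple (Ideal.quotientMap I ι (le_refl (I.comap ι))) X) :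
    ∃ (M : ModuleCat.{u} Λᵐᵒᵖ) (P : ModuleCat.{u} Γᵐᵒᵖ) (i : M →ₛₗ[RingHom.op ι] P)
      (q : M × P →+ X), IsHull π i ∧ IsTriplePres I i q ∧
        IsCReduced (baseOp Γ π) P ∧ IsCPrecomplete (baseOp Γ π) P := by
  obtain ⟨U, V, _, _, _, _, f, hf, hspan, hproj, ⟨eX⟩⟩ := hX
  obtain ⟨P, ρ, hρ, hPtf, hPred, hPpre⟩ := exists_isReductionMod_of_projective H hΓ hred hpre V
  let _ : Module Λᵐᵒᵖ P := Module.compHom P (RingHom.op ι)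
  have hfι : ∀ (s : Λ) (u : U), f (op (Ideal.Quotient.mk _ s) • u)
      = op (Ideal.Quotient.mk I (ι s)) • f u := fun s u => f.map_smulₛₗ (op _) u
  let M : Submodule Λᵐᵒᵖ P :=
    { carrier := {p | ∃ u, f u = ρ p}
      add_mem' := by
        rintro p p' ⟨u, hu⟩ ⟨u', hu'⟩
        exact ⟨u + u', by rw [map_add, map_add, hu, hu']⟩
      zero_mem' := ⟨0, by rw [map_zero, map_zero]⟩
      smul_mem' := by
        rintro s p ⟨u, hu⟩
        refine ⟨op (Ideal.Quotient.mk (I.comap ι) s.unop) • u, ?_⟩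
        rw [hfι, hu, ← reduction_op_smul]; rfl }
  let i : M →ₛₗ[RingHom.op ι] P :=
    { toFun := Subtype.val, map_add' := fun _ _ => rfl, map_smul' := fun _ _ => rfl }
  have hmemM : ∀ p ∈ rightMul I P, p ∈ M := fun p hp =>
    ⟨0, by rw [map_zero, (hρ.apply_eq_zero p).2 hp]⟩
  have hi : IsHull π i := by
    refine ⟨Subtype.val_injective, ?_, hPtf⟩
    have h1 : ∀ v ∈ Submodule.span (Γ ⧸ I)ᵐᵒᵖ (Set.range f),
        ∃ p ∈ Submodule.span Γᵐᵒᵖ (Set.range i), ρ p = v := by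
      intro v hv
      induction hv using Submodule.span_induction with
      | mem v hv =>
        obtain ⟨u, rfl⟩ := hv
        obtain ⟨p, hp⟩ := hρ.surjective (f u)
        exact ⟨p, Submodule.subset_span ⟨⟨p, u, hp.symm⟩, rfl⟩, hp⟩
      | zero => exact ⟨0, zero_mem _, map_zero ρ⟩
      | add v w _ _ hv hw =>
        obtain ⟨p, hp, rfl⟩ := hv
        obtain ⟨p', hp', rfl⟩ := hw
        exact ⟨p + p', add_mem hp hp', map_add ρ _ _⟩
      | smul t v _ hv =>
        obtain ⟨p, hp, rfl⟩ := hv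
        obtain ⟨γ, hγ⟩ := Ideal.Quotient.mk_surjective t.unop
        refine ⟨op γ • p, Submodule.smul_mem _ _ hp, ?_⟩
        rw [reduction_op_smul, hγ, op_unop]
    rw [eq_top_iff]
    rintro p -
    obtain ⟨p', hp', h2⟩ := h1 (ρ p) (hspan ▸ Submodule.mem_top)
    rw [← sub_add_cancel p p']
    refine add_mem (Submodule.subset_span ⟨⟨p - p', hmemM _ ?_⟩, rfl⟩) hp'
    rw [← hρ.apply_eq_zero, map_sub, h2, sub_self]
  choose u hu using fun m : M => m.2
  have hu_add : ∀ m m' : M, u (m + m') = u m + u m' := fun m m' => hf (by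
    rw [map_add, hu, hu, hu, ← map_add]; rfl)
  let q : M × P →+ TripleModule f := AddMonoidHom.mk' (fun x => (u x.1, ρ x.2)) fun x y =>
    Prod.ext (hu_add _ _) (map_add ρ _ _)
  have hq : IsTriplePres I i q := by
    refine ⟨fun a b c m p => Prod.ext (hf ?_) ?_, ?_, fun m p => ?_⟩
    · refine (hu _).trans (Eq.trans ?_ (hfι a (u m)).symm)
      rw [hu]
      exact reduction_op_smul ρ (ι a) m.1
    · change ρ (op b • i m + op c • p)
        = op (Ideal.Quotient.mk I b) • f (u m) + op (Ideal.Quotient.mk I c) • ρ p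
      rw [map_add, reduction_op_smul, reduction_op_smul, hu]; rfl
    · rintro ⟨x, y⟩
      obtain ⟨m, hm⟩ := hρ.surjective (f x)
      obtain ⟨p, hp⟩ := hρ.surjective y
      exact ⟨(⟨m, x, hm.symm⟩, p), Prod.ext (hf ((hu _).trans hm)) hp⟩
    · rw [← hρ.apply_eq_zero, ← hρ.apply_eq_zero]
      refine Iff.trans (Prod.ext_iff (y := (0 : U × V))) (and_congr ?_ Iff.rfl)
      change u m = 0 ↔ ρ (m : P) = 0
      rw [← hu, map_eq_zero_iff f hf]
  exact ⟨ModuleCat.of _ M, P, i, _, hi, hq.comp_equiv eX.symm.toLinearEquiv, hPred, hPpre⟩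

end Density

/-! ### Orders over a complete discrete valuation ring -/

section Orders

variable {R : Type u} [CommRing R] {π : R}

/-- The Jacobson radical of an order is nilpotent modulo `π`. -/
theorem exists_jacobson_pow_le [IsLocalRing R]
    (hπ : IsLocalRing.maximalIdeal R = Ideal.span {π})
    (S : Type u) [Ring S] [Algebra R S] [Module.Finite R S] :
    ∃ m, ∀ x ∈ Ring.jacobson S ^ m, ∃ y, x = algebraMap R S π * y := by
  let J : Ideal S := Ideal.span {algebraMap R S π}
  have hJ : ∀ x ∈ J, ∃ y, x = algebraMap R S π * y := fun x hx => by
    obtain ⟨y, rfl⟩ := Ideal.mem_span_singleton'.1 hx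
    exact ⟨y, (Algebra.commutes π y).symm⟩
  have : J.IsTwoSided := ⟨fun {a} b ha => by
    obtain ⟨y, rfl⟩ := hJ a ha
    rw [Algebra.commutes, mul_assoc, Algebra.commutes, ← mul_assoc]
    exact Ideal.mem_span_singleton'.2 ⟨_, rfl⟩⟩
  have htor : Module.IsTorsionBySet R (S ⧸ J) (IsLocalRing.maximalIdeal R) := by
    rintro x ⟨r, hr⟩
    rw [SetLike.mem_coe, hπ] at hr
    obtain ⟨a, rfl⟩ := Ideal.mem_span_singleton'.1 hr
    obtain ⟨s, rfl⟩ := Ideal.Quotient.mk_surjective x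
    change (a * π) • Ideal.Quotient.mk J s = 0
    rw [Algebra.smul_def, map_mul]
    change Ideal.Quotient.mk J (algebraMap R S a * algebraMap R S π * s) = 0
    rw [Ideal.Quotient.eq_zero_iff_mem, mul_assoc, Algebra.commutes π s, ← mul_assoc]
    exact Ideal.mem_span_singleton'.2 ⟨_, rfl⟩
  let : Module (R ⧸ IsLocalRing.maximalIdeal R) (S ⧸ J) := htor.module
  let : Field (R ⧸ IsLocalRing.maximalIdeal R) := Ideal.Quotient.field _
  have : IsScalarTower R (R ⧸ IsLocalRing.maximalIdeal R) (S ⧸ J) := htor.isScalarTower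
  have : Module.Finite (R ⧸ IsLocalRing.maximalIdeal R) (S ⧸ J) :=
    Module.Finite.of_restrictScalars_finite R _ _
  have hA : IsArtinian R (S ⧸ J) :=
    isArtinian_of_surjective_algebraMap (R := R ⧸ IsLocalRing.maximalIdeal R)
      Ideal.Quotient.mk_surjective
  have : IsArtinianRing (S ⧸ J) := isArtinian_of_tower R hA
  obtain ⟨m, hm⟩ := IsArtinianRing.isNilpotent_jacobson_bot (R := S ⧸ J)
  rw [Ideal.jacobson_bot] at hm
  have key : ∀ k, ∀ x ∈ Ring.jacobson S ^ k,
      Ideal.Quotient.mk J x ∈ Ring.jacobson (S ⧸ J) ^ k := by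
    intro k
    induction k with
    | zero => intro x _; rw [Submodule.pow_zero, Ideal.one_eq_top]; trivial
    | succ k ih =>
      intro x hx
      rw [Submodule.pow_succ] at hx ⊢
      refine Submodule.mul_induction_on hx (fun a ha b hb => ?_) fun a b ha hb => ?_
      · rw [map_mul]
        refine Ideal.mul_mem_mul (ih a ha) ?_
        have : RingHomSurjective (Ideal.Quotient.mk J) := ⟨Ideal.Quotient.mk_surjective⟩
        exact Ring.le_comap_jacobson (Ideal.Quotient.mk J) hb
      · rw [map_add]; exact add_mem ha hb
  refine ⟨m, fun x hx => hJ x ?_⟩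
  have := key m x hx
  rw [hm] at this
  exact Ideal.Quotient.eq_zero_iff_mem.1 this

theorem exists_finset_sum_smul (R S : Type u) [CommRing R] [Ring S] [Algebra R S]
    [Module.Finite R S] : ∃ t : Finset S, ∀ y, ∃ s : S → R, y = ∑ g ∈ t, s g • g := by
  obtain ⟨t, ht⟩ := (Module.Finite.fg_top : (⊤ : Submodule R S).FG)
  refine ⟨t, fun y => ?_⟩
  have hy : y ∈ Submodule.span R (t : Set S) := ht ▸ Submodule.mem_top
  obtain ⟨s, -, rfl⟩ := Submodule.mem_span_finset.1 hy
  exact ⟨s, rfl⟩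

/-- An order over a noetherian ring is left noetherian. -/
theorem Ideal.fg_of_finite_base [IsNoetherianRing R] (S : Type u) [Ring S] [Algebra R S]
    [Module.Finite R S] (I : Ideal S) : I.FG :=
  (isNoetherian_of_tower R (inferInstance : IsNoetherian R S)).noetherian I

theorem IsRightHereditary.projective_ideal {S : Type u} [Ring S] (h : IsRightHereditary S)
    (J : Ideal Sᵐᵒᵖ) : Module.Projective Sᵐᵒᵖ J := by
  let e : Sᵐᵒᵖ ≃ₗ[Sᵐᵒᵖ] S :=
    { toFun := unop, invFun := op, map_add' := fun _ _ => rfl, map_smul' := fun _ _ => rfl,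
      left_inv := fun _ => rfl, right_inv := fun _ => rfl }
  have := h (Submodule.map (e : Sᵐᵒᵖ →ₗ[Sᵐᵒᵖ] S) J)
  exact Module.Projective.of_equiv (e.submoduleMap J).symm

/-- A finitely generated torsion-free algebra over a complete discrete valuation ring is
complete. -/
theorem isCReduced_order [IsDomain R] [IsDiscreteValuationRing R]
    [IsAdicComplete (IsLocalRing.maximalIdeal R) R]
    (hπ : IsLocalRing.maximalIdeal R = Ideal.span {π})
    (S : Type u) [Ring S] [Algebra R S] [Module.Finite R S] [Module.IsTorsionFree R S] :
    IsCReduced (baseOp S π) S ∧ IsCPrecomplete (baseOp S π) S := by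
  let b := Module.finBasis R S
  have hop : ∀ (k : ℕ) (s : S), baseOp S π ^ k • s = π ^ k • s := fun k s => by
    rw [← op_pow, ← map_pow, op_smul_eq_mul, Algebra.smul_def, Algebra.commutes]
  have hpow : ∀ k : ℕ, ∀ r : R,
      r ∈ (IsLocalRing.maximalIdeal R ^ k • ⊤ : Submodule R R) ↔ ∃ a, r = π ^ k * a := by
    intro k r
    rw [hπ, Ideal.span_singleton_pow, smul_eq_mul, Ideal.mul_top, Ideal.mem_span_singleton]
    rfl
  constructor
  · intro x hx
    refine b.repr.injective (Finsupp.ext fun j => ?_)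
    rw [map_zero, Finsupp.zero_apply]
    refine IsHausdorff.haus (I := IsLocalRing.maximalIdeal R) inferInstance _ fun k => ?_
    rw [SModEq.zero, hpow]
    obtain ⟨y, rfl⟩ := hx k
    exact ⟨b.repr y j, by rw [hop, map_smul]; rfl⟩
  · intro s hs
    choose y hy using hs
    have hlim : ∀ j, ∃ L : R, ∀ k, ∃ a, b.repr (s k) j - L = π ^ k * a := by
      intro j
      have hc : ∀ {m n}, m ≤ n → ∃ a, b.repr (s m) j - b.repr (s n) j = π ^ m * a := by
        intro m n hmn
        induction n, hmn using Nat.le_induction with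
        | base => exact ⟨0, by simp⟩
        | succ n hmn ih =>
          obtain ⟨a, ha⟩ := ih
          have h1 := congrArg (fun z => b.repr z j) (hy n)
          simp only [hop, map_sub, map_smul, Finsupp.sub_apply, Finsupp.smul_apply,
            smul_eq_mul] at h1
          obtain ⟨d, rfl⟩ := Nat.exists_eq_add_of_le hmn
          refine ⟨a - π ^ d * b.repr (y (m + d)) j, ?_⟩
          rw [mul_sub, ← ha, ← mul_assoc, ← pow_add, ← h1]
          ring
      obtain ⟨L, hL⟩ := IsPrecomplete.prec (I := IsLocalRing.maximalIdeal R) (M := R) inferInstance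
        (f := fun k => b.repr (s k) j) fun {m n} hmn => by
          rw [SModEq.sub_mem, hpow]; exact hc hmn
      refine ⟨L, fun k => ?_⟩
      have := hL k
      rwa [SModEq.sub_mem, hpow] at this
    choose L hL using hlim
    choose a ha using hL
    refine ⟨∑ j, L j • b j, fun k => ⟨-∑ j, a j k • b j, ?_⟩⟩
    rw [hop, smul_neg, Finset.smul_sum, ← neg_sub, neg_inj]
    conv_lhs => rw [← b.sum_repr (s k)]
    rw [← Finset.sum_sub_distrib]
    refine Finset.sum_congr rfl fun j _ => ?_
    rw [← sub_smul, ha, mul_smul]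

/-- Two orders over a discrete valuation ring with `Γ` hereditary form a hereditary pair. Powers of
`I` lie in `π Γ` since `I` is contained in the radical of `Λ`. -/
theorem IsHereditaryPair.of_finite [IsDomain R] [IsDiscreteValuationRing R] {Λ Γ : Type u}
    [Ring Λ] [Ring Γ] [Algebra R Λ] [Algebra R Γ] [Module.Finite R Λ] [Module.Finite R Γ]
    (hπ : IsLocalRing.maximalIdeal R = Ideal.span {π}) (ι : Λ →+* Γ)
    (hι : ∀ r, ι (algebraMap R Λ r) = algebraMap R Γ r) (hher : IsRightHereditary Γ)
    (I : Ideal Γ) [I.IsTwoSided] (hI : ∀ x ∈ I, ∃ s ∈ Ring.jacobson Λ, ι s = x)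
    (hπI : ∃ n : ℕ, algebraMap R Γ (π ^ n) ∈ I) : IsHereditaryPair ι I π where
  map_algebraMap := hι
  hereditary := hher.projective_ideal
  exists_preimage x hx := (hI x hx).imp fun _ h => h.2
  exists_pow_mem := by simpa only [map_pow] using hπI
  exists_pow_le := by
    obtain ⟨m, hm⟩ := exists_jacobson_pow_le hπ Λ
    have key : ∀ k, ∀ x ∈ I ^ (k + 1), ∃ s ∈ Ring.jacobson Λ ^ (k + 1), ι s = x := by
      intro k
      induction k with
      | zero => simpa only [zero_add, Submodule.pow_one] using hI
      | succ k ih =>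
        intro x hx
        rw [Submodule.pow_succ] at hx
        refine Submodule.mul_induction_on hx (fun a ha b hb => ?_) ?_
        · obtain ⟨s, hs, rfl⟩ := ih a ha
          obtain ⟨t, ht, rfl⟩ := hI b hb
          refine ⟨s * t, ?_, map_mul _ _ _⟩
          rw [Submodule.pow_succ]
          exact Ideal.mul_mem_mul hs ht
        · rintro _ _ ⟨s, hs, rfl⟩ ⟨t, ht, rfl⟩
          exact ⟨s + t, add_mem hs ht, map_add _ _ _⟩
    refine ⟨m + 1, fun x hx => ?_⟩
    obtain ⟨s, hs, rfl⟩ := key m x hx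
    rw [Submodule.pow_succ] at hs
    refine Submodule.mul_induction_on (C := fun s => ∃ y, ι s = algebraMap R Γ π * y) hs ?_ ?_
    · intro a ha b _
      obtain ⟨y, rfl⟩ := hm a ha
      exact ⟨ι y * ι b, by rw [map_mul, map_mul, hι, mul_assoc]⟩
    · rintro a b ⟨x, hx⟩ ⟨y, hy⟩
      exact ⟨x + y, by rw [map_add, hx, hy, mul_add]⟩
  finite := by
    obtain ⟨t, ht⟩ := exists_finset_sum_smul R Γ
    refine ⟨t, fun y => ?_⟩
    obtain ⟨s, rfl⟩ := ht y
    refine ⟨fun g => algebraMap R Λ (s g), Finset.sum_congr rfl fun g _ => ?_⟩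
    rw [hι, Algebra.smul_def]
  fg := Ideal.fg_of_finite_base (R := R) Γ I

end Orders

section OrderPair

variable {R Q Λ : Type u} [CommRing R] {π : R}
  [Field Q] [Algebra R Q] [Ring Λ] [Algebra R Λ]
  {Γ : Subalgebra R (Q ⊗[R] Λ)}
  (hΓ : (Algebra.TensorProduct.includeRight : Λ →ₐ[R] Q ⊗[R] Λ).range ≤ Γ)

theorem orderIncl_algebraMap (r : R) : orderIncl hΓ (algebraMap R Λ r) = algebraMap R Γ r :=
  AlgHom.commutes ((Algebra.TensorProduct.includeRight : Λ →ₐ[R] Q ⊗[R] Λ).codRestrict Γ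
    fun s => hΓ ⟨s, rfl⟩) r

theorem isHereditaryPair_orderIncl [IsDomain R] [IsDiscreteValuationRing R] [Module.Finite R Λ]
    [Module.Finite R Γ] (hπ : IsLocalRing.maximalIdeal R = Ideal.span {π})
    (hher : IsRightHereditary Γ) (I : Ideal Γ) [I.IsTwoSided]
    (hI : ∀ x ∈ I, ∃ s ∈ Ring.jacobson Λ, orderIncl hΓ s = x)
    (hπI : ∃ n : ℕ, algebraMap R Γ (π ^ n) ∈ I) : IsHereditaryPair (orderIncl hΓ) I π :=
  IsHereditaryPair.of_finite hπ _ (orderIncl_algebraMap hΓ) hher I hI hπI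

end OrderPair

/-! ### Direct summands -/

section Retract

/-- `X` is isomorphic to a direct summand of `Y`. -/
def IsRetractOf (B X Y : Type*) [Ring B] [AddCommGroup X] [Module B X] [AddCommGroup Y]
    [Module B Y] : Prop :=
  ∃ (f : X →ₗ[B] Y) (g : Y →ₗ[B] X), ∀ x, g (f x) = x

variable {B X Y Z : Type*} [Ring B] [AddCommGroup X] [Module B X] [AddCommGroup Y] [Module B Y]
  [AddCommGroup Z] [Module B Z]

theorem IsRetractOf.trans (h : IsRetractOf B X Y) (h' : IsRetractOf B Y Z) :
    IsRetractOf B X Z := by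
  obtain ⟨f, g, hgf⟩ := h
  obtain ⟨f', g', hgf'⟩ := h'
  exact ⟨f' ∘ₗ f, g ∘ₗ g', fun x => by simp only [LinearMap.comp_apply, hgf', hgf]⟩

theorem IsRetractOf.of_equiv (e : X ≃ₗ[B] Y) : IsRetractOf B X Y :=
  ⟨e, e.symm, e.symm_apply_apply⟩

theorem IsRetractOf.sol_subset {S : Type*} [Ring S] {X Y : Type*} [AddCommGroup X]
    [Module Sᵐᵒᵖ X] [AddCommGroup Y] [Module Sᵐᵒᵖ Y] (h : IsRetractOf Sᵐᵒᵖ X Y)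
    {φ ψ : PPFormula S 1} (hY : φ.sol Y ⊆ ψ.sol Y) : φ.sol X ⊆ ψ.sol X := by
  obtain ⟨f, g, hgf⟩ := h
  exact φ.sol_subset_of_retract ψ f g hgf hY

/-- All idempotent endomorphisms are `0` or `1`. -/
def HasTrivialIdempotents (B X : Type*) [Ring B] [AddCommGroup X] [Module B X] : Prop :=
  ∀ e : X →ₗ[B] X, (∀ x, e (e x) = e x) → (∀ x, e x = 0) ∨ ∀ x, e x = x

theorem indecomposable_iff {S : Type u} [Ring S] (X : ModuleCat.{u} S) :
    Indecomposable X ↔ Nontrivial X ∧ HasTrivialIdempotents S X := by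
  rw [← not_subsingleton_iff_nontrivial, ← ModuleCat.isZero_iff_subsingleton]
  refine and_congr_right fun _ => ⟨fun h e he => ?_, fun h Y Z i => ?_⟩
  · have hc : IsCompl (LinearMap.range e) (LinearMap.ker e) :=
      LinearMap.IsIdempotentElem.isCompl (LinearMap.ext he)
    let i := (Submodule.prodEquivOfIsCompl _ _ hc).symm.toModuleIso ≪≫
      (ModuleCat.biprodIsoProd (ModuleCat.of S (LinearMap.range e))
        (ModuleCat.of S (LinearMap.ker e))).symm
    refine (h _ _ i).imp (fun h0 x => ?_) fun h0 x => ?_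
    · have := ModuleCat.subsingleton_of_isZero h0
      exact congrArg Subtype.val (Subsingleton.elim (⟨e x, x, rfl⟩ : LinearMap.range e) 0)
    · have := ModuleCat.subsingleton_of_isZero h0
      have hx : e x - x ∈ LinearMap.ker e := by
        rw [LinearMap.mem_ker, map_sub, he, sub_self]
      exact sub_eq_zero.1 (congrArg Subtype.val
        (Subsingleton.elim (⟨e x - x, hx⟩ : LinearMap.ker e) 0))
  · let F : X ≃ₗ[S] Y × Z := (i ≪≫ ModuleCat.biprodIsoProd Y Z).toLinearEquiv
    have hF := h (F.symm.toLinearMap ∘ₗ LinearMap.inl S Y Z ∘ₗ LinearMap.fst S Y Z ∘ₗ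
      F.toLinearMap) fun x => by simp
    simp only [LinearMap.comp_apply, LinearEquiv.coe_coe, LinearEquiv.symm_apply_eq] at hF
    refine hF.imp (fun h0 => ?_) fun h0 => ?_
    · rw [ModuleCat.isZero_iff_subsingleton]
      refine subsingleton_of_forall_eq 0 fun y => ?_
      simpa using h0 (F.symm (y, 0))
    · rw [ModuleCat.isZero_iff_subsingleton]
      refine subsingleton_of_forall_eq 0 fun z => ?_
      have := congrArg Prod.snd (h0 (F.symm (0, z)))
      simpa using this.symm

end Retract

/-! ### Functoriality of hulls -/

section Uniqueness

variable {R Λ Γ : Type u} [CommRing R] [Ring Λ] [Ring Γ] [Algebra R Λ] [Algebra R Γ]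
  {ι : Λ →+* Γ} {I : Ideal Γ} [I.IsTwoSided] {π : R}
  {M P P' : Type u} [AddCommGroup M] [Module Λᵐᵒᵖ M] [AddCommGroup P]
  [Module Γᵐᵒᵖ P] {i : M →ₛₗ[RingHom.op ι] P} [AddCommGroup P'] [Module Γᵐᵒᵖ P']
  {M' : Type u} [AddCommGroup M'] [Module Λᵐᵒᵖ M'] {j : M' →ₛₗ[RingHom.op ι] P'}

/-- The formation of hulls is functorial: the submodule of `P × P'` that is generated by the graph
of `M → M'` is a hull of `M`, hence projects isomorphically to `P`. -/
theorem IsHull.exists_map (H : IsHereditaryPair ι I π) (hi : IsHull π i) (hj : IsHull π j)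
    (α : M →ₗ[Λᵐᵒᵖ] M') : ∃ β : P →ₗ[Γᵐᵒᵖ] P', ∀ m, β (i m) = j (α m) := by
  let G : Submodule Γᵐᵒᵖ (P × P') := Submodule.span Γᵐᵒᵖ (Set.range fun m => (i m, j (α m)))
  let d : M →ₛₗ[RingHom.op ι] G :=
    { toFun := fun m => ⟨(i m, j (α m)), Submodule.subset_span ⟨m, rfl⟩⟩
      map_add' := fun x y => Subtype.ext (Prod.ext (map_add i x y) (by simp))
      map_smul' := fun s x => Subtype.ext (Prod.ext (i.map_smulₛₗ s x)
        ((congrArg j (map_smul α s x)).trans (j.map_smulₛₗ s (α x)))) }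
  have hd : IsHull π d :=
    { injective := fun x y h => hi.injective (congrArg (fun z : G => z.1.1) h)
      span_range := by
        have : Set.range d = ((↑) : G → P × P') ⁻¹' (Set.range fun m => (i m, j (α m))) := by
          ext x
          exact ⟨fun ⟨m, hm⟩ => ⟨m, congrArg Subtype.val hm⟩, fun ⟨m, hm⟩ => ⟨m, Subtype.ext hm⟩⟩
        rw [this]
        exact Submodule.span_span_coe_preimage
      torsionFree := fun p hp => Subtype.ext (Prod.ext
        (hi.torsionFree _ (congrArg (fun z : G => z.1.1) hp))
        (hj.torsionFree _ (congrArg (fun z : G => z.1.2) hp))) }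
  obtain ⟨n, hn⟩ := IsHull.exists_smul_mem H
  let f : G →ₗ[Γᵐᵒᵖ] P := (LinearMap.fst Γᵐᵒᵖ P P').comp G.subtype
  have hf : ∀ m, f (d m) = i m := fun _ => rfl
  have hbij : Function.Bijective f := by
    constructor
    · rw [injective_iff_map_eq_zero]
      intro x hx
      obtain ⟨m, hm⟩ := hn hd x
      refine torsionFree_pow hd.torsionFree n ?_
      have : i m = 0 := by rw [← hf, hm, map_smul, hx, smul_zero]
      rw [← hm, hi.injective (this.trans (map_zero i).symm), map_zero, smul_zero]
    · rw [← LinearMap.range_eq_top, eq_top_iff, ← hi.span_range, Submodule.span_le]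
      rintro _ ⟨m, rfl⟩
      exact ⟨d m, hf m⟩
  let e := LinearEquiv.ofBijective f hbij
  refine ⟨((LinearMap.snd Γᵐᵒᵖ P P').comp G.subtype).comp e.symm.toLinearMap, fun m => ?_⟩
  have : e.symm (i m) = d m := (LinearEquiv.symm_apply_eq e).2 rfl
  rw [LinearMap.comp_apply, LinearEquiv.coe_coe, this]
  rfl

/-- The presented modules depend functorially on the torsion-free modules. -/
theorem IsTriplePres.exists_map_of_hulls (H : IsHereditaryPair ι I π) (hi : IsHull π i)
    (hj : IsHull π j) {X X' : Type u} [AddCommGroup X] [Module (TripleRing ι I)ᵐᵒᵖ X]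
    [AddCommGroup X'] [Module (TripleRing ι I)ᵐᵒᵖ X'] {q : M × P →+ X} {q' : M' × P' →+ X'}
    (hq : IsTriplePres I i q) (hq' : IsTriplePres I j q') (α : M →ₗ[Λᵐᵒᵖ] M') :
    ∃ (β : P →ₗ[Γᵐᵒᵖ] P') (e : X →ₗ[(TripleRing ι I)ᵐᵒᵖ] X'), (∀ m, β (i m) = j (α m)) ∧
      ∀ m p, e (q (m, p)) = q' (α m, β p) := by
  obtain ⟨β, hβ⟩ := hi.exists_map H hj α
  obtain ⟨e, he⟩ := hq.exists_map hq' α β hβ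
  exact ⟨β, e, hβ, he⟩

/-- A direct summand of a torsion-free module presents a direct summand. -/
theorem IsTriplePres.isRetractOf (H : IsHereditaryPair ι I π) (hi : IsHull π i)
    (hj : IsHull π j) {X X' : Type u} [AddCommGroup X] [Module (TripleRing ι I)ᵐᵒᵖ X]
    [AddCommGroup X'] [Module (TripleRing ι I)ᵐᵒᵖ X'] {q : M × P →+ X} {q' : M' × P' →+ X'}
    (hq : IsTriplePres I i q) (hq' : IsTriplePres I j q') (h : IsRetractOf Λᵐᵒᵖ M M') :
    IsRetractOf (TripleRing ι I)ᵐᵒᵖ X X' := by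
  obtain ⟨α, α', hα⟩ := h
  obtain ⟨β, e, hβ, he⟩ := hq.exists_map_of_hulls H hi hj hq' α
  obtain ⟨β', e', hβ', he'⟩ := hq'.exists_map_of_hulls H hj hi hq α'
  have hid : β' ∘ₗ β = LinearMap.id := hi.ext fun m => by
    rw [LinearMap.comp_apply, hβ, hβ', hα, LinearMap.id_apply]
  refine ⟨e, e', fun x => ?_⟩
  obtain ⟨⟨m, p⟩, rfl⟩ := hq.surjective x
  rw [he, he', hα, ← LinearMap.comp_apply β', hid, LinearMap.id_apply]

/-- The triple presented by a torsion-free module is unique up to isomorphism. -/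
theorem IsTriplePres.nonempty_equiv_of_hulls (H : IsHereditaryPair ι I π)
    {j : M →ₛₗ[RingHom.op ι] P'}
    (hi : IsHull π i) (hj : IsHull π j) {X X' : Type u} [AddCommGroup X]
    [Module (TripleRing ι I)ᵐᵒᵖ X] [AddCommGroup X'] [Module (TripleRing ι I)ᵐᵒᵖ X']
    {q : M × P →+ X} {q' : M × P' →+ X'}
    (hq : IsTriplePres I i q) (hq' : IsTriplePres I j q') :
    Nonempty (X ≃ₗ[(TripleRing ι I)ᵐᵒᵖ] X') := by
  obtain ⟨β, hβ⟩ := hi.exists_map H hj LinearMap.id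
  obtain ⟨β', hβ'⟩ := hj.exists_map H hi LinearMap.id
  have h1 : β' ∘ₗ β = LinearMap.id := hi.ext fun m => by
    rw [LinearMap.comp_apply, hβ, hβ', LinearMap.id_apply, LinearMap.id_apply,
      LinearMap.id_apply]
  have h2 : β ∘ₗ β' = LinearMap.id := hj.ext fun m => by
    rw [LinearMap.comp_apply, hβ', hβ, LinearMap.id_apply, LinearMap.id_apply,
      LinearMap.id_apply]
  exact hq.nonempty_equiv hq' (LinearEquiv.refl _ _) (LinearEquiv.ofLinearMap β β' h2 h1) hβ

end Uniqueness

/-! ### Torsion-free modules over an order -/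

section Standard

variable {R Q Λ : Type u} [CommRing R] [IsDomain R] [Field Q] [Algebra R Q] [IsFractionRing R Q]
  [Ring Λ] [Algebra R Λ]
  {M : Type u} [AddCommGroup M] [Module R M] [Module Λᵐᵒᵖ M] [IsScalarTower R Λᵐᵒᵖ M]

omit [IsDomain R] in
theorem baseOp_smul_eq (r : R) (m : M) : baseOp Λ r • m = r • m := by
  have : baseOp Λ r = r • (1 : Λᵐᵒᵖ) := by
    rw [baseOp, Algebra.algebraMap_eq_smul_one, op_smul, op_one]
  rw [this, smul_assoc, one_smul]

theorem ModQ.tmul_one_injective (hM : ∀ (r : R) (m : M), r • m = 0 → r = 0 ∨ m = 0) :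
    Function.Injective (ModQ.tmul R (1 : Q) : M → ModQ R Q M) := by
  have : Function.Injective (TensorProduct.mk R Q M 1) := by
    rw [injective_iff_map_eq_zero]
    intro m hm
    obtain ⟨c, hc⟩ := (IsLocalizedModule.eq_zero_iff (nonZeroDivisors R) _).1 hm
    exact (hM c m hc).resolve_left (nonZeroDivisors.ne_zero c.2)
  exact this

omit [IsDomain R] in
theorem ModQ.op_algebraMap_smul_cancel {r : R} (hr : r ≠ 0) {x : ModQ R Q M}
    (hx : op (algebraMap R (Q ⊗[R] Λ) r) • x = 0) : x = 0 := by
  have hr' : algebraMap R Q r ≠ 0 := by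
    rwa [Ne, FaithfulSMul.algebraMap_eq_zero_iff]
  have h : algebraMap R (Q ⊗[R] Λ) r * ((algebraMap R Q r)⁻¹ ⊗ₜ 1) = 1 := by
    rw [Algebra.TensorProduct.algebraMap_apply, Algebra.TensorProduct.tmul_mul_tmul,
      mul_inv_cancel₀ hr', one_mul]
    rfl
  have := congrArg (fun y => op ((algebraMap R Q r)⁻¹ ⊗ₜ[R] (1 : Λ)) • y) hx
  simpa only [← mul_smul, ← op_mul, h, op_one, one_smul, smul_zero] using this

variable {Γ : Subalgebra R (Q ⊗[R] Λ)}
  (hΓ : (Algebra.TensorProduct.includeRight : Λ →ₐ[R] Q ⊗[R] Λ).range ≤ Γ)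

theorem isHull_inclMΓ {π : R} (h0 : π ≠ 0)
    (hM : ∀ (r : R) (m : M), r • m = 0 → r = 0 ∨ m = 0) : IsHull π (inclMΓ hΓ M) where
  injective x y h := ModQ.tmul_one_injective hM (congrArg Subtype.val h)
  span_range := by
    have : Set.range (inclMΓ hΓ M) = ((↑) : spanMΓ Γ M → ModQ R Q M) ⁻¹'
        (Set.range fun m : M => ModQ.tmul R (1 : Q) m) := by
      ext x
      exact ⟨fun ⟨m, hm⟩ => ⟨m, congrArg Subtype.val hm⟩, fun ⟨m, hm⟩ => ⟨m, Subtype.ext hm⟩⟩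
    rw [this]
    exact Submodule.span_span_coe_preimage
  torsionFree p hp := Subtype.ext
    (ModQ.op_algebraMap_smul_cancel h0 (congrArg Subtype.val hp))

variable (I : Ideal Γ) [I.IsTwoSided]

omit [IsDomain R] [IsFractionRing R Q] in
theorem subMΓI_eq_rightMul : subMΓI I M = rightMul I (ModΓ Γ M) := by
  refine le_antisymm (Submodule.span_mono ?_) (Submodule.span_le.2 ?_)
  · rintro _ ⟨g, hg, m, rfl⟩
    exact ⟨g, hg, _, rfl⟩
  · rintro _ ⟨g, hg, x, rfl⟩
    exact smul_mem_subMΓI I M x g hg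

variable (M) in
/-- The presentation of the triple of a torsion-free module `M` by `M` and `M Γ`. -/
def tripleMk : M × ModΓ Γ M →+ TripleModule (sigma hΓ I M) where
  toFun x := (Submodule.Quotient.mk x.1, Submodule.Quotient.mk x.2)
  map_zero' := rfl
  map_add' _ _ := rfl

theorem isTriplePres_tripleMk {π : R} (h0 : π ≠ 0)
    (hM : ∀ (r : R) (m : M), r • m = 0 → r = 0 ∨ m = 0)
    (hI : ∀ x ∈ I, ∃ s, orderIncl hΓ s = x) :
    IsTriplePres I (inclMΓ hΓ M) (tripleMk M hΓ I) where
  apply_smul _ _ _ _ _ := rfl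
  surjective := by
    rintro ⟨x, y⟩
    obtain ⟨m, rfl⟩ := Submodule.Quotient.mk_surjective _ x
    obtain ⟨p, rfl⟩ := Submodule.Quotient.mk_surjective _ y
    exact ⟨(m, p), rfl⟩
  apply_eq_zero m p := by
    have h1 : tripleMk M hΓ I (m, p) = 0 ↔ m ∈ subMI hΓ I M ∧ p ∈ subMΓI I M := by
      rw [← Submodule.Quotient.mk_eq_zero (subMI hΓ I M),
        ← Submodule.Quotient.mk_eq_zero (subMΓI I M)]
      exact Prod.ext_iff
    rw [h1, subMΓI_eq_rightMul]
    clear h1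
    refine and_congr_left fun _ => ⟨fun h => ?_, fun h => ?_⟩
    · induction h using Submodule.span_induction with
      | mem x hx =>
        obtain ⟨s, hs, m, rfl⟩ := hx
        rw [semilinear_op_smul]
        exact smul_mem_rightMul I hs _
      | zero => rw [map_zero]; exact zero_mem _
      | add x y _ _ hx hy => rw [map_add]; exact add_mem hx hy
      | smul a x _ hx => rw [LinearMap.map_smulₛₗ]; exact Submodule.smul_mem _ _ hx
    · have hi := isHull_inclMΓ hΓ h0 hM
      obtain ⟨m', hm', hmem⟩ := hi.exists_preimage hI h
      rwa [← hi.injective hm']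

variable (M) in
/-- The canonical map `M Γ → M Γ / M I`. -/
def mkQuotMΓ : ModΓ Γ M →ₛₗ[RingHom.op (Ideal.Quotient.mk I)] quotMΓ I M where
  toFun := Submodule.Quotient.mk
  map_add' _ _ := rfl
  map_smul' _ _ := rfl

omit [IsDomain R] [IsFractionRing R Q] in
theorem isReductionMod_mkQuotMΓ : IsReductionMod I (mkQuotMΓ M I) where
  surjective := Submodule.Quotient.mk_surjective _
  apply_eq_zero p := by
    rw [← subMΓI_eq_rightMul]
    exact Submodule.Quotient.mk_eq_zero _

end Standard

/-! ### The divisible part of a torsion-free module -/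

section DivisiblePart

variable {R Q Λ : Type u} [CommRing R] [IsDomain R] [IsDiscreteValuationRing R] {π : R}

theorem exists_unit_mul_pow (hπ : IsLocalRing.maximalIdeal R = Ideal.span {π}) {r : R}
    (hr : r ≠ 0) : ∃ (k : ℕ) (u : Rˣ), r = u * π ^ k :=
  IsDiscreteValuationRing.eq_unit_mul_pow_irreducible hr
    ((IsDiscreteValuationRing.irreducible_iff_uniformizer π).2 hπ)

theorem uniformizer_ne_zero (hπ : IsLocalRing.maximalIdeal R = Ideal.span {π}) : π ≠ 0 :=
  ((IsDiscreteValuationRing.irreducible_iff_uniformizer π).2 hπ).ne_zero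

theorem exists_mul_pow_eq_algebraMap (hπ : IsLocalRing.maximalIdeal R = Ideal.span {π})
    [Field Q] [Algebra R Q] [IsFractionRing R Q] (q : Q) :
    ∃ (k : ℕ) (r : R), π ^ k • q = algebraMap R Q r := by
  obtain ⟨a, b, hb, rfl⟩ := IsFractionRing.div_surjective (A := R) q
  obtain ⟨k, u, rfl⟩ := exists_unit_mul_pow hπ (nonZeroDivisors.ne_zero hb)
  refine ⟨k, (↑u⁻¹ : R) * a, ?_⟩
  have hb' : algebraMap R Q (↑u * π ^ k) ≠ 0 := by
    rw [Ne, FaithfulSMul.algebraMap_eq_zero_iff]; exact nonZeroDivisors.ne_zero hb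
  rw [Algebra.smul_def, ← mul_div_assoc, div_eq_iff hb', ← map_mul, ← map_mul]
  congr 1
  linear_combination (-(π ^ k * a)) * u.inv_mul

variable [Ring Λ] [Algebra R Λ] {M : Type u} [AddCommGroup M] [Module Λᵐᵒᵖ M]

theorem torsionFree_of_uniformizer (hπ : IsLocalRing.maximalIdeal R = Ideal.span {π})
    (hM : ∀ m : M, baseOp Λ π • m = 0 → m = 0) (r : R) (m : M) (h : baseOp Λ r • m = 0) :
    r = 0 ∨ m = 0 := by
  refine or_iff_not_imp_left.2 fun hr => ?_
  obtain ⟨k, u, rfl⟩ := exists_unit_mul_pow hπ hr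
  refine torsionFree_pow hM k ?_
  rw [smul_zero]
  have h1 : baseOp Λ π ^ k = baseOp Λ (↑u⁻¹ : R) * baseOp Λ (↑u * π ^ k) := by
    rw [← op_mul, ← map_mul, ← op_pow, ← map_pow]
    congr 2
    linear_combination (-π ^ k) * u.inv_mul
  rw [h1, mul_smul, h, smul_zero]

variable [Field Q] [Algebra R Q] [IsFractionRing R Q] [Module R M] [IsScalarTower R Λᵐᵒᵖ M]

/-- If `Q Λ` is semisimple, then the divisible part of a torsion-free `Λ`-module `M`, which is a
`Q Λ`-submodule of `M Q`, is a direct summand of `M`. -/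
theorem exists_retraction_divisiblePart (hπ : IsLocalRing.maximalIdeal R = Ideal.span {π})
    [IsSemisimpleRing (Q ⊗[R] Λ)] (hM : ∀ m : M, baseOp Λ π • m = 0 → m = 0) :
    ∃ ρ : M →ₗ[Λᵐᵒᵖ] M, (∀ m, ρ m ∈ divisiblePart (baseOp Λ π) (baseOp_central Λ π) M) ∧
      ∀ m ∈ divisiblePart (baseOp Λ π) (baseOp_central Λ π) M, ρ m = m := by
  set D := divisiblePart (baseOp Λ π) (baseOp_central Λ π) M with hD
  have hinj : Function.Injective (ModQ.tmul R (1 : Q) : M → ModQ R Q M) :=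
    ModQ.tmul_one_injective fun r m h =>
      torsionFree_of_uniformizer hπ hM r m (by rwa [baseOp_smul_eq])
  have hdiv : ∀ (k : ℕ) (d : M), d ∈ D → ∃ y ∈ D, π ^ k • y = d := by
    intro k d hd
    induction k with
    | zero => exact ⟨d, hd, by simp⟩
    | succ k ih =>
      obtain ⟨y, hy, rfl⟩ := ih
      obtain ⟨z, rfl⟩ := (mem_divisiblePart _).1 hy 1
      rw [pow_one] at hy ⊢
      refine ⟨z, mem_divisiblePart_of_smul_mem _ hM hy, ?_⟩
      rw [baseOp_smul_eq, pow_succ, mul_smul]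
  have hact : ∀ d ∈ D, ∀ a : Q ⊗[R] Λ, ∃ d' ∈ D, op a • ModQ.tmul R (1 : Q) d
      = (ModQ.tmul R (1 : Q) d' : ModQ R Q M) := by
    intro d hd a
    induction a using TensorProduct.induction_on with
    | zero => exact ⟨0, zero_mem _, by
        rw [op_zero, zero_smul]; exact (TensorProduct.tmul_zero _ _).symm⟩
    | add a b ha hb =>
      obtain ⟨x, hx, hx'⟩ := ha
      obtain ⟨y, hy, hy'⟩ := hb
      exact ⟨x + y, add_mem hx hy, by
        rw [MulOpposite.op_add, add_smul, hx', hy']; exact (TensorProduct.tmul_add _ _ _).symm⟩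
    | tmul q s =>
      obtain ⟨k, r, hr⟩ := exists_mul_pow_eq_algebraMap hπ q
      obtain ⟨y, hy, hy'⟩ := hdiv k (op s • d) (Submodule.smul_mem _ _ hd)
      refine ⟨r • y, ?_, ?_⟩
      · rw [← baseOp_smul_eq (Λ := Λ)]; exact Submodule.smul_mem _ _ hy
      · rw [ModQ.op_tmul_smul, mul_one, ← hy']
        change q ⊗ₜ[R] (π ^ k • y) = (1 : Q) ⊗ₜ[R] (r • y)
        rw [← TensorProduct.smul_tmul, ← TensorProduct.smul_tmul, hr,
          Algebra.algebraMap_eq_smul_one]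
  let E : Submodule (Q ⊗[R] Λ)ᵐᵒᵖ (ModQ R Q M) :=
    { carrier := {x | ∃ d ∈ D, x = ModQ.tmul R (1 : Q) d}
      zero_mem' := ⟨0, zero_mem _, (TensorProduct.tmul_zero _ _).symm⟩
      add_mem' := by
        rintro _ _ ⟨x, hx, rfl⟩ ⟨y, hy, rfl⟩
        exact ⟨x + y, add_mem hx hy, (TensorProduct.tmul_add _ _ _).symm⟩
      smul_mem' := by
        rintro a _ ⟨d, hd, rfl⟩
        exact hact d hd a.unop }
  obtain ⟨C, hC⟩ := exists_isCompl E
  let p := E.projectionOnto C hC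
  choose ρ hρ hρ' using fun m : M => (p (ModQ.tmul R (1 : Q) m)).2
  have hone : ∀ s : Λ, ∀ m : M, ModQ.tmul R (1 : Q) (op s • m)
      = op ((1 : Q) ⊗ₜ[R] s) • ModQ.tmul R (1 : Q) m := fun s m => by
    rw [ModQ.op_tmul_smul, one_mul]
  refine ⟨{ toFun := ρ, map_add' := fun x y => hinj ?_, map_smul' := fun s x => hinj ?_ },
    hρ, fun m hm => hinj ?_⟩
  · rw [← hρ']
    refine Eq.trans ?_ (TensorProduct.tmul_add _ _ _).symm
    change _ = ModQ.tmul R (1 : Q) (ρ x) + ModQ.tmul R (1 : Q) (ρ y)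
    rw [← hρ', ← hρ', ← Submodule.coe_add, ← map_add]
    exact congrArg (fun z => (p z : ModQ R Q M)) (TensorProduct.tmul_add _ _ _)
  · obtain ⟨s, rfl⟩ := op_surjective s
    rw [← hρ', RingHom.id_apply, hone, hone, map_smul, ← hρ']
    rfl
  · change ModQ.tmul R (1 : Q) (ρ m) = _
    rw [← hρ']
    exact congrArg Subtype.val (Submodule.projectionOnto_apply_left hC ⟨_, m, hm, rfl⟩)

end DivisiblePart

/-! ### Direct summands of triples -/

section TripleRetract

variable {S T : Type u} [Ring S] [Ring T] {ι : S →+* T}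

theorem IsGeneratingMonoTriple.of_equiv {X Y : ModuleCat.{u} (TriangularRing ι)ᵐᵒᵖ}
    (hX : IsGeneratingMonoTriple ι X) (e : Y ≃ₗ[(TriangularRing ι)ᵐᵒᵖ] X) :
    IsGeneratingMonoTriple ι Y := by
  obtain ⟨U, V, _, _, _, _, f, hf, hspan, hproj, ⟨eX⟩⟩ := hX
  exact ⟨U, V, _, _, _, _, f, hf, hspan, hproj, ⟨e.toModuleIso ≪≫ eX⟩⟩

/-- The class `𝒟` is closed under direct summands: an idempotent endomorphism of a triple is given
by idempotent endomorphisms of its two components. -/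
theorem IsGeneratingMonoTriple.of_isRetractOf {X Y : ModuleCat.{u} (TriangularRing ι)ᵐᵒᵖ}
    (hX : IsGeneratingMonoTriple ι X) (h : IsRetractOf (TriangularRing ι)ᵐᵒᵖ Y X) :
    IsGeneratingMonoTriple ι Y := by
  obtain ⟨U, V, _, _, _, _, f, hf, hspan, hproj, ⟨eX⟩⟩ := hX
  obtain ⟨a, b, hba⟩ := h.trans (IsRetractOf.of_equiv eX.toLinearEquiv)
  let E : U × V → U × V := fun x => a (b x)
  have hE : ∀ x, E (E x) = E x := fun x => congrArg a (hba (b x))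
  have hadd : ∀ x y, E (x + y) = E x + E y := map_add (a ∘ₗ b)
  have hsm : ∀ (s : S) (t t' : T) (u : U) (v : V), E (op s • u, op t • f u + op t' • v)
      = (op s • (E (u, v)).1, op t • f (E (u, v)).1 + op t' • (E (u, v)).2) :=
    fun s t t' u v => (a ∘ₗ b).map_smul (op (⟨s, t, t'⟩ : TriangularRing ι))
      ((u, v) : TripleModule f)
  -- the components of `E`
  have hfst : ∀ (s : S) (u : U), E (op s • u, 0) = (op s • (E (u, 0)).1, 0) := fun s u => by
    simpa using hsm s 0 0 u 0
  have hsnd : ∀ (t : T) (v : V), E (0, op t • v) = (0, op t • (E (0, v)).2) := fun t v => by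
    simpa using hsm 0 0 t 0 v
  let EU : U →ₗ[Sᵐᵒᵖ] U :=
    { toFun := fun u => (E (u, 0)).1
      map_add' := fun u u' => by
        have : (u + u', (0 : V)) = (u, 0) + (u', 0) := by simp
        rw [this, hadd]; rfl
      map_smul' := fun s u => congrArg Prod.fst (hfst s.unop u) }
  let EV : V →ₗ[Tᵐᵒᵖ] V :=
    { toFun := fun v => (E (0, v)).2
      map_add' := fun v v' => by
        have : ((0 : U), v + v') = (0, v) + (0, v') := by simp
        rw [this, hadd]; rfl
      map_smul' := fun t v => congrArg Prod.snd (hsnd t.unop v) }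
  have hEUV : ∀ u v, E (u, v) = (EU u, EV v) := by
    intro u v
    have h1 := hfst 1 u
    have h2 := hsnd 1 v
    rw [op_one, one_smul, one_smul] at h1 h2
    have : (u, v) = (u, 0) + (0, v) := by simp
    rw [this, hadd, h1, h2]
    exact Prod.ext (add_zero _) (zero_add _)
  have hfE : ∀ u, EV (f u) = f (EU u) := by
    intro u
    have h := hsm 0 1 0 u 0
    rw [hEUV, hEUV] at h
    simpa using (Prod.ext_iff.1 h).2
  have hU : ∀ u, EU (EU u) = EU u := fun u => by
    have := hE (u, 0)
    rw [hEUV, hEUV] at this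
    exact (Prod.ext_iff.1 this).1
  have hV : ∀ v, EV (EV v) = EV v := fun v => by
    have := hE (0, v)
    rw [hEUV, hEUV] at this
    exact (Prod.ext_iff.1 this).2
  let f' : LinearMap.range EU →ₛₗ[RingHom.op ι] LinearMap.range EV :=
    { toFun := fun u => ⟨f u, by
        obtain ⟨_, u, rfl⟩ := u
        exact ⟨f u, hfE u⟩⟩
      map_add' := fun u u' => Subtype.ext (map_add f u.1 u'.1)
      map_smul' := fun s u => Subtype.ext (f.map_smulₛₗ s u.1) }
  have haE : ∀ y, a y = (EU (a y).1, EV (a y).2) := fun y => by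
    rw [← hEUV]
    exact (congrArg a (hba y)).symm
  let F : Y →ₗ[(TriangularRing ι)ᵐᵒᵖ] TripleModule f' :=
    { toFun := fun y => (⟨(a y).1, (a y).1, (congrArg Prod.fst (haE y)).symm⟩,
        ⟨(a y).2, (a y).2, (congrArg Prod.snd (haE y)).symm⟩)
      map_add' := fun x y => Prod.ext (Subtype.ext (congrArg Prod.fst (map_add a x y)))
        (Subtype.ext (congrArg Prod.snd (map_add a x y)))
      map_smul' := fun d y => Prod.ext (Subtype.ext (congrArg Prod.fst (map_smul a d y)))
        (Subtype.ext (congrArg Prod.snd (map_smul a d y))) }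
  have hF : Function.Bijective F := by
    constructor
    · intro x y hxy
      have h : a x = a y := Prod.ext (congrArg (fun z => z.1.1) hxy)
        (congrArg (fun z => z.2.1) hxy)
      rw [← hba x, h, hba]
    · rintro ⟨⟨_, u, rfl⟩, ⟨_, v, rfl⟩⟩
      have h : a (b (u, v)) = (EU u, EV v) := hEUV u v
      exact ⟨b (u, v), Prod.ext (Subtype.ext (Prod.ext_iff.1 h).1)
        (Subtype.ext (Prod.ext_iff.1 h).2)⟩
  refine ⟨LinearMap.range EU, LinearMap.range EV, _, _, _, _, f',
    fun u u' h => Subtype.ext (hf (congrArg Subtype.val h)), ?_,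
    Module.Projective.of_split (LinearMap.range EV).subtype EV.rangeRestrict
      (LinearMap.ext ?_), ⟨(LinearEquiv.ofBijective F hF).toModuleIso⟩⟩
  · rw [eq_top_iff]
    rintro ⟨_, v, rfl⟩ -
    have hv : v ∈ Submodule.span Tᵐᵒᵖ (Set.range f) := hspan ▸ Submodule.mem_top
    have := Submodule.mem_map_of_mem (f := EV.rangeRestrict) hv
    rw [Submodule.map_span] at this
    refine Submodule.span_mono ?_ this
    rintro _ ⟨_, ⟨u, rfl⟩, rfl⟩
    exact ⟨EU.rangeRestrict u, Subtype.ext (hfE u).symm⟩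
  · rintro ⟨_, v, rfl⟩
    exact Subtype.ext (hV v)

end TripleRetract

section PresentedModules

variable {R Λ Γ : Type u} [CommRing R] [Ring Λ] [Ring Γ] [Algebra R Λ] [Algebra R Γ]
  {ι : Λ →+* Γ} {I : Ideal Γ} [I.IsTwoSided] {π : R}
  {M P M' P' : Type u} [AddCommGroup M] [Module Λᵐᵒᵖ M] [AddCommGroup P]
  [Module Γᵐᵒᵖ P] {i : M →ₛₗ[RingHom.op ι] P} [AddCommGroup M'] [Module Λᵐᵒᵖ M']
  [AddCommGroup P'] [Module Γᵐᵒᵖ P'] {j : M' →ₛₗ[RingHom.op ι] P'}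
  {X X' : Type u} [AddCommGroup X] [Module (TripleRing ι I)ᵐᵒᵖ X] [AddCommGroup X']
  [Module (TripleRing ι I)ᵐᵒᵖ X'] {q : M × P →+ X} {q' : M' × P' →+ X'}

/-- A direct summand of a presented triple comes from a direct summand of the torsion-free module,
if the hulls are complete. -/
theorem IsTriplePres.exists_retraction (H : IsHereditaryPair ι I π) (hi : IsHull π i)
    (hj : IsHull π j) (hred : IsCReduced (baseOp Γ π) P) (hpre : IsCPrecomplete (baseOp Γ π) P)
    (hred' : IsCReduced (baseOp Γ π) P') (hpre' : IsCPrecomplete (baseOp Γ π) P')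
    (hq : IsTriplePres I i q) (hq' : IsTriplePres I j q')
    (e : X →ₗ[(TripleRing ι I)ᵐᵒᵖ] X') (e' : X' →ₗ[(TripleRing ι I)ᵐᵒᵖ] X)
    (he : ∀ x, e' (e x) = x) :
    ∃ (f : M →ₗ[Λᵐᵒᵖ] M') (g : M' →ₗ[Λᵐᵒᵖ] M), (∀ m, g (f m) = m) ∧
      (Function.Surjective f → Function.Surjective e) := by
  obtain ⟨α, β, hαβ, hβ⟩ := hq.exists_lift H hi hj hred' hpre' hq' e
  obtain ⟨α', β', hαβ', hβ'⟩ := hq'.exists_lift H hj hi hred hpre hq e'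
  have hbij : Function.Bijective (α' ∘ₗ α) :=
    hq.bijective H hi hred hpre (α' ∘ₗ α) (β' ∘ₗ β)
      (fun m => by simp only [LinearMap.comp_apply, hαβ, hαβ'])
      fun m p => by simp only [LinearMap.comp_apply, ← hβ', ← hβ, he]
  let E := LinearEquiv.ofBijective _ hbij
  refine ⟨α, E.symm.toLinearMap ∘ₗ α', fun m => (LinearEquiv.symm_apply_eq E).2 rfl,
    fun hα x => ?_⟩
  have hβs : Function.Surjective β := by
    rw [← LinearMap.range_eq_top, eq_top_iff, ← hj.span_range, Submodule.span_le]
    rintro _ ⟨m, rfl⟩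
    obtain ⟨m, rfl⟩ := hα m
    exact ⟨i m, hαβ m⟩
  obtain ⟨⟨m, p⟩, rfl⟩ := hq'.surjective x
  obtain ⟨m, rfl⟩ := hα m
  obtain ⟨p, rfl⟩ := hβs p
  exact ⟨q (m, p), hβ m p⟩

/-! ### Pure-injectivity and indecomposability of triples -/

/-- The triple of a pure-injective module is pure-injective. -/
theorem IsTriplePres.isPureInjective (H : IsHereditaryPair ι I π) {M : ModuleCat.{u} Λᵐᵒᵖ}
    {X : ModuleCat.{u} (TripleRing ι I)ᵐᵒᵖ} {i : M →ₛₗ[RingHom.op ι] P} {q : M × P →+ X}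
    (hi : IsHull π i) (hq : IsTriplePres I i q) (hM : IsPureInjective M) :
    IsPureInjective X := by
  refine isPureInjective_of_diag X fun K l _ => ?_
  obtain ⟨g, hg⟩ := hM.exists_retraction _ (isPureEmbedding_diag l M)
  obtain ⟨q', hq', hform⟩ := IsTriplePres.exists_redProd (l := l) H.fg fun _ : K => hq
  obtain ⟨β, e, hβ, he⟩ :=
    hq'.exists_map_of_hulls H (IsHull.redProd H fun _ : K => hi) hi hq g
  have hid : β ∘ₗ RedProd.diag Γᵐᵒᵖ l P = LinearMap.id := hi.ext fun m => by
    have := hβ (RedProd.diag Λᵐᵒᵖ l M m)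
    rw [hg] at this
    exact this
  refine ⟨e, fun x => ?_⟩
  obtain ⟨⟨m, p⟩, rfl⟩ := hq.surjective x
  rw [RedProd.diag_apply, ← hform (fun _ => m) fun _ => p, he]
  congr 1
  exact Prod.ext (hg m) (LinearMap.congr_fun hid p)

/-- A module with complete hull is pure-injective if its triple is. -/
theorem IsTriplePres.isPureInjective_of_isPureInjective (H : IsHereditaryPair ι I π)
    {M : ModuleCat.{u} Λᵐᵒᵖ} {X : ModuleCat.{u} (TripleRing ι I)ᵐᵒᵖ}
    {i : M →ₛₗ[RingHom.op ι] P} {q : M × P →+ X} (hi : IsHull π i)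
    (hred : IsCReduced (baseOp Γ π) P) (hpre : IsCPrecomplete (baseOp Γ π) P)
    (hq : IsTriplePres I i q) (hX : IsPureInjective X) : IsPureInjective M := by
  refine isPureInjective_of_diag M fun K l _ => ?_
  obtain ⟨g, hg⟩ := hX.exists_retraction _ (isPureEmbedding_diag l X)
  obtain ⟨q', hq', hform⟩ := IsTriplePres.exists_redProd (l := l) H.fg fun _ : K => hq
  obtain ⟨α, β, hαβ, hβ⟩ :=
    hq'.exists_lift H (IsHull.redProd H fun _ : K => hi) hi hred hpre hq g
  have hbij : Function.Bijective (α ∘ₗ RedProd.diag Λᵐᵒᵖ l M) :=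
    hq.bijective H hi hred hpre _ (β ∘ₗ RedProd.diag Γᵐᵒᵖ l P)
      (fun m => hαβ (RedProd.diag Λᵐᵒᵖ l M m)) fun m p => by
        rw [LinearMap.comp_apply, LinearMap.comp_apply, ← hβ, RedProd.diag_apply,
          RedProd.diag_apply, hform, ← RedProd.diag_apply, hg]
  let E := LinearEquiv.ofBijective _ hbij
  exact ⟨E.symm.toLinearMap ∘ₗ α, fun m => (LinearEquiv.symm_apply_eq E).2 rfl⟩

omit [Algebra R Λ] in
theorem IsTriplePres.nontrivial (hi : IsHull π i) (hq : IsTriplePres I i q) [Nontrivial X] :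
    Nontrivial M := by
  rw [← not_subsingleton_iff_nontrivial]
  intro h
  have hP : Subsingleton P := by
    refine subsingleton_of_forall_eq 0 fun p => ?_
    have hp : p ∈ Submodule.span Γᵐᵒᵖ (Set.range i) := hi.span_range ▸ Submodule.mem_top
    have : Set.range i ⊆ {0} := by
      rintro _ ⟨m, rfl⟩
      rw [Subsingleton.elim m 0, map_zero]; rfl
    simpa using Submodule.span_mono this hp
  exact not_subsingleton X hq.surjective.subsingleton

theorem IsTriplePres.nontrivial_of_nontrivial (H : IsHereditaryPair ι I π) (hi : IsHull π i)
    (hred : IsCReduced (baseOp Γ π) P) (hq : IsTriplePres I i q) [Nontrivial M] :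
    Nontrivial X := by
  rw [← not_subsingleton_iff_nontrivial]
  intro h
  obtain ⟨m, hm⟩ := exists_ne (0 : M)
  have hP : ∀ p, (LinearMap.id : P →ₗ[Γᵐᵒᵖ] P) p ∈ rightMul I P := fun p =>
    ((hq.apply_eq_zero 0 p).1 (Subsingleton.elim _ _)).2
  refine hm (hi.injective ?_)
  rw [map_zero]
  exact H.eq_zero_of_idempotent hred LinearMap.id hP (fun _ => rfl) (i m)

/-- Idempotent endomorphisms of `M` are detected by the triple of `M`. -/
theorem IsTriplePres.hasTrivialIdempotents (H : IsHereditaryPair ι I π) (hi : IsHull π i)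
    (hred : IsCReduced (baseOp Γ π) P) (hq : IsTriplePres I i q)
    (hX : HasTrivialIdempotents (TripleRing ι I)ᵐᵒᵖ X) : HasTrivialIdempotents Λᵐᵒᵖ M := by
  -- an idempotent that induces zero is zero
  have key : ∀ (α : M →ₗ[Λᵐᵒᵖ] M) (β : P →ₗ[Γᵐᵒᵖ] P), (∀ m, β (i m) = i (α m)) →
      (∀ m, α (α m) = α m) → (∀ p, q (0, β p) = 0) → ∀ m, α m = 0 := by
    intro α β h hα h0 m
    have hβ : β ∘ₗ β = β := hi.ext fun m => by rw [LinearMap.comp_apply, h, h, hα]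
    refine hi.injective ?_
    rw [← h, map_zero]
    exact H.eq_zero_of_idempotent hred β (fun p => ((hq.apply_eq_zero 0 _).1 (h0 p)).2)
      (fun p => LinearMap.congr_fun hβ p) _
  intro α hα
  obtain ⟨β, e, hβ, he⟩ := hq.exists_map_of_hulls H hi hi hq α
  have hββ : β ∘ₗ β = β := hi.ext fun m => by rw [LinearMap.comp_apply, hβ, hβ, hα]
  have hidem : ∀ x, e (e x) = e x := by
    intro x
    obtain ⟨⟨m, p⟩, rfl⟩ := hq.surjective x
    rw [he, he, hα, ← LinearMap.comp_apply β β, hββ]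
  refine (hX e hidem).imp (fun h0 => key α β hβ hα fun p => ?_) fun h1 => ?_
  · rw [← map_zero α, ← he, h0]
  · have := key (LinearMap.id - α) (LinearMap.id - β) (fun m => by simp [hβ])
      (fun m => by simp [hα]) fun p => by
        have h2 : ((0 : M), (LinearMap.id - β : P →ₗ[Γᵐᵒᵖ] P) p) = (0, p) - (α 0, β p) := by
          simp
        rw [h2, map_sub, ← he, h1, sub_self]
    exact fun m => (sub_eq_zero.1 (this m)).symm

/-- Idempotent endomorphisms of the triple of `M` are detected by `M`: their images come from
direct summands of `M`. -/
theorem IsTriplePres.hasTrivialIdempotents_triple (H : IsHereditaryPair ι I π)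
    (hΓ : ∀ x : Γ, baseOp Γ π • x = 0 → x = 0) (hredΓ : IsCReduced (baseOp Γ π) Γ)
    (hpreΓ : IsCPrecomplete (baseOp Γ π) Γ) {X : ModuleCat.{u} (TripleRing ι I)ᵐᵒᵖ}
    {q : M × P →+ X} (hi : IsHull π i)
    (hred : IsCReduced (baseOp Γ π) P) (hpre : IsCPrecomplete (baseOp Γ π) P)
    (hq : IsTriplePres I i q)
    (hX : IsGeneratingMonoTriple (Ideal.quotientMap I ι (le_refl (I.comap ι))) X)
    (hM : HasTrivialIdempotents Λᵐᵒᵖ M) : HasTrivialIdempotents (TripleRing ι I)ᵐᵒᵖ X := by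
  intro e he
  let Y := ModuleCat.of (TripleRing ι I)ᵐᵒᵖ (LinearMap.range e)
  let a : Y →ₗ[(TripleRing ι I)ᵐᵒᵖ] X := (LinearMap.range e).subtype
  let b : X →ₗ[(TripleRing ι I)ᵐᵒᵖ] Y := e.rangeRestrict
  have hab : ∀ y, b (a y) = y := by
    rintro ⟨_, x, rfl⟩
    exact Subtype.ext (he x)
  have hY : IsGeneratingMonoTriple _ Y := hX.of_isRetractOf ⟨a, b, hab⟩
  obtain ⟨N, W, k, q', hk, hq', hredW, hpreW⟩ := hY.exists_pres H hΓ hredΓ hpreΓ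
  obtain ⟨f, g, hgf, hsurj⟩ :=
    hq'.exists_retraction H hk hi hredW hpreW hred hpre hq a b hab
  refine (hM (f ∘ₗ g) fun m => congrArg f (hgf (g m))).imp (fun h0 x => ?_) fun h1 x => ?_
  · have hN : ∀ n : N, n = 0 := fun n => by
      rw [← hgf n, ← hgf (g (f n))]
      have := h0 (f n)
      rw [LinearMap.comp_apply] at this
      rw [this, map_zero]
    have hYs : Subsingleton Y := by
      by_contra hns
      rw [not_subsingleton_iff_nontrivial] at hns
      have := hq'.nontrivial hk
      obtain ⟨n, hn⟩ := exists_ne (0 : N)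
      exact hn (hN n)
    exact congrArg a (Subsingleton.elim (b x) 0)
  · obtain ⟨⟨_, y, rfl⟩, rfl⟩ := hsurj (fun m => ⟨g m, h1 m⟩) x
    exact he y

end PresentedModules

/-! ### Points of the Ziegler spectrum -/

section ZieglerPoints

variable {S : Type u} [Ring S]

/-- A pure-injective module that cannot be separated from a class `C` of modules by a pair of
pp formulas is a direct summand of a reduced product of members of `C`. -/
theorem IsPureInjective.exists_separation_or {X : ModuleCat.{u} Sᵐᵒᵖ} (hX : IsPureInjective X)
    (C : ModuleCat.{u} Sᵐᵒᵖ → Prop) :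
    (∃ φ ψ : PPFormula S 1, ¬ φ.sol X ⊆ ψ.sol X ∧
      ∀ Y : ModuleCat.{u} Sᵐᵒᵖ, C Y → φ.sol Y ⊆ ψ.sol Y) ∨
    ∃ (K : Type u) (l : Filter K) (ht : K → ℕ) (Y : K → ModuleCat.{u} Sᵐᵒᵖ),
      Filter.Tendsto ht l Filter.atTop ∧ (∀ k, C (Y k)) ∧
        IsRetractOf Sᵐᵒᵖ X (RedProd Sᵐᵒᵖ l fun k => Y k) := by
  refine or_iff_not_imp_left.2 fun h => ?_
  push Not at h
  obtain ⟨K, l, ht, Y, f, hht, hY, hf⟩ := exists_pureEmbedding_redProd X C h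
  obtain ⟨g, hg⟩ := hX.exists_retraction f hf
  exact ⟨K, l, ht, Y, hht, hY, f, g, hg⟩

theorem Zg.mk_eq_mk {M N : ModuleCat.{u} Sᵐᵒᵖ} {hM : IsZgModule M} {hN : IsZgModule N} :
    Zg.mk M hM = Zg.mk N hN ↔ Nonempty (M ≅ N) :=
  Quotient.eq

theorem Zg.mk_mem_inter {C : ModuleCat.{u} Sᵐᵒᵖ → Prop}
    (hC : ∀ M N : ModuleCat.{u} Sᵐᵒᵖ, (N ≃ₗ[Sᵐᵒᵖ] M) → C M → C N) {M : ModuleCat.{u} Sᵐᵒᵖ}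
    {hM : IsZgModule M} : Zg.mk M hM ∈ Zg.inter S C ↔ C M := by
  constructor
  · rintro ⟨N, hN, h, hCN⟩
    obtain ⟨e⟩ := Zg.mk_eq_mk.1 h
    exact hC _ _ e.symm.toLinearEquiv hCN
  · exact fun h => ⟨M, hM, rfl, h⟩

theorem Zg.mk_mem_basicOpen {φ ψ : PPFormula S 1} {M : ModuleCat.{u} Sᵐᵒᵖ} {hM : IsZgModule M} :
    Zg.mk M hM ∈ Zg.basicOpen φ ψ ↔ ¬ φ.sol M ⊆ ψ.sol M := by
  have h : ∀ N : ModuleCat.{u} Sᵐᵒᵖ, ψ.sol N ∩ φ.sol N ⊂ φ.sol N ↔ ¬ φ.sol N ⊆ ψ.sol N :=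
    fun N => by simp [ssubset_iff_subset_not_subset]
  rw [Zg.basicOpen, Zg.mk_mem_inter, h]
  intro M N e hM
  rw [h] at hM ⊢
  exact fun hN => hM ((IsRetractOf.of_equiv e.symm).sol_subset hN)

theorem Zg.isOpen_basicOpen (φ ψ : PPFormula S 1) : IsOpen (Zg.basicOpen φ ψ) :=
  TopologicalSpace.isOpen_generateFrom_of_mem ⟨φ, ψ, rfl⟩

/-- A direct summand of a module with trivial idempotents is zero or the whole module. -/
theorem HasTrivialIdempotents.nonempty_equiv {B X Y : Type*} [Ring B] [AddCommGroup X]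
    [Module B X] [AddCommGroup Y] [Module B Y] [Nontrivial X] (hY : HasTrivialIdempotents B Y)
    (h : IsRetractOf B X Y) : Nonempty (X ≃ₗ[B] Y) := by
  obtain ⟨f, g, hgf⟩ := h
  rcases hY (f ∘ₗ g) fun y => congrArg f (hgf (g y)) with h0 | h1
  · obtain ⟨x, hx⟩ := exists_ne (0 : X)
    refine absurd ?_ hx
    have := h0 (f x)
    rw [LinearMap.comp_apply, hgf] at this
    rw [← hgf x, this, map_zero]
  · exact ⟨LinearEquiv.ofLinearMap f g (LinearMap.ext h1) (LinearMap.ext hgf)⟩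

end ZieglerPoints

/-! ### Presentations and separation by pp formulas -/

section Presents

variable {R Λ Γ : Type u} [CommRing R] [Ring Λ] [Ring Γ] [Algebra R Λ] [Algebra R Γ]
  {ι : Λ →+* Γ} {I : Ideal Γ} [I.IsTwoSided] {π : R}

variable (ι I π) in
/-- The torsion-free module `M` presents `X` as the triple `(M / M I, M Γ / M I, σ_M)`. -/
def Presents (M : ModuleCat.{u} Λᵐᵒᵖ) (X : ModuleCat.{u} (TripleRing ι I)ᵐᵒᵖ) : Prop :=
  ∃ (P : ModuleCat.{u} Γᵐᵒᵖ) (i : M →ₛₗ[RingHom.op ι] P) (q : M × P →+ X),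
    IsHull π i ∧ IsTriplePres I i q

variable {M M' : ModuleCat.{u} Λᵐᵒᵖ} {X X' : ModuleCat.{u} (TripleRing ι I)ᵐᵒᵖ}

theorem Presents.torsionFree (H : IsHereditaryPair ι I π) (h : Presents ι I π M X) (m : M)
    (hm : baseOp Λ π • m = 0) : m = 0 := by
  obtain ⟨P, i, q, hi, -⟩ := h
  refine hi.injective ?_
  rw [map_zero]
  refine hi.torsionFree _ ?_
  rw [← pow_one (baseOp Γ π), ← H.map_base_smul, pow_one, hm, map_zero]

theorem Presents.isRetractOf (H : IsHereditaryPair ι I π) (h : Presents ι I π M X)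
    (h' : Presents ι I π M' X') (hr : IsRetractOf Λᵐᵒᵖ M M') :
    IsRetractOf (TripleRing ι I)ᵐᵒᵖ X X' := by
  obtain ⟨P, i, q, hi, hq⟩ := h
  obtain ⟨P', i', q', hi', hq'⟩ := h'
  exact hq.isRetractOf H hi hi' hq' hr

theorem Presents.nonempty_equiv (H : IsHereditaryPair ι I π) (h : Presents ι I π M X)
    (h' : Presents ι I π M X') : Nonempty (X ≃ₗ[(TripleRing ι I)ᵐᵒᵖ] X') := by
  obtain ⟨P, i, q, hi, hq⟩ := h
  obtain ⟨P', i', q', hi', hq'⟩ := h'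
  exact hq.nonempty_equiv_of_hulls H hi hi' hq'

theorem Presents.redProd (H : IsHereditaryPair ι I π) {K : Type u} (l : Filter K)
    {M : K → ModuleCat.{u} Λᵐᵒᵖ} {X : K → ModuleCat.{u} (TripleRing ι I)ᵐᵒᵖ}
    (h : ∀ k, Presents ι I π (M k) (X k)) :
    Presents ι I π (ModuleCat.of Λᵐᵒᵖ (RedProd Λᵐᵒᵖ l fun k => M k))
      (ModuleCat.of (TripleRing ι I)ᵐᵒᵖ (RedProd (TripleRing ι I)ᵐᵒᵖ l fun k => X k)) := by
  choose P i q hi hq using h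
  obtain ⟨q', hq', -⟩ := IsTriplePres.exists_redProd (l := l) H.fg hq
  exact ⟨ModuleCat.of Γᵐᵒᵖ (RedProd Γᵐᵒᵖ l fun k => P k), RedProd.map l i, q',
    IsHull.redProd H hi, hq'⟩

theorem Presents.quotient_divisiblePart (H : IsHereditaryPair ι I π) (h : Presents ι I π M X) :
    Presents ι I π
      (ModuleCat.of Λᵐᵒᵖ (M ⧸ divisiblePart (baseOp Λ π) (baseOp_central Λ π) M)) X := by
  obtain ⟨P, i, q, hi, hq⟩ := h
  obtain ⟨q', hq'⟩ := hq.exists_quotientDivisible H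
  exact ⟨ModuleCat.of Γᵐᵒᵖ (P ⧸ divisiblePart (baseOp Γ π) (baseOp_central Γ π) P), _, q',
    hi.quotientDivisible H, hq'⟩

/-- Between complete modules, direct summands are detected by the triples. -/
theorem Presents.isRetractOf_of_triple (H : IsHereditaryPair ι I π) (h : Presents ι I π M X)
    (h' : Presents ι I π M' X') (hred : IsCReduced (baseOp Λ π) M)
    (hpre : IsCPrecomplete (baseOp Λ π) M) (hred' : IsCReduced (baseOp Λ π) M')
    (hpre' : IsCPrecomplete (baseOp Λ π) M') (hr : IsRetractOf (TripleRing ι I)ᵐᵒᵖ X X') :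
    IsRetractOf Λᵐᵒᵖ M M' := by
  obtain ⟨P, i, q, hi, hq⟩ := h
  obtain ⟨P', i', q', hi', hq'⟩ := h'
  obtain ⟨e, e', he⟩ := hr
  obtain ⟨f, g, hgf, -⟩ := hq.exists_retraction H hi hi' (hi.isCReduced H hred)
    (hi.isCPrecomplete H hpre) (hi'.isCReduced H hred') (hi'.isCPrecomplete H hpre') hq' e e' he
  exact ⟨f, g, hgf⟩

/-- The class `𝒟` is separated by pp pairs from the other pure-injective modules, since it is
closed under reduced products and direct summands. -/
theorem IsPureInjective.exists_separation_of_not_mem (H : IsHereditaryPair ι I π)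
    (hΓ : ∀ x : Γ, baseOp Γ π • x = 0 → x = 0) (hredΓ : IsCReduced (baseOp Γ π) Γ)
    (hpreΓ : IsCPrecomplete (baseOp Γ π) Γ)
    (hD : ∀ (M : ModuleCat.{u} Λᵐᵒᵖ) (X : ModuleCat.{u} (TripleRing ι I)ᵐᵒᵖ), Presents ι I π M X →
      IsGeneratingMonoTriple (Ideal.quotientMap I ι (le_refl (I.comap ι))) X)
    (hX : IsPureInjective X)
    (hXD : ¬ IsGeneratingMonoTriple (Ideal.quotientMap I ι (le_refl (I.comap ι))) X) :
    ∃ φ ψ : PPFormula (TripleRing ι I) 1, ¬ φ.sol X ⊆ ψ.sol X ∧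
      ∀ Y, IsGeneratingMonoTriple (Ideal.quotientMap I ι (le_refl (I.comap ι))) Y →
        φ.sol Y ⊆ ψ.sol Y := by
  refine (hX.exists_separation_or _).resolve_right ?_
  rintro ⟨K, l, ht, Y, -, hY, hr⟩
  choose M P i q hi hq _ _ using fun k => (hY k).exists_pres H hΓ hredΓ hpreΓ
  exact hXD ((hD _ _ (Presents.redProd H l fun k => ⟨P k, i k, q k, hi k, hq k⟩)).of_isRetractOf hr)

/-- Separation of `M` by pp pairs is implied by separation of its triple. -/
theorem Presents.exists_separation (H : IsHereditaryPair ι I π) (h : Presents ι I π M X)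
    (hM : IsPureInjective M) (φ ψ : PPFormula (TripleRing ι I) 1) (hφ : ¬ φ.sol X ⊆ ψ.sol X) :
    ∃ φ' ψ' : PPFormula Λ 1, ¬ φ'.sol M ⊆ ψ'.sol M ∧ ∀ M' X', Presents ι I π M' X' →
      φ.sol X' ⊆ ψ.sol X' → φ'.sol M' ⊆ ψ'.sol M' := by
  rcases hM.exists_separation_or fun M' => ∃ X', Presents ι I π M' X' ∧ φ.sol X' ⊆ ψ.sol X' with
    ⟨φ', ψ', h1, h2⟩ | ⟨K, l, ht, Y, -, hY, hr⟩
  · exact ⟨φ', ψ', h1, fun M' X' hp hs => h2 M' ⟨X', hp, hs⟩⟩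
  · choose Z hZ hZ' using hY
    exact absurd ((h.isRetractOf H (Presents.redProd H l hZ) hr).sol_subset
      (φ.sol_subset_redProd ψ l _ hZ')) hφ

/-- Separation of the triple of a complete module `M` by pp pairs is implied by separation of
`M`. A reduced product of torsion-free modules need not be reduced, but its divisible part is a
direct summand, which does not contribute to the triple. -/
theorem Presents.exists_separation_triple (H : IsHereditaryPair ι I π) (h : Presents ι I π M X)
    (hs : ∀ N : ModuleCat.{u} Λᵐᵒᵖ, (∀ n : N, baseOp Λ π • n = 0 → n = 0) →
      IsRetractOf Λᵐᵒᵖ (N ⧸ divisiblePart (baseOp Λ π) (baseOp_central Λ π) N) N)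
    (hred : IsCReduced (baseOp Λ π) M) (hpre : IsCPrecomplete (baseOp Λ π) M)
    (hX : IsPureInjective X) (φ ψ : PPFormula Λ 1) (hφ : ¬ φ.sol M ⊆ ψ.sol M) :
    ∃ φ' ψ' : PPFormula (TripleRing ι I) 1, ¬ φ'.sol X ⊆ ψ'.sol X ∧
      ∀ M' X', Presents ι I π M' X' → φ.sol M' ⊆ ψ.sol M' → φ'.sol X' ⊆ ψ'.sol X' := by
  rcases hX.exists_separation_or fun X' => ∃ M', Presents ι I π M' X' ∧ φ.sol M' ⊆ ψ.sol M' with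
    ⟨φ', ψ', h1, h2⟩ | ⟨K, l, ht, Y, hht, hY, hr⟩
  · exact ⟨φ', ψ', h1, fun M' X' hp hs => h2 X' ⟨M', hp, hs⟩⟩
  · choose Z hZ hZ' using hY
    have hN := Presents.redProd H l hZ
    have hr' := h.isRetractOf_of_triple H (hN.quotient_divisiblePart H) hred hpre
      (isCReduced_quotient_divisiblePart (baseOp_central Λ π))
      (IsCPrecomplete.quotient_divisiblePart (baseOp_central Λ π)
        (RedProd.isCPrecomplete _ hht fun k => Z k)) hr
    exact absurd ((hr'.trans (hs _ (hN.torsionFree H))).sol_subset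
      (φ.sol_subset_redProd ψ l _ hZ')) hφ

end Presents

section PresentedPoints

variable {R Λ Γ : Type u} [CommRing R] [Ring Λ] [Ring Γ] [Algebra R Λ] [Algebra R Γ]
  {ι : Λ →+* Γ} {I : Ideal Γ} [I.IsTwoSided] {π : R}
  {M M' : ModuleCat.{u} Λᵐᵒᵖ} {X X' : ModuleCat.{u} (TripleRing ι I)ᵐᵒᵖ}

/-- The triple of a complete point is a point. -/
theorem Presents.isZgModule_triple (H : IsHereditaryPair ι I π)
    (hΓ : ∀ x : Γ, baseOp Γ π • x = 0 → x = 0) (hredΓ : IsCReduced (baseOp Γ π) Γ)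
    (hpreΓ : IsCPrecomplete (baseOp Γ π) Γ) (h : Presents ι I π M X)
    (hX : IsGeneratingMonoTriple (Ideal.quotientMap I ι (le_refl (I.comap ι))) X)
    (hM : IsZgModule M) (hred : IsCReduced (baseOp Λ π) M) : IsZgModule X := by
  obtain ⟨P, i, q, hi, hq⟩ := h
  obtain ⟨hind, hpi⟩ := hM
  obtain ⟨hnt, hidem⟩ := (indecomposable_iff M).1 hind
  have hredP := hi.isCReduced H hred
  have hpreP := hi.isCPrecomplete H (hpi.isCPrecomplete _)
  exact ⟨(indecomposable_iff X).2 ⟨hq.nontrivial_of_nontrivial H hi hredP,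
    hq.hasTrivialIdempotents_triple H hΓ hredΓ hpreΓ hi hredP hpreP hX hidem⟩,
    hq.isPureInjective H hi hpi⟩

/-- Each point in `𝒟` is the triple of a reduced torsion-free point. -/
theorem IsGeneratingMonoTriple.exists_presents (H : IsHereditaryPair ι I π)
    (hΓ : ∀ x : Γ, baseOp Γ π • x = 0 → x = 0) (hredΓ : IsCReduced (baseOp Γ π) Γ)
    (hpreΓ : IsCPrecomplete (baseOp Γ π) Γ)
    (hX : IsGeneratingMonoTriple (Ideal.quotientMap I ι (le_refl (I.comap ι))) X)
    (hZ : IsZgModule X) :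
    ∃ M, Presents ι I π M X ∧ IsZgModule M ∧ IsCReduced (baseOp Λ π) M := by
  obtain ⟨M, P, i, q, hi, hq, hred, hpre⟩ := hX.exists_pres H hΓ hredΓ hpreΓ
  obtain ⟨hind, hpi⟩ := hZ
  obtain ⟨hnt, hidem⟩ := (indecomposable_iff X).1 hind
  refine ⟨M, ⟨P, i, q, hi, hq⟩, ⟨(indecomposable_iff M).2 ⟨hq.nontrivial hi,
    hq.hasTrivialIdempotents H hi hred hidem⟩,
    hq.isPureInjective_of_isPureInjective H hi hred hpre hpi⟩, fun m hm => hi.injective ?_⟩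
  rw [map_zero]
  refine hred _ fun k => ?_
  obtain ⟨y, rfl⟩ := hm k
  exact ⟨i y, (H.map_base_smul i k y).symm⟩

theorem Presents.nonempty_iso (H : IsHereditaryPair ι I π) (h : Presents ι I π M X)
    (h' : Presents ι I π M' X') (hX : IsZgModule X) (hX' : IsZgModule X') (e : M ≅ M') :
    Nonempty (X ≅ X') := by
  obtain ⟨hnt, -⟩ := (indecomposable_iff X).1 hX.1
  obtain ⟨f⟩ := ((indecomposable_iff X').1 hX'.1).2.nonempty_equiv
    (h.isRetractOf H h' (IsRetractOf.of_equiv e.toLinearEquiv))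
  exact ⟨f.toModuleIso⟩

/-- Reduced points with isomorphic triples are isomorphic. -/
theorem Presents.nonempty_iso_of_triple (H : IsHereditaryPair ι I π) (h : Presents ι I π M X)
    (h' : Presents ι I π M' X') (hM : IsZgModule M) (hM' : IsZgModule M')
    (hred : IsCReduced (baseOp Λ π) M) (hred' : IsCReduced (baseOp Λ π) M') (e : X ≅ X') :
    Nonempty (M ≅ M') := by
  obtain ⟨hnt, -⟩ := (indecomposable_iff M).1 hM.1
  obtain ⟨f⟩ := ((indecomposable_iff M').1 hM'.1).2.nonempty_equiv
    (h.isRetractOf_of_triple H h' hred (hM.2.isCPrecomplete _) hred' (hM'.2.isCPrecomplete _)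
      (IsRetractOf.of_equiv e.toLinearEquiv))
  exact ⟨f.toModuleIso⟩

end PresentedPoints

section Continuity

variable {S T : Type u} [Ring S] [Ring T]

/-- A criterion for continuity in terms of pp pairs. -/
theorem Zg.continuous_of_separation {A : Type*} [TopologicalSpace A] {f : A → Zg S} {g : A → Zg T}
    (hg : Continuous g) (h : ∀ a φ ψ, f a ∈ Zg.basicOpen φ ψ → ∃ φ' ψ',
      g a ∈ Zg.basicOpen φ' ψ' ∧ ∀ b, g b ∈ Zg.basicOpen φ' ψ' → f b ∈ Zg.basicOpen φ ψ) :
    Continuous f := by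
  refine continuous_generateFrom_iff.2 ?_
  rintro _ ⟨φ, ψ, rfl⟩
  refine isOpen_iff_forall_mem_open.2 fun a ha => ?_
  obtain ⟨φ', ψ', ha', hb⟩ := h a φ ψ ha
  exact ⟨_, hb, (Zg.isOpen_basicOpen φ' ψ').preimage hg, ha'⟩

theorem PPFormula.mem_sol_dvd {s : S} {M : Type*} [AddCommGroup M] [Module Sᵐᵒᵖ M]
    {x : Fin 1 → M} : x ∈ (PPFormula.dvd s).sol M ↔ ∃ y, x 0 = op s • y := by
  have key : ∀ y : Fin 1 → M, (∑ i : Fin 1 ⊕ Fin 1,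
      op ((PPFormula.dvd s).mat i (0 : Fin 1)) • Sum.elim x y i = 0) ↔ x 0 = op s • y 0 := by
    intro y
    rw [Fintype.sum_sum_type, Fin.sum_univ_one, Fin.sum_univ_one]
    change op (1 : S) • x 0 + op (-s) • y 0 = 0 ↔ _
    rw [op_one, one_smul, MulOpposite.op_neg, neg_smul, add_neg_eq_zero]
  constructor
  · rintro ⟨y, hy⟩
    exact ⟨y (0 : Fin 1), (key y).1 (hy (0 : Fin 1))⟩
  · rintro ⟨y, hy⟩
    refine ⟨fun _ : Fin 1 => y, fun j : Fin 1 => ?_⟩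
    rw [Subsingleton.elim j 0]
    exact (key fun _ => y).2 hy

theorem PPFormula.sol_top (M : Type*) [AddCommGroup M] [Module Sᵐᵒᵖ M] :
    (PPFormula.top S).sol M = Set.univ :=
  Set.eq_univ_of_forall fun _ => ⟨fun i : Fin 0 => i.elim0, fun j : Fin 0 => j.elim0⟩

end Continuity

/-! ### The functor on torsion-free modules -/

section FunctorF

variable {R Q Λ : Type u} [CommRing R] [Ring Λ] [Algebra R Λ]

theorem isReducedModule_iff {π : R} {M : ModuleCat.{u} Λᵐᵒᵖ} :
    IsReducedModule π M ↔ IsCReduced (baseOp Λ π) M := by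
  simp only [IsReducedModule, IsCReduced, map_pow, op_pow]

theorem IsReducedModule.of_equiv {π : R} (M N : ModuleCat.{u} Λᵐᵒᵖ) (e : N ≃ₗ[Λᵐᵒᵖ] M)
    (h : IsReducedModule π M) : IsReducedModule π N := by
  intro n hn
  refine e.map_eq_zero_iff.1 (h _ fun i => ?_)
  obtain ⟨m, rfl⟩ := hn i
  exact ⟨e m, (map_smul e _ m).symm⟩

variable [IsDomain R] [Field Q] [Algebra R Q] [IsFractionRing R Q]
  {Γ : Subalgebra R (Q ⊗[R] Λ)}
  (hΓ : (Algebra.TensorProduct.includeRight : Λ →ₐ[R] Q ⊗[R] Λ).range ≤ Γ)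
  (I : Ideal Γ) [I.IsTwoSided] {π : R}

attribute [local instance] moduleOverBase moduleOverBase_isScalarTower

omit [IsDomain R] in
theorem smul_eq_zero_of_isTorsionFreeModule {M : ModuleCat.{u} Λᵐᵒᵖ}
    (hM : IsTorsionFreeModule R M) (r : R) (m : M) (h : r • m = 0) : r = 0 ∨ m = 0 :=
  hM r m (by rwa [← baseOp_smul_eq (Λ := Λ)] at h)

/-- The module `𝔽 M` is presented by `M`. -/
theorem presents_functorF (h0 : π ≠ 0) (hI : ∀ x ∈ I, ∃ s, orderIncl hΓ s = x) (M : Tf R Λ) :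
    Presents (orderIncl hΓ) I π M.obj ((functorF hΓ I).obj M) :=
  ⟨ModuleCat.of Γᵐᵒᵖ (ModΓ Γ M.obj), inclMΓ hΓ M.obj, tripleMk M.obj hΓ I,
    isHull_inclMΓ hΓ h0 (smul_eq_zero_of_isTorsionFreeModule M.property),
    isTriplePres_tripleMk hΓ I h0 (smul_eq_zero_of_isTorsionFreeModule M.property) hI⟩

theorem isGeneratingMonoTriple_functorF (h0 : π ≠ 0) (H : IsHereditaryPair (orderIncl hΓ) I π)
    (M : Tf R Λ) : IsGeneratingMonoTriple (quotIncl hΓ I) ((functorF hΓ I).obj M) := by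
  have hM := smul_eq_zero_of_isTorsionFreeModule M.property
  have hpres := isTriplePres_tripleMk hΓ I h0 hM H.exists_preimage
  refine ⟨quotM hΓ I M.obj, quotMΓ I M.obj, _, _, _, _, sigma hΓ I M.obj, ?_, ?_,
    IsReductionMod.projective H (isHull_inclMΓ hΓ h0 hM).torsionFree
      (isReductionMod_mkQuotMΓ I), ⟨Iso.refl _⟩⟩
  · rw [injective_iff_map_eq_zero]
    intro x hx
    obtain ⟨m, rfl⟩ := Submodule.Quotient.mk_surjective _ x
    rw [sigma_mk, Submodule.Quotient.mk_eq_zero, subMΓI_eq_rightMul] at hx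
    exact congrArg Prod.fst ((hpres.apply_eq_zero m 0).2 ⟨hx, zero_mem _⟩)
  · rw [eq_top_iff]
    rintro x -
    obtain ⟨p, rfl⟩ := Submodule.Quotient.mk_surjective _ x
    have hp : p ∈ Submodule.span Γᵐᵒᵖ (Set.range (inclMΓ hΓ M.obj)) :=
      (isHull_inclMΓ hΓ h0 hM).span_range ▸ Submodule.mem_top
    induction hp using Submodule.span_induction with
    | mem x hx =>
      obtain ⟨m, rfl⟩ := hx
      exact Submodule.subset_span ⟨Submodule.Quotient.mk m, rfl⟩
    | zero => exact zero_mem _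
    | add x y _ _ hx hy => exact add_mem hx hy
    | smul γ x _ hx =>
      exact Submodule.smul_mem _ (op (Ideal.Quotient.mk I γ.unop)) hx

theorem Presents.isGeneratingMonoTriple (h0 : π ≠ 0) (H : IsHereditaryPair (orderIncl hΓ) I π)
    (htf : ∀ M : ModuleCat.{u} Λᵐᵒᵖ, (∀ m : M, baseOp Λ π • m = 0 → m = 0) →
      IsTorsionFreeModule R M)
    {M : ModuleCat.{u} Λᵐᵒᵖ} {X : ModuleCat.{u} (TripleRing (orderIncl hΓ) I)ᵐᵒᵖ}
    (h : Presents (orderIncl hΓ) I π M X) : IsGeneratingMonoTriple (quotIncl hΓ I) X := by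
  let M' : Tf R Λ := ⟨M, htf M (h.torsionFree H)⟩
  obtain ⟨e⟩ := h.nonempty_equiv H (presents_functorF hΓ I h0 H.exists_preimage M')
  exact (isGeneratingMonoTriple_functorF hΓ I h0 H M').of_equiv e

end FunctorF

section Reduced

variable {R Q Λ : Type u} [CommRing R] [IsDomain R] [IsDiscreteValuationRing R] {π : R}
  [Field Q] [Algebra R Q] [IsFractionRing R Q] [Ring Λ] [Algebra R Λ]

attribute [local instance] moduleOverBase moduleOverBase_isScalarTower

theorem isRetractOf_quotient_divisiblePart
    (hπ : IsLocalRing.maximalIdeal R = Ideal.span {π}) (hA : IsSemisimpleRing (Q ⊗[R] Λ))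
    (N : ModuleCat.{u} Λᵐᵒᵖ) (hN : ∀ n : N, baseOp Λ π • n = 0 → n = 0) :
    IsRetractOf Λᵐᵒᵖ (N ⧸ divisiblePart (baseOp Λ π) (baseOp_central Λ π) N) N := by
  obtain ⟨ρ, h1, h2⟩ := exists_retraction_divisiblePart (Q := Q) hπ hN
  refine ⟨(divisiblePart (baseOp Λ π) (baseOp_central Λ π) N).liftQ (LinearMap.id - ρ)
    fun n hn => ?_, (divisiblePart (baseOp Λ π) (baseOp_central Λ π) N).mkQ, fun x => ?_⟩
  · rw [LinearMap.mem_ker, LinearMap.sub_apply, LinearMap.id_apply, h2 n hn, sub_self]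
  · obtain ⟨n, rfl⟩ := Submodule.mkQ_surjective _ x
    change Submodule.Quotient.mk (n - ρ n) = Submodule.Quotient.mk n
    rw [Submodule.Quotient.mk_sub, (Submodule.Quotient.mk_eq_zero _).2 (h1 n), sub_zero]

/-- An indecomposable torsion-free module is reduced or divisible, as its divisible part is a
direct summand. -/
theorem isCReduced_iff_exists_not_dvd
    (hπ : IsLocalRing.maximalIdeal R = Ideal.span {π}) (hA : IsSemisimpleRing (Q ⊗[R] Λ))
    {M : ModuleCat.{u} Λᵐᵒᵖ} (hM : ∀ m : M, baseOp Λ π • m = 0 → m = 0) (hind : Indecomposable M) :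
    IsCReduced (baseOp Λ π) M ↔ ∃ m : M, ∀ y : M, m ≠ baseOp Λ π • y := by
  obtain ⟨hnt, hidem⟩ := (indecomposable_iff M).1 hind
  constructor
  · intro hred
    by_contra! h
    obtain ⟨m, hm⟩ := exists_ne (0 : M)
    refine hm (hred m fun k => ?_)
    induction k with
    | zero => exact ⟨m, by simp⟩
    | succ k ih =>
      obtain ⟨y, rfl⟩ := ih
      obtain ⟨z, rfl⟩ := h y
      exact ⟨z, by rw [pow_succ, mul_smul]⟩
  · rintro ⟨m, hm⟩ x hx
    obtain ⟨ρ, h1, h2⟩ := exists_retraction_divisiblePart (Q := Q) hπ hM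
    rcases hidem ρ (fun x => h2 _ (h1 x)) with h | h
    · rw [← h2 x hx, h]
    · obtain ⟨y, hy⟩ := h1 m 1
      rw [pow_one, h] at hy
      exact absurd hy.symm (hm y)

end Reduced

/-! ### The homeomorphism -/

theorem mainTheorem3 {R Q Λ : Type u}
    [CommRing R] [IsDomain R] [IsDiscreteValuationRing R]
    [IsAdicComplete (IsLocalRing.maximalIdeal R) R]
    (π : R) (hπ : IsLocalRing.maximalIdeal R = Ideal.span {π})
    [Field Q] [Algebra R Q] [IsFractionRing R Q]
    [Ring Λ] [Algebra R Λ] [Module.Finite R Λ] [Module.IsTorsionFree R Λ]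
    (hA : IsSeparableAlg Q (Q ⊗[R] Λ))
    (Γ : Subalgebra R (Q ⊗[R] Λ)) [Module.Finite R Γ]
    (hΓ : (Algebra.TensorProduct.includeRight : Λ →ₐ[R] Q ⊗[R] Λ).range ≤ Γ)
    (hher : IsRightHereditary Γ)
    (I : Ideal Γ) [I.IsTwoSided]
    (hI : ∀ x ∈ I, ∃ s ∈ Ring.jacobson Λ, orderIncl hΓ s = x)
    (hπI : ∃ n : ℕ, algebraMap R Γ (π ^ n) ∈ I) :
    ZgTf.reduced Λ π = ZgTf.notDivisible Λ π ∧
    IsOpen (ZgTf.reduced Λ π) ∧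
    IsClosed (ZgD hΓ I) ∧
    ∃ e : ZgTf.reduced Λ π ≃ₜ ZgD hΓ I,
      ∀ (M : Tf R Λ) (hM : IsZgModule M.obj) (hM' : IsReducedModule π M.obj),
        ∃ hF : IsZgModule ((functorF hΓ I).obj M),
          (e ⟨⟨Zg.mk M.obj hM, M.obj, hM, rfl, M.property⟩, M.obj, hM, rfl, hM'⟩ :
            Zg (RingD hΓ I)) = Zg.mk ((functorF hΓ I).obj M) hF := by
  have h0 : π ≠ 0 := uniformizer_ne_zero hπ
  have hss : IsSemisimpleRing (Q ⊗[R] Λ) :=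
    have := hA.2 Q
    (Algebra.TensorProduct.lid Q (Q ⊗[R] Λ)).toRingEquiv.isSemisimpleRing
  have H : IsHereditaryPair (orderIncl hΓ) I π := isHereditaryPair_orderIncl hΓ hπ hher I hI hπI
  have : Module.IsTorsionFree R (Q ⊗[R] Λ) := Module.IsTorsionFree.trans Q
  obtain ⟨hredΓ, hpreΓ⟩ := isCReduced_order hπ Γ
  have hΓtf : ∀ x : Γ, baseOp Γ π • x = 0 → x = 0 := fun x hx => by
    rw [op_smul_eq_mul, ← Algebra.commutes, ← Algebra.smul_def] at hx
    exact (smul_eq_zero.1 hx).resolve_left h0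
  have htf : ∀ M : ModuleCat.{u} Λᵐᵒᵖ, (∀ m : M, baseOp Λ π • m = 0 → m = 0) →
      IsTorsionFreeModule R M := fun M => torsionFree_of_uniformizer hπ
  have htf' : ∀ M : ModuleCat.{u} Λᵐᵒᵖ, IsTorsionFreeModule R M →
      ∀ m : M, baseOp Λ π • m = 0 → m = 0 := fun M hM m hm => (hM π m hm).resolve_left h0
  have hD : ∀ (M : ModuleCat.{u} Λᵐᵒᵖ) (X : ModuleCat.{u} (TripleRing (orderIncl hΓ) I)ᵐᵒᵖ),
      Presents (orderIncl hΓ) I π M X → IsGeneratingMonoTriple (quotIncl hΓ I) X :=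
    fun M X h => h.isGeneratingMonoTriple hΓ I h0 H htf
  have hs := isRetractOf_quotient_divisiblePart (Q := Q) (Λ := Λ) hπ hss
  have hF := presents_functorF (R := R) hΓ I h0 H.exists_preimage
  have hDF := isGeneratingMonoTriple_functorF hΓ I h0 H
  have hDmem : ∀ {X : ModuleCat.{u} (RingD hΓ I)ᵐᵒᵖ} {hX : IsZgModule X},
      Zg.mk X hX ∈ ZgD hΓ I ↔ IsGeneratingMonoTriple (quotIncl hΓ I) X :=
    Zg.mk_mem_inter fun X Y e h => h.of_equiv e
  -- the reduced points are the points outside the closed set of divisible points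
  have heq : ZgTf.reduced Λ π = ZgTf.notDivisible Λ π := by
    ext ⟨_, M, hM, rfl, hMtf⟩
    have hr : Zg.mk M hM ∈ Zg.inter Λ (IsReducedModule π) ↔ IsReducedModule π M :=
      Zg.mk_mem_inter IsReducedModule.of_equiv
    change Zg.mk M hM ∈ Zg.inter Λ (IsReducedModule π) ↔
      Zg.mk M hM ∈ Zg.basicOpen (PPFormula.top Λ) (PPFormula.dvd (algebraMap R Λ π))
    rw [hr, isReducedModule_iff, isCReduced_iff_exists_not_dvd hπ hss (htf' M hMtf) hM.1,
      Zg.mk_mem_basicOpen, PPFormula.sol_top, Set.univ_subset_iff, Set.eq_univ_iff_forall]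
    simp only [PPFormula.mem_sol_dvd]
    push Not
    exact ⟨fun ⟨m, hm⟩ => ⟨fun _ => m, hm⟩, fun ⟨x, hx⟩ => ⟨x 0, hx⟩⟩
  -- representatives of the reduced points
  have hrep : ∀ p : ZgTf.reduced Λ π, ∃ (M : Tf R Λ) (hM : IsZgModule M.obj)
      (_ : IsReducedModule π M.obj), (p.1.1 : Zg Λ) = Zg.mk M.obj hM := by
    rintro ⟨⟨_, M, hM, rfl, hMtf⟩, hp⟩
    exact ⟨⟨M, hMtf⟩, hM, (Zg.mk_mem_inter IsReducedModule.of_equiv).1 hp, rfl⟩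
  choose M hM hMred hMp using hrep
  have hZ : ∀ (N : Tf R Λ), IsZgModule N.obj → IsReducedModule π N.obj →
      IsZgModule ((functorF hΓ I).obj N) := fun N hN hred =>
    (hF N).isZgModule_triple H hΓtf hredΓ hpreΓ (hDF N) hN (isReducedModule_iff.1 hred)
  let f : ZgTf.reduced Λ π → ZgD hΓ I := fun p =>
    ⟨Zg.mk _ (hZ (M p) (hM p) (hMred p)), hDmem.2 (hDF (M p))⟩
  have hf : ∀ (N : Tf R Λ) (hN : IsZgModule N.obj) (hN' : IsReducedModule π N.obj),
      (f ⟨⟨Zg.mk N.obj hN, N.obj, hN, rfl, N.property⟩, N.obj, hN, rfl, hN'⟩ : Zg (RingD hΓ I))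
        = Zg.mk _ (hZ N hN hN') := by
    intro N hN hN'
    obtain ⟨e⟩ := Zg.mk_eq_mk.1
      (hMp ⟨⟨Zg.mk N.obj hN, N.obj, hN, rfl, N.property⟩, N.obj, hN, rfl, hN'⟩)
    exact Zg.mk_eq_mk.2 ((hF _).nonempty_iso H (hF N) (hZ _ (hM _) (hMred _)) (hZ N hN hN') e.symm)
  have hfinj : Function.Injective f := by
    intro p p' h
    obtain ⟨e⟩ := Zg.mk_eq_mk.1 (congrArg Subtype.val h)
    refine Subtype.ext (Subtype.ext ?_)
    rw [hMp p, hMp p']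
    exact Zg.mk_eq_mk.2 ((hF _).nonempty_iso_of_triple H (hF _) (hM p) (hM p')
      (isReducedModule_iff.1 (hMred p)) (isReducedModule_iff.1 (hMred p')) e)
  have hfsurj : Function.Surjective f := by
    rintro ⟨_, X, hX, rfl, hXD⟩
    obtain ⟨N, hN, hNZ, hNred⟩ := hXD.exists_presents H hΓtf hredΓ hpreΓ hX
    let N' : Tf R Λ := ⟨N, htf N (hN.torsionFree H)⟩
    have hN' : IsReducedModule π N'.obj := isReducedModule_iff.2 hNred
    refine ⟨⟨⟨Zg.mk N hNZ, N, hNZ, rfl, N'.property⟩, N, hNZ, rfl, hN'⟩, Subtype.ext ?_⟩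
    obtain ⟨e⟩ := (hF N').nonempty_equiv H hN
    exact (hf N' hNZ hN').trans (Zg.mk_eq_mk.2 ⟨e.toModuleIso⟩)
  let e := Equiv.ofBijective f ⟨hfinj, hfsurj⟩
  have hp : Continuous fun p : ZgTf.reduced Λ π => (p.1.1 : Zg Λ) :=
    continuous_subtype_val.comp continuous_subtype_val
  have hcont : Continuous f := by
    refine Continuous.subtype_mk (Zg.continuous_of_separation hp fun p φ ψ hφ => ?_) _
    obtain ⟨φ', ψ', h1, h2⟩ := (hF (M p)).exists_separation H (hM p).2 φ ψ
      (Zg.mk_mem_basicOpen.1 hφ)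
    refine ⟨φ', ψ', ?_, fun p' hp' => ?_⟩
    · rw [hMp]
      exact Zg.mk_mem_basicOpen.2 h1
    · rw [hMp] at hp'
      exact Zg.mk_mem_basicOpen.2 fun h => Zg.mk_mem_basicOpen.1 hp' (h2 _ _ (hF (M p')) h)
  have hcont' : Continuous e.symm := by
    have hq : ∀ q : ZgD hΓ I, (q : Zg (RingD hΓ I)) =
        Zg.mk _ (hZ _ (hM (e.symm q)) (hMred (e.symm q))) :=
      fun q => congrArg Subtype.val (e.apply_symm_apply q).symm
    refine continuous_induced_rng.2 (continuous_induced_rng.2 ?_)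
    refine Zg.continuous_of_separation (g := fun q : ZgD hΓ I => (q : Zg (RingD hΓ I)))
      continuous_subtype_val fun q φ ψ hφ => ?_
    change (e.symm q).1.1 ∈ _ at hφ
    rw [hMp] at hφ
    obtain ⟨φ', ψ', h1, h2⟩ := (hF (M (e.symm q))).exists_separation_triple H hs
      (isReducedModule_iff.1 (hMred _)) ((hM (e.symm q)).2.isCPrecomplete _)
      (hZ _ (hM (e.symm q)) (hMred _)).2 φ ψ (Zg.mk_mem_basicOpen.1 hφ)
    refine ⟨φ', ψ', ?_, fun q' hq' => ?_⟩
    · rw [hq]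
      exact Zg.mk_mem_basicOpen.2 h1
    · change (e.symm q').1.1 ∈ _
      rw [hMp]
      rw [hq] at hq'
      exact Zg.mk_mem_basicOpen.2 fun h => Zg.mk_mem_basicOpen.1 hq' (h2 _ _ (hF _) h)
  refine ⟨heq, ?_, ?_, ⟨e, hcont, hcont'⟩, fun N hN hN' => ⟨hZ N hN hN', hf N hN hN'⟩⟩
  · rw [heq]
    exact (Zg.isOpen_basicOpen _ _).preimage continuous_subtype_val
  · rw [← isOpen_compl_iff]
    refine isOpen_iff_forall_mem_open.2 fun x hx => ?_
    obtain ⟨⟨X, hX⟩, rfl⟩ := Quotient.exists_rep x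
    change Zg.mk X hX ∉ ZgD hΓ I at hx
    rw [hDmem] at hx
    obtain ⟨φ, ψ, h1, h2⟩ := hX.2.exists_separation_of_not_mem H hΓtf hredΓ hpreΓ hD hx
    refine ⟨Zg.basicOpen φ ψ, ?_, Zg.isOpen_basicOpen φ ψ, Zg.mk_mem_basicOpen.2 h1⟩
    rintro _ hy ⟨Y, hY, rfl, hYD⟩
    exact Zg.mk_mem_basicOpen.1 hy (h2 Y hYD)
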